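/- **Conventions.** Let $\mathfrak g_N=\mathfrak o_N$ (orthogonal case) or $\mathfrak g_N=\mathfrak{sp}_N$ (symplectic case, $N$ even). Rows and columns of $N\times N$ matrices are numbered by $\{-n,\dots,n\}$ if $N=2n+1$ and by $\{-n,\dots,-1,1,\dots,n\}$ if $N=2n$ (so $0$ is omitted in this case). Put $\theta_{ij}=1$ in the orthogonal case and $\theta_{ij}=\operatorname{sgn} i\cdot\operatorname{sgn} j$ in the symplectic case. The *extended twisted Yangian* $\mathrm X(\mathfrak g_N)$ is the associative unital algebra over $\mathbb C$ with generators $s_{ij}^{(r)}$, $r\ge 1$, and the defining relations, for $s_{ij}(u)=\delta_{ij}+\sum_{r\ge1}s^{(r)}_{ij}u^{-r}$, $$\begin{aligned}(u^2-v^2)[s_{ij}(u),s_{kl}(v)]&=(u+v)\big(s_{kj}(u)s_{il}(v)-s_{kj}(v)s_{il}(u)\big)\\&\quad-(u-v)\big(\theta_{k,-j}s_{i,-k}(u)s_{-j,l}(v)-\theta_{i,-l}s_{k,-i}(v)s_{-l,j}(u)\big)\\&\quad+\theta_{i,-j}\big(s_{k,-i}(u)s_{-j,l}(v)-s_{k,-i}(v)s_{-j,l}(u)\big).\end{aligned}$$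 Set $S(u)=(s_{ij}(u))$. *Sklyanin minors.* Let $S(u)$ be any matrix of formal series in $u^{-1}$ over an associative unital $\mathbb C$-algebra, with rows and columns numbered by a finite set $I\subset\mathbb Z$ with $I=-I$. For $k\ge 0$ work in $(\operatorname{End}\mathbb C^I)^{\otimes k}$ with coefficients series in $u^{-1}$. Let $u_i=u-i+1$, let $S_i$ be $S(u_i)$ acting in the $i$-th copy, $Q=\sum_{i,j}\theta_{ij}\,e_{-j,-i}\otimes e_{ji}$, $R^t_{ij}=1+(u_i+u_j)^{-1}Q_{ij}$ (expanded in $u^{-1}$), $A_k=\sum_{\sigma\in\mathfrak S_k}\operatorname{sgn}\sigma\,P_\sigma$, and $$\langle S_1,\dots,S_k\rangle=S_1(R^t_{12}\cdots R^t_{1k})S_2(R^t_{23}\cdots R^t_{2k})\cdots S_k .$$ The Sklyanin minor $s^{a_1\cdots a_k}_{b_1\cdots b_k}(u)$ is the coefficient of $e_{a_1b_1}\otimes\cdots\otimes e_{a_kb_k}$ in $A_k\langle S_1,\dots,S_k\rangle$. The Sklyanin determinant $\operatorname{sdet}S(u)$ is the Sklyanin minor whose rows and columns are all the elements of $I$ in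 increasing order (so it is $1$ if $I=\emptyset$). Fix integers $0\le m<n$ and set $M=2m$ if $N=2n$ and $M=2m+1$ if $N=2n+1$. Let $\mathcal B$ be the set of row numbers $i$ of $N\times N$ matrices with $-m\le i\le m$, and let $\mathcal A$ be the set of the remaining row numbers; the generator series of $\mathrm X(\mathfrak g_{N-M})$ are numbered by $a,b\in\mathcal A$. For $a,b\in\mathcal A$ put $$s^\sharp_{ab}(u)=s^{-m\cdots m,\,a}_{-m\cdots m,\,b}(u+M/2)\in \mathrm X(\mathfrak g_N)[[u^{-1}]],$$ where the indices $-m,\dots,m$ run over $\mathcal B$ in increasing order. Let $S^\sharp(u)=(s^\sharp_{ab}(u))_{a,b\in\mathcal A}$ and $S_{\mathcal B\mathcal B}(u)=(s_{ij}(u))_{i,j\in\mathcal B}$. **Theorem 2.6** (quantum Sylvester theorem for $\mathrm X(\mathfrak g_N)$). The assignment $s_{ab}(u)\mapsto s^\sharp_{ab}(u)$, $a,b\in\mathcal A$, defines an algebra homomorphism $\mathrm X(\mathfrak g_{N-M})\to\mathrm X(\mathfrak g_N)$. Moreover, $$\operatorname{sdet}S^\sharp(u)=\operatorname{sdet}S(u+M/2)\;\operatorname{sdet}S_{\mathcal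 B\mathcal B}(u+M/2-1)\cdots\operatorname{sdet}S_{\mathcal B\mathcal B}(u+M/2-N+M+1).$$ -/

import Mathlib

open scoped PowerSeries

noncomputable section

namespace TwistedYangian

/-- The two series of Lie algebras: `𝔤_N = 𝔬_N` or `𝔤_N = 𝔰𝔭_N`. -/
inductive CaseType
  | orthogonal
  | symplectic

/-- `θ_{ij}`: `1` in the orthogonal case and `sgn i * sgn j` in the symplectic case. -/
def theta : CaseType → ℤ → ℤ → ℤ
  | .orthogonal, _, _ => 1
  | .symplectic, i, j => i.sign * j.sign

/-! ### Index sets -/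

/-- A finite set of integers, closed under `i ↦ -i`, used to number rows and columns. -/
structure IndexSet where
  carrier : Finset ℤ
  neg_mem : ∀ i ∈ carrier, -i ∈ carrier

/-- The type of indices in `I`, with its negation and the order inherited from `ℤ`. -/
abbrev IndexSet.Idx (I : IndexSet) : Type := ↥I.carrier

instance (I : IndexSet) : Neg I.Idx := ⟨fun i => ⟨-i.1, I.neg_mem i.1 i.2⟩⟩

/-- `{-n, …, n}` if `N = 2n + 1`, and `{-n, …, -1, 1, …, n}` if `N = 2n`. -/
def indexSet (N : ℕ) : IndexSet where
  carrier := (Finset.Icc (-((N / 2 : ℕ) : ℤ)) ((N / 2 : ℕ) : ℤ)).filter (fun i => i ≠ 0 ∨ Odd N)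
  neg_mem := by
    intro i hi
    simp only [Finset.mem_filter, Finset.mem_Icc] at hi ⊢
    refine ⟨by omega, ?_⟩
    rcases hi.2 with h | h
    · exact Or.inl (by omega)
    · exact Or.inr h

/-- The complement of `J` in `I`. -/
def IndexSet.compl (I J : IndexSet) : IndexSet where
  carrier := I.carrier \ J.carrier
  neg_mem := by
    intro i hi
    rw [Finset.mem_sdiff] at hi ⊢
    exact ⟨I.neg_mem i hi.1, fun h => hi.2 (by simpa using J.neg_mem _ h)⟩

/-- The inclusion of the complement of `J` in `I` into `I`. -/
def IndexSet.complIncl (I J : IndexSet) (a : (I.compl J).Idx) : I.Idx :=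
  ⟨a.1, (Finset.mem_sdiff.mp a.2).1⟩

/-- The inclusion of `J` into `I` when `J ⊆ I`. -/
def IndexSet.incl {J I : IndexSet} (h : J.carrier ⊆ I.carrier) (b : J.Idx) : I.Idx :=
  ⟨b.1, h b.2⟩

/-- The elements of `I` in increasing order. -/
def IndexSet.enum (I : IndexSet) (r : Fin I.carrier.card) : I.Idx :=
  I.carrier.orderIsoOfFin rfl r

theorem indexSet_subset {M N : ℕ} (h : M ≤ N) (hpar : Even M ↔ Even N) :
    (indexSet M).carrier ⊆ (indexSet N).carrier := by
  intro i hi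
  simp only [indexSet, Finset.mem_filter, Finset.mem_Icc] at hi ⊢
  have h2 : M / 2 ≤ N / 2 := Nat.div_le_div_right h
  refine ⟨by omega, ?_⟩
  rcases hi.2 with h' | h'
  · exact Or.inl h'
  · refine Or.inr ?_
    rw [← Nat.not_even_iff_odd] at h' ⊢
    exact fun hN => h' (hpar.mpr hN)

/-! ### The extended twisted Yangian -/

/-- The defining relations of the extended twisted Yangian, for a matrix `S(u)` of formal
series in `u⁻¹` over `A`. Series in `u⁻¹, v⁻¹` are elements of `A⟦X⟧⟦X⟧`; the inner variable is
`x = u⁻¹` and the outer variable is `y = v⁻¹`. Both sides of the relation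
`(u² - v²) [s_ij(u), s_kl(v)] = …` are multiplied by `u⁻² v⁻²`, so that
`u² - v²`, `u + v`, `u - v`, `1` become
`y² - x²`, `x y (x + y)`, `x y (y - x)`, `x² y²`, respectively. -/
def relLHS {A : Type*} [Ring A] {I : IndexSet}
    (S : Matrix I.Idx I.Idx A⟦X⟧) (i j k l : I.Idx) : A⟦X⟧⟦X⟧ :=
  let x : A⟦X⟧⟦X⟧ := PowerSeries.C (PowerSeries.X : A⟦X⟧)
  let y : A⟦X⟧⟦X⟧ := PowerSeries.X
  let su : I.Idx → I.Idx → A⟦X⟧⟦X⟧ := fun p q => PowerSeries.C (S p q)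
  let sv : I.Idx → I.Idx → A⟦X⟧⟦X⟧ := fun p q => PowerSeries.map (PowerSeries.C (R := A)) (S p q)
  (y ^ 2 - x ^ 2) * (su i j * sv k l - sv k l * su i j)

/-- The right hand side of the defining relations, see `relLHS`. -/
def relRHS (t : CaseType) {A : Type*} [Ring A] {I : IndexSet}
    (S : Matrix I.Idx I.Idx A⟦X⟧) (i j k l : I.Idx) : A⟦X⟧⟦X⟧ :=
  let x : A⟦X⟧⟦X⟧ := PowerSeries.C (PowerSeries.X : A⟦X⟧)
  let y : A⟦X⟧⟦X⟧ := PowerSeries.X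
  let su : I.Idx → I.Idx → A⟦X⟧⟦X⟧ := fun p q => PowerSeries.C (S p q)
  let sv : I.Idx → I.Idx → A⟦X⟧⟦X⟧ := fun p q => PowerSeries.map (PowerSeries.C (R := A)) (S p q)
  x * y * (x + y) * (su k j * sv i l - sv k j * su i l)
    - x * y * (y - x) *
      ((theta t k (-j) : A⟦X⟧⟦X⟧) * (su i (-k) * sv (-j) l)
        - (theta t i (-l) : A⟦X⟧⟦X⟧) * (sv k (-i) * su (-l) j))
    + x ^ 2 * y ^ 2 * ((theta t i (-j) : A⟦X⟧⟦X⟧) *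
      (su k (-i) * sv (-j) l - sv k (-i) * su (-j) l))

/-- The free algebra on the symbols `s_ij^{(r+1)}`, indexed by `(i, j, r)` with `r ≥ 0`. -/
abbrev FreeGen (I : IndexSet) : Type := FreeAlgebra ℂ (I.Idx × I.Idx × ℕ)

/-- The matrix of series `δ_ij + s_ij^{(1)} u⁻¹ + s_ij^{(2)} u⁻² + ⋯` over the free algebra. -/
def freeSeries (I : IndexSet) : Matrix I.Idx I.Idx (FreeGen I)⟦X⟧ := fun i j =>
  PowerSeries.mk fun r =>
    match r with
    | 0 => if i = j then 1 else 0
    | r + 1 => FreeAlgebra.ι ℂ (i, j, r)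

/-- The defining relations, coefficient by coefficient. -/
def Rel (t : CaseType) (I : IndexSet) (a b : FreeGen I) : Prop :=
  ∃ (i j k l : I.Idx) (p q : ℕ),
    a = PowerSeries.coeff p (PowerSeries.coeff q (relLHS (freeSeries I) i j k l)) ∧
    b = PowerSeries.coeff p (PowerSeries.coeff q (relRHS t (freeSeries I) i j k l))

/-- The extended twisted Yangian whose generator series are numbered by `I`; for
`I = indexSet N` this is `X(𝔤_N)`. -/
def ExtYangian (t : CaseType) (I : IndexSet) : Type := RingQuot (Rel t I)

instance (t : CaseType) (I : IndexSet) : Ring (ExtYangian t I) :=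
  inferInstanceAs (Ring (RingQuot (Rel t I)))

instance (t : CaseType) (I : IndexSet) : Algebra ℂ (ExtYangian t I) :=
  inferInstanceAs (Algebra ℂ (RingQuot (Rel t I)))

/-- The canonical projection from the free algebra. -/
def proj (t : CaseType) (I : IndexSet) : FreeGen I →ₐ[ℂ] ExtYangian t I :=
  RingQuot.mkAlgHom ℂ (Rel t I)

/-- The matrix `S(u)` of generator series of the extended twisted Yangian. -/
def genMatrix (t : CaseType) (I : IndexSet) : Matrix I.Idx I.Idx (ExtYangian t I)⟦X⟧ :=
  fun i j => PowerSeries.map (proj t I : FreeGen I →+* ExtYangian t I) (freeSeries I i j)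

/-! ### Sklyanin minors -/

section Minors

variable {A : Type*} [Ring A] [Algebra ℂ A]

/-- For `f(u) = ∑ f_r u^{-r}`, the series `f(u + c) = ∑ f_r (u + c)^{-r}` expanded in `u⁻¹`,
where `(u + c)⁻¹ = u⁻¹ (1 + c u⁻¹)⁻¹`. -/
def shift (c : ℂ) (f : A⟦X⟧) : A⟦X⟧ :=
  PowerSeries.mk fun d => ∑ r ∈ Finset.range (d + 1),
    PowerSeries.coeff d
      (((PowerSeries.X : ℂ⟦X⟧) * (1 + PowerSeries.C c * PowerSeries.X)⁻¹) ^ r) •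
      PowerSeries.coeff r f

/-- The rational function `(2u - c)⁻¹ = u⁻¹ (2 - c u⁻¹)⁻¹` as a series in `u⁻¹`. -/
def invTwoSub (A : Type*) [Ring A] [Algebra ℂ A] (c : ℂ) : A⟦X⟧ :=
  PowerSeries.map (algebraMap ℂ A)
    ((PowerSeries.X : ℂ⟦X⟧) * (2 - PowerSeries.C c * PowerSeries.X)⁻¹)

/-- The algebra `A⟦u⁻¹⟧ ⊗ (End ℂ^I)^{⊗ k}`; the entry in row `p` and column `q` is the
coefficient of `e_{p_1 q_1} ⊗ ⋯ ⊗ e_{p_k q_k}`. -/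
abbrev TensorEnd (A : Type*) (I : IndexSet) (k : ℕ) : Type _ :=
  Matrix (Fin k → I.Idx) (Fin k → I.Idx) A⟦X⟧

/-- The matrix `S` acting on the `a`-th copy of `End ℂ^I`. -/
def onSite {I : IndexSet} {k : ℕ} (S : Matrix I.Idx I.Idx A⟦X⟧) (a : Fin k) :
    TensorEnd A I k := fun p q =>
  if ∀ c, c ≠ a → p c = q c then S (p a) (q a) else 0

/-- `Q_{ab}`, where `Q = ∑ θ_ij e_{-j,-i} ⊗ e_{ji}`. -/
def opQ (A : Type*) [Ring A] (t : CaseType) {I : IndexSet} {k : ℕ} (a b : Fin k) :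
    TensorEnd A I k := fun p q =>
  if p a = -p b ∧ q a = -q b ∧ ∀ c, c ≠ a → c ≠ b → p c = q c then
    (theta t (q b) (p b) : A⟦X⟧) else 0

/-- `R^t_{ab}(-u_a - u_b) = 1 + Q_{ab} (u_a + u_b)⁻¹`. The copies are numbered from `0`, so that
`u_a = u - a` and `u_a + u_b = 2u - (a + b)`. -/
def opRt (A : Type*) [Ring A] [Algebra ℂ A] (t : CaseType) {I : IndexSet} {k : ℕ}
    (a b : Fin k) : TensorEnd A I k :=
  1 + invTwoSub A (((a : ℕ) : ℂ) + ((b : ℕ) : ℂ)) • opQ A t a b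

/-- `⟨S_1, …, S_k⟩ = S_1 (R^t_{12} ⋯ R^t_{1k}) S_2 (R^t_{23} ⋯ R^t_{2k}) ⋯ S_k`, where `S_a` is
`S(u_a)` in the `a`-th copy. -/
def bracketProd (t : CaseType) {I : IndexSet} (S : Matrix I.Idx I.Idx A⟦X⟧) (k : ℕ) :
    TensorEnd A I k :=
  ((List.finRange k).map fun a : Fin k =>
    onSite (fun i j => shift (-((a : ℕ) : ℂ)) (S i j)) a *
      (((List.finRange k).filter fun b : Fin k => a < b).map fun b : Fin k => opRt A t a b).prod).prod

/-- The operator `P_σ` permuting the tensor factors. -/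
def opPerm (A : Type*) [Ring A] {I : IndexSet} {k : ℕ} (σ : Equiv.Perm (Fin k)) :
    TensorEnd A I k := fun p q =>
  if ∀ c, p (σ c) = q c then 1 else 0

/-- The anti-symmetrization operator `A_k = ∑ sgn σ P_σ`. -/
def antisymmetrizer (A : Type*) [Ring A] (I : IndexSet) (k : ℕ) : TensorEnd A I k :=
  ∑ σ : Equiv.Perm (Fin k), ((Equiv.Perm.sign σ : ℤ) : ℤ) • opPerm A σ

/-- The Sklyanin minor with rows `a_1, …, a_k` and columns `b_1, …, b_k` of the matrix `S(u)`. -/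
def sklyaninMinor (t : CaseType) {I : IndexSet} (S : Matrix I.Idx I.Idx A⟦X⟧) {k : ℕ}
    (a b : Fin k → I.Idx) : A⟦X⟧ :=
  (antisymmetrizer A I k * bracketProd t S k) a b

/-- The Sklyanin determinant of the matrix `S(u)`. -/
def sdet (t : CaseType) {I : IndexSet} (S : Matrix I.Idx I.Idx A⟦X⟧) : A⟦X⟧ :=
  sklyaninMinor t S I.enum I.enum

/-- The matrix with rows and columns in the complement of `{-m, …, m}` (the index set of size `M`)
in the index set of size `N`, with entries the Sklyanin minors with rows `-m, …, m, a` and columns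
`-m, …, m, b`, evaluated at `u + M/2`. -/
def sharpMatrix (t : CaseType) {N M : ℕ} (h : (indexSet M).carrier ⊆ (indexSet N).carrier)
    (S : Matrix (indexSet N).Idx (indexSet N).Idx A⟦X⟧) :
    Matrix ((indexSet N).compl (indexSet M)).Idx ((indexSet N).compl (indexSet M)).Idx A⟦X⟧ :=
  fun a b =>
    let rows : ((indexSet N).compl (indexSet M)).Idx →
        Fin ((indexSet M).carrier.card + 1) → (indexSet N).Idx := fun c =>
      Fin.snoc (α := fun _ => (indexSet N).Idx)
        (fun r => IndexSet.incl h ((indexSet M).enum r))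
        (IndexSet.complIncl (indexSet N) (indexSet M) c)
    shift ((M : ℂ) / 2) (sklyaninMinor t S (rows a) (rows b))

/-- The submatrix of `S` with rows and columns numbered by `J ⊆ I`. -/
def subMatrix {I J : IndexSet} (h : J.carrier ⊆ I.carrier) (S : Matrix I.Idx I.Idx A⟦X⟧) :
    Matrix J.Idx J.Idx A⟦X⟧ :=
  S.submatrix (IndexSet.incl h) (IndexSet.incl h)

end Minors

end TwistedYangian

end

open TwistedYangian

open scoped PowerSeries

noncomputable section

namespace TwistedYangian

set_option linter.unusedSectionVars false

open Equiv Finset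

/-! ### Operators on a tensor power, with sites numbered by an arbitrary finite type -/

/-! This is a Jacobi complementary-minor argument for the twisted relations. Let `T(u) = S(u)⁻¹`.
The matrix of minors is a series times the inverse of the block of `T` on 𝒜, and inversion respects
the relations up to a substitution of the parameter.

Putting `v = u + z` turns the defining relations into `R S₁(u) Rᵗ S₂(v) = S₂(v) Rᵗ S₁(u) R` with `R
= 1 - P/(u - v)` and `Rᵗ = 1 + Q/(u + v)`; this is `Quat`. A series in two variables that vanishes
for infinitely many `z` is zero (`eq_zero_of_evLin_eq_zero`), so the relations at all `z ≠ 0` are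
equivalent to the defining ones (`relLHS_eq_relRHS_iff`). Since `Q² = |I| Q`, the inverse of `Rᵗ`
has the same shape, and `S(u) ↦ T(-u - |I|/2)` preserves the relations (`Twisted.inverse`). So does
passing to a block with symmetric index set. Inverting, cutting down to 𝒜 and inverting again shows
that `D(u) = E(u - M/2)` satisfies the relations, where `E` is the inverse of `T_𝒜𝒜`.

Let `g = sdet S_ℬℬ`. Minors with a repeated column vanish, so the unshifted matrix of minors times
`T_𝒜𝒜(u - M)` is `g(u)` times the identity (`Twisted.sharpOf_mul`). Hence `S♯(u) = g(u + M/2) D(u)`.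
The coefficients of `g` commute with `T_𝒜𝒜` and so with `D` (`Twisted.coeffCommute_inverse`), and
with each other because the Sklyanin determinant commutes with the entries of its own matrix
(`Twisted.coeffCommute_of_bijective`). Therefore `S♯` satisfies the defining relations, and the
universal property gives the homomorphism.

For the determinant, when the number of sites equals the number of indices the antisymmetrizer has
rank one and `A⟨S₁,…⟩ = sdet S · A`. Moreover the inverse of `⟨S₁,…⟩` is a product of the same kind
for the inverse matrices in reverse order. This expresses `g` as `sdet S` times a Sklyanin
determinant of the block of `T` (`Twisted.sminor_complement`). Using this for `S`, and again for
that block, yields `sdet S(u + M/2) = g(u + M/2) sdet D(u)`. A factor `c` contributes `∏ c(u - a)`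
to a Sklyanin determinant. In `sdet S♯` the factor with `a = 0` completes `sdet D` to `sdet S(u +
M/2)`, and the others form the product in the theorem. -/

/-- Matrices over `W` acting on the tensor power of `W^J` with factors numbered by `ι`. -/
abbrev SiteMatrix (ι J W : Type*) := Matrix (ι → J) (ι → J) W

/-- The conditions on a family of signs `θ_ij` for which the twisted relations make sense. -/
structure IsSignForm {J : Type*} [Neg J] (θ : J → J → ℤ) : Prop where
  self : ∀ i, θ i i = 1
  mul : ∀ i j k, θ i j * θ j k = θ i k
  symm : ∀ i j, θ i j = θ j i
  neg : ∀ i j, θ (-i) (-j) = θ i j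

section Sites

variable {ι J K W : Type*} [Fintype ι] [DecidableEq ι] [Fintype J] [DecidableEq J]
  [CommRing K] [Ring W] [Algebra K W]

/-- The matrix `T` acting on the site `a`. -/
def siteOp (T : Matrix J J W) (a : ι) : SiteMatrix ι J W := fun p q =>
  if ∀ c, c ≠ a → p c = q c then T (p a) (q a) else 0

/-- The operator `Q = ∑ θ_ij e_{-j,-i} ⊗ e_{ji}` acting on the sites `a` and `b`. -/
def pairOp (W : Type*) [Ring W] [Neg J] (θ : J → J → ℤ) (a b : ι) : SiteMatrix ι J W := fun p q =>
  if p a = -p b ∧ q a = -q b ∧ ∀ c, c ≠ a → c ≠ b → p c = q c then ((θ (q b) (p b) : ℤ) : W) else 0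

/-- The operator permuting the tensor factors. -/
def permOp (J W : Type*) [DecidableEq J] [Ring W] (σ : Perm ι) : SiteMatrix ι J W := fun p q =>
  if ∀ c, p (σ c) = q c then 1 else 0

/-- The anti-symmetrization operator. -/
def altOp (ι J W : Type*) [Fintype ι] [DecidableEq ι] [DecidableEq J] [Ring W] :
    SiteMatrix ι J W :=
  ∑ σ : Perm ι, (Perm.sign σ : ℤ) • permOp J W σ

theorem pairOp_of [Neg J] {θ : J → J → ℤ} {a b : ι} {p q : ι → J} (hp : p a = -p b)
    (hq : q a = -q b) (h : ∀ c, c ≠ a → c ≠ b → p c = q c) :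
    pairOp W θ a b p q = ((θ (q b) (p b) : ℤ) : W) :=
  if_pos ⟨hp, hq, h⟩

theorem of_pairOp_ne_zero [Neg J] {θ : J → J → ℤ} {a b : ι} {p q : ι → J}
    (h : pairOp W θ a b p q ≠ 0) :
    p a = -p b ∧ q a = -q b ∧ ∀ c, c ≠ a → c ≠ b → p c = q c := by
  by_contra h'
  exact h (if_neg h')

theorem permOp_mul_apply (σ : Perm ι) (Y : SiteMatrix ι J W) (p q : ι → J) :
    (permOp J W σ * Y) p q = Y (p ∘ σ) q := by
  rw [Matrix.mul_apply, sum_eq_single (p ∘ σ)]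
  · simp [permOp]
  · intro r _ hr
    have : ¬ ∀ c, p (σ c) = r c := fun h => hr (funext fun c => (h c).symm)
    simp [permOp, this]
  · simp

theorem mul_permOp_apply (σ : Perm ι) (Y : SiteMatrix ι J W) (p q : ι → J) :
    (Y * permOp J W σ) p q = Y p (q ∘ ⇑σ⁻¹) := by
  rw [Matrix.mul_apply, sum_eq_single (q ∘ ⇑σ⁻¹)]
  · simp [permOp]
  · intro r _ hr
    have : ¬ ∀ c, r (σ c) = q c := fun h => hr (funext fun c => by simp [← h])
    simp [permOp, this]
  · simp

theorem permOp_mul_permOp (σ τ : Perm ι) : permOp J W σ * permOp J W τ = permOp J W (σ * τ) := by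
  ext p q
  rw [permOp_mul_apply]
  rfl

theorem permOp_one : permOp J W (1 : Perm ι) = 1 := by
  ext p q
  by_cases h : p = q
  · subst h
    simp [permOp]
  · rw [Matrix.one_apply_ne h, permOp, if_neg]
    exact fun h' => h (funext h')

theorem altOp_mul_apply (Y : SiteMatrix ι J W) (p q : ι → J) :
    (altOp ι J W * Y) p q = ∑ σ : Perm ι, (Perm.sign σ : ℤ) • Y (p ∘ σ) q := by
  simp only [altOp, sum_mul, smul_mul_assoc, Matrix.sum_apply, Matrix.smul_apply, permOp_mul_apply]

theorem altOp_apply (p q : ι → J) :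
    altOp ι J W p q = ∑ σ : Perm ι, (Perm.sign σ : ℤ) • if p ∘ σ = q then (1 : W) else 0 := by
  rw [← mul_one (altOp ι J W), altOp_mul_apply]
  simp [Matrix.one_apply]

theorem permOp_mul_altOp (σ : Perm ι) :
    permOp J W σ * altOp ι J W = (Perm.sign σ : ℤ) • altOp ι J W := by
  rw [altOp, mul_sum, smul_sum]
  refine Fintype.sum_equiv (Equiv.mulLeft σ) _ _ fun τ => ?_
  rw [coe_mulLeft, mul_smul_comm, permOp_mul_permOp, Perm.sign_mul, smul_smul, Units.val_mul,
    ← mul_assoc, ← Units.val_mul, Int.units_mul_self, Units.val_one, one_mul]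

theorem altOp_mul_permOp (σ : Perm ι) :
    altOp ι J W * permOp J W σ = (Perm.sign σ : ℤ) • altOp ι J W := by
  rw [altOp, sum_mul, smul_sum]
  refine Fintype.sum_equiv (Equiv.mulRight σ) _ _ fun τ => ?_
  rw [coe_mulRight, smul_mul_assoc, permOp_mul_permOp, Perm.sign_mul, smul_smul, Units.val_mul,
    mul_left_comm, ← Units.val_mul, Int.units_mul_self, Units.val_one, mul_one]

theorem altOp_mul_apply_comp (Y : SiteMatrix ι J W) (σ : Perm ι) (p q : ι → J) :
    (altOp ι J W * Y) (p ∘ σ) q = (Perm.sign σ : ℤ) • (altOp ι J W * Y) p q := by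
  rw [← permOp_mul_apply σ (altOp ι J W * Y) p q, ← mul_assoc, permOp_mul_altOp, smul_mul_assoc, Matrix.smul_apply]

/-! ### Supports and commutation -/

/-- The operator `Y` acts on the sites in `s` only. -/
def ActsOn (s : Set ι) (Y : SiteMatrix ι J W) : Prop :=
  (∀ p q, Y p q ≠ 0 → ∀ c ∉ s, p c = q c) ∧
  ∀ p q p' q', (∀ c ∈ s, p c = p' c) → (∀ c ∈ s, q c = q' c) → (∀ c ∉ s, p c = q c) →
    (∀ c ∉ s, p' c = q' c) → Y p q = Y p' q'

/-- Only one intermediate multi-index contributes: `Y` has to do all the changing on `s`, and `Z`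
all the changing off `s`. -/
theorem ActsOn.mul_apply {s t : Set ι} (hst : Disjoint s t)
    [DecidablePred (· ∈ s)]
    {Y Z : SiteMatrix ι J W} (hY : ActsOn s Y) (hZ : ActsOn t Z) (p q : ι → J) :
    (Y * Z) p q = Y p (fun c => if c ∈ s then q c else p c) *
      Z (fun c => if c ∈ s then q c else p c) q := by
  rw [Matrix.mul_apply, sum_eq_single (fun c => if c ∈ s then q c else p c)]
  · intro r _ hr
    by_contra h
    have h1 : Y p r ≠ 0 := left_ne_zero_of_mul h
    have h2 : Z r q ≠ 0 := right_ne_zero_of_mul h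
    refine hr (funext fun c => ?_)
    split_ifs with hc
    · exact hZ.1 _ _ h2 c (Set.disjoint_left.mp hst hc)
    · exact (hY.1 _ _ h1 c hc).symm
  · simp

/-- Disjoint supports alone do not suffice over a noncommutative ring: the two single-term products
still have their factors in opposite orders, hence the hypothesis on entries. -/
theorem ActsOn.commute {s t : Set ι} (hst : Disjoint s t) {Y Z : SiteMatrix ι J W}
    (hY : ActsOn s Y) (hZ : ActsOn t Z) (hc : ∀ p q p' q', Commute (Y p q) (Z p' q')) :
    Commute Y Z := by
  classical
  ext p q
  rw [ActsOn.mul_apply hst hY hZ, ActsOn.mul_apply hst.symm hZ hY]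
  by_cases h : ∀ c, c ∉ s → c ∉ t → p c = q c
  · rw [(hc _ _ _ _).eq]
    congr 1
    · refine hZ.2 _ _ _ _ ?_ ?_ ?_ ?_
      · intro c hc; simp [Set.disjoint_right.mp hst hc]
      · intro c hc; simp [hc]
      · intro c hc
        by_cases hcs : c ∈ s
        · simp [hcs]
        · simp [hcs, h c hcs hc]
      · intro c hc; simp [hc]
    · refine hY.2 _ _ _ _ ?_ ?_ ?_ ?_
      · intro c hc; simp [Set.disjoint_left.mp hst hc]
      · intro c hc; simp [hc]
      · intro c hc; simp [hc]
      · intro c hc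
        by_cases hct : c ∈ t
        · simp [hct]
        · simp [hct, h c hc hct]
  · push Not at h
    obtain ⟨c, hs, ht, hne⟩ := h
    have h1 : Z (fun c => if c ∈ s then q c else p c) q = 0 := by
      by_contra hz
      exact hne (by simpa [hs] using hZ.1 _ _ hz c ht)
    have h2 : Y (fun c => if c ∈ t then q c else p c) q = 0 := by
      by_contra hz
      exact hne (by simpa [ht] using hY.1 _ _ hz c hs)
    rw [h1, h2, mul_zero, mul_zero]

theorem actsOn_siteOp (T : Matrix J J W) (a : ι) : ActsOn {a} (siteOp T a) := by
  constructor
  · intro p q h c hc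
    by_contra hne
    exact h (if_neg fun h' => hne (h' c (by simpa using hc)))
  · intro p q p' q' hp hq h h'
    simp only [Set.mem_singleton_iff, forall_eq] at hp hq h h'
    rw [siteOp, siteOp, if_pos h, if_pos h', hp, hq]

theorem actsOn_pairOp [Neg J] (θ : J → J → ℤ) (a b : ι) :
    ActsOn {a, b} (pairOp W θ a b) := by
  constructor
  · intro p q h c hc
    by_contra hne
    simp only [Set.mem_insert_iff, Set.mem_singleton_iff, not_or] at hc
    exact h (if_neg fun h' => hne (h'.2.2 c hc.1 hc.2))
  · intro p q p' q' hp hq h h'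
    have e1 := hp a (by simp)
    have e2 := hp b (by simp)
    have e3 := hq a (by simp)
    have e4 := hq b (by simp)
    simp only [Set.mem_insert_iff, Set.mem_singleton_iff, not_or, and_imp] at h h'
    simp only [pairOp, e1, e2, e3, e4, and_iff_left h, and_iff_left h']

theorem actsOn_permOp (σ : Perm ι) (s : Set ι) (hσ : ∀ c ∉ s, σ c = c) :
    ActsOn s (permOp J W σ) := by
  have hs : ∀ c ∈ s, σ c ∈ s := fun c hc => by
    by_contra h
    exact h (by rwa [σ.injective (hσ _ h)])
  constructor
  · intro p q h c hc
    by_contra hne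
    refine h (if_neg fun h' => hne ?_)
    rw [← h' c, hσ c hc]
  · intro p q p' q' hp hq h h'
    have key : ∀ c, p (σ c) = q c ↔ p' (σ c) = q' c := fun c => by
      by_cases hc : c ∈ s
      · rw [hp _ (hs c hc), hq c hc]
      · simp [hσ c hc, h c hc, h' c hc]
    simp only [permOp, key]

theorem ActsOn.one (s : Set ι) : ActsOn s (1 : SiteMatrix ι J W) := by
  rw [← permOp_one]
  exact actsOn_permOp _ _ fun _ _ => rfl

theorem ActsOn.mono {s t : Set ι} (hst : s ⊆ t) {Y : SiteMatrix ι J W} (hY : ActsOn s Y) :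
    ActsOn t Y := by
  refine ⟨fun p q h c hc => hY.1 p q h c fun h' => hc (hst h'), fun p q p' q' hp hq h h' => ?_⟩
  by_cases H : ∀ c ∉ s, p c = q c
  · refine hY.2 _ _ _ _ (fun c hc => hp c (hst hc)) (fun c hc => hq c (hst hc)) H fun c hc => ?_
    by_cases hct : c ∈ t
    · rw [← hp c hct, ← hq c hct, H c hc]
    · exact h' c hct
  · have H' : ¬ ∀ c ∉ s, p' c = q' c := fun H' => H fun c hc => by
      by_cases hct : c ∈ t
      · rw [hp c hct, hq c hct, H' c hc]
      · exact h c hct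
    have h1 : Y p q = 0 := by_contra fun h0 => H (hY.1 p q h0)
    have h2 : Y p' q' = 0 := by_contra fun h0 => H' (hY.1 p' q' h0)
    rw [h1, h2]

theorem commute_pairOp_apply [Neg J] (θ : J → J → ℤ) (a b : ι) (w : W) (p q : ι → J) :
    Commute (pairOp W θ a b p q) w := by
  unfold pairOp
  split_ifs
  · exact Int.cast_commute _ _
  · exact Commute.zero_left _

theorem commute_permOp_apply (σ : Perm ι) (w : W) (p q : ι → J) :
    Commute (permOp J W σ p q) w := by
  unfold permOp
  split_ifs
  · exact Commute.one_left _
  · exact Commute.zero_left _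

theorem commute_pairOp_siteOp [Neg J] (θ : J → J → ℤ) (T : Matrix J J W) {a b c : ι} (hca : c ≠ a)
    (hcb : c ≠ b) : Commute (pairOp W θ a b) (siteOp T c) :=
  ActsOn.commute (by simp [hca, hcb]) (actsOn_pairOp θ a b) (actsOn_siteOp T c)
    fun _ _ _ _ => commute_pairOp_apply ..

theorem commute_pairOp_pairOp [Neg J] (θ : J → J → ℤ) {a b c d : ι} (hca : c ≠ a)
    (hcb : c ≠ b) (hda : d ≠ a) (hdb : d ≠ b) :
    Commute (pairOp W θ a b) (pairOp W θ c d) :=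
  ActsOn.commute (by simp [hca, hcb, hda, hdb]) (actsOn_pairOp θ a b)
    (actsOn_pairOp θ c d) fun _ _ _ _ => commute_pairOp_apply ..

theorem actsOn_permOp_swap (a b : ι) : ActsOn {a, b} (permOp J W (swap a b)) :=
  actsOn_permOp _ _ fun c hc => by
    simp only [Set.mem_insert_iff, Set.mem_singleton_iff, not_or] at hc
    exact swap_apply_of_ne_of_ne hc.1 hc.2

theorem commute_swap_siteOp (T : Matrix J J W) {a b c : ι} (hca : c ≠ a)
    (hcb : c ≠ b) : Commute (permOp J W (swap a b)) (siteOp T c) :=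
  ActsOn.commute (by simp [hca, hcb]) (actsOn_permOp_swap a b) (actsOn_siteOp T c)
    fun _ _ _ _ => commute_permOp_apply ..

theorem commute_swap_pairOp [Neg J] (θ : J → J → ℤ) {a b c d : ι} (hca : c ≠ a)
    (hcb : c ≠ b) (hda : d ≠ a) (hdb : d ≠ b) :
    Commute (permOp J W (swap a b)) (pairOp W θ c d) :=
  ActsOn.commute (by simp [hca, hcb, hda, hdb]) (actsOn_permOp_swap a b)
    (actsOn_pairOp θ c d) fun _ _ _ _ => commute_permOp_apply ..

/-! ### Relations between permutations and the operators `Q` -/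

theorem permOp_mul_pairOp [Neg J] (θ : J → J → ℤ) (σ : Perm ι) (a b : ι) :
    permOp J W σ * pairOp W θ a b = pairOp W θ (σ a) (σ b) * permOp J W σ := by
  ext p q
  rw [permOp_mul_apply, mul_permOp_apply]
  have : (∀ c, c ≠ a → c ≠ b → (p ∘ σ) c = q c) ↔
      ∀ c, c ≠ σ a → c ≠ σ b → p c = (q ∘ ⇑σ⁻¹) c := by
    rw [σ.forall_congr_left]
    simp [Perm.inv_def, Equiv.symm_apply_eq]
  simp only [pairOp, this]
  simp

variable [InvolutiveNeg J] {θ : J → J → ℤ}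

theorem pairOp_comm (hθ : IsSignForm θ) (a b : ι) : pairOp W θ a b = pairOp W θ b a := by
  ext p q
  simp only [pairOp]
  by_cases h : p a = -p b ∧ q a = -q b ∧ ∀ c, c ≠ a → c ≠ b → p c = q c
  · have h' : p b = -p a ∧ q b = -q a ∧ ∀ c, c ≠ b → c ≠ a → p c = q c :=
      ⟨by rw [h.1, neg_neg], by rw [h.2.1, neg_neg], fun c h1 h2 => h.2.2 c h2 h1⟩
    rw [if_pos h, if_pos h', h.1, h.2.1, hθ.neg]
  · have h' : ¬ (p b = -p a ∧ q b = -q a ∧ ∀ c, c ≠ b → c ≠ a → p c = q c) := fun h' =>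
      h ⟨by rw [h'.1, neg_neg], by rw [h'.2.1, neg_neg], fun c h1 h2 => h'.2.2 c h2 h1⟩
    rw [if_neg h, if_neg h']

/-- `Q` has rank one up to the other sites, so contracting two copies that share the site `j` leaves
no free sum: it only moves the index from one partner to the other. -/
theorem pairOp_mul_pairOp (hθ : IsSignForm θ) {j a b : ι} (hja : j ≠ a) (hjb : j ≠ b)
    (hab : a ≠ b) :
    pairOp W θ j a * pairOp W θ j b = permOp J W (swap a b) * pairOp W θ j b := by
  ext p q
  -- The only possible intermediate multi-index: the first factor leaves site `b` alone, the second
  -- forces the value `-p b` at `j`, and the first then forces `p b` at `a`.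
  rw [permOp_mul_apply, Matrix.mul_apply,
    sum_eq_single (fun c => if c = j then -p b else if c = a then p b else p c)]
  · by_cases h : p j = -p a ∧ q j = -q b ∧ q a = p b ∧ ∀ c, c ≠ j → c ≠ a → c ≠ b → p c = q c
    · obtain ⟨h1, h2, h3, h4⟩ := h
      rw [pairOp_of h1 (by simp [hja.symm]), pairOp_of (by simp [hjb.symm, hab.symm]) h2,
        pairOp_of (by simp [swap_apply_of_ne_of_ne hja hjb, h1]) h2]
      · simp only [hja.symm, hjb.symm, hab.symm, if_true, if_false, Function.comp_apply,
          swap_apply_right]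
        rw [← Int.cast_mul, mul_comm, hθ.mul]
      · intro c hj hb
        by_cases hca : c = a
        · simp [hca, h3]
        · simp [swap_apply_of_ne_of_ne hca hb, h4 c hj hca hb]
      · intro c hj hb
        by_cases hca : c = a
        · simp [hca, h3, hja.symm]
        · simp [hca, hj, h4 c hj hca hb]
      · intro c hj ha
        simp [hj, ha]
    · have h2 : pairOp W θ j b (p ∘ ⇑(swap a b)) q = 0 := by
        by_contra h0
        obtain ⟨e1, e2, e3⟩ := of_pairOp_ne_zero h0
        refine h ⟨by simpa [swap_apply_of_ne_of_ne hja hjb] using e1, e2, ?_, ?_⟩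
        · simpa using (e3 a hja.symm hab).symm
        · intro c h1 h2 h3
          simpa [swap_apply_of_ne_of_ne h2 h3] using e3 c h1 h3
      rw [h2]
      by_contra h0
      obtain ⟨e1, -, -⟩ := of_pairOp_ne_zero (left_ne_zero_of_mul h0)
      obtain ⟨e2, e3, e4⟩ := of_pairOp_ne_zero (right_ne_zero_of_mul h0)
      refine h ⟨e1, e3, ?_, ?_⟩
      · simpa [hja.symm] using (e4 a hja.symm hab).symm
      · intro c h1 h2 h3
        simpa [h1, h2] using e4 c h1 h3
  · intro r _ hr
    by_contra h0
    obtain ⟨e1, e2, e3⟩ := of_pairOp_ne_zero (left_ne_zero_of_mul h0)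
    obtain ⟨e1', e2', e3'⟩ := of_pairOp_ne_zero (right_ne_zero_of_mul h0)
    have hb := e3 b hjb.symm hab.symm
    refine hr (funext fun c => ?_)
    split_ifs with h1 h2
    · rw [h1, e1', hb]
    · rw [h2, hb, ← neg_neg (r a), ← e2, e1', neg_neg]
    · exact (e3 c h1 h2).symm
  · simp

theorem pairOp_mul_self (hθ : IsSignForm θ) {a b : ι} (hab : a ≠ b) :
    pairOp W θ a b * pairOp W θ a b = (Fintype.card J : W) • pairOp W θ a b := by
  ext p q
  rw [Matrix.mul_apply, Matrix.smul_apply]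
  by_cases h : p a = -p b ∧ q a = -q b ∧ ∀ c, c ≠ a → c ≠ b → p c = q c
  -- The intermediate value at `b` is free and determines the one at `a`; each choice gives the same
  -- term, whence the factor `|J|`.
  · rw [← sum_subset (subset_univ
      (univ.image fun (j : J) (c : ι) => if c = a then -j else if c = b then j else p c))]
    · rw [sum_image]
      · have : ∀ j : J, pairOp W θ a b p (fun c => if c = a then -j else if c = b then j else p c) *
            pairOp W θ a b (fun c => if c = a then -j else if c = b then j else p c) q =
            pairOp W θ a b p q := by
          intro j
          rw [pairOp_of h.1 h.2.1 h.2.2, pairOp_of h.1 (by simp [hab.symm]),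
            pairOp_of (by simp [hab.symm]) h.2.1]
          · simp only [hab.symm, if_false, if_true]
            rw [← Int.cast_mul, mul_comm, hθ.mul]
          · intro c h1 h2
            simp [h1, h2, h.2.2 c h1 h2]
          · intro c h1 h2
            simp [h1, h2]
        simp [this]
      · intro x _ y _ hxy
        simpa [hab.symm] using congrFun hxy b
    · intro r _ hr
      by_contra h0
      obtain ⟨e1, e2, e3⟩ := of_pairOp_ne_zero (left_ne_zero_of_mul h0)
      refine hr (mem_image.mpr ⟨r b, mem_univ _, funext fun c => ?_⟩)
      split_ifs with h1 h2
      · rw [h1, e2]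
      · rw [h2]
      · exact e3 c h1 h2
  · have hz : pairOp W θ a b p q = 0 := if_neg h
    rw [hz, smul_zero]
    refine sum_eq_zero fun r _ => ?_
    by_contra h0
    obtain ⟨e1, e2, e3⟩ := of_pairOp_ne_zero (left_ne_zero_of_mul h0)
    obtain ⟨e1', e2', e3'⟩ := of_pairOp_ne_zero (right_ne_zero_of_mul h0)
    exact h ⟨e1, e2', fun c h1 h2 => (e3 c h1 h2).trans (e3' c h1 h2)⟩

end Sites

/-! ### The products `⟨S₁, …, S_k⟩`, the Yang–Baxter equation and the quaternary relation -/

section Bracket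

variable {ι J K W : Type*} [Fintype ι] [DecidableEq ι] [Fintype J] [DecidableEq J]
  [CommRing K] [Ring W] [Algebra K W] [InvolutiveNeg J] {θ : J → J → ℤ}

/-- The operator `1 + β Q` acting on the sites `a` and `b`. -/
def rtOp (W : Type*) [Ring W] [Algebra K W] (θ : J → J → ℤ) (β : ι → ι → K) (a b : ι) :
    SiteMatrix ι J W :=
  1 + β a b • pairOp W θ a b

/-- The product of the operators `1 + β Q` acting on `a` and the elements of a list. -/
def rtProd (W : Type*) [Ring W] [Algebra K W] (θ : J → J → ℤ) (β : ι → ι → K) (a : ι)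
    (l : List ι) : SiteMatrix ι J W :=
  (l.map (rtOp W θ β a)).prod

/-- The product `S_a (R^t_{ab} R^t_{ac} ⋯) S_b (R^t_{bc} ⋯) ⋯` for a list of sites `a, b, c, …`. -/
def bracket (θ : J → J → ℤ) (S : ι → Matrix J J W) (β : ι → ι → K) : List ι → SiteMatrix ι J W
  | [] => 1
  | a :: l => siteOp (S a) a * rtProd W θ β a l * bracket θ S β l

theorem rtProd_cons (β : ι → ι → K) (a b : ι) (l : List ι) :
    rtProd W θ β a (b :: l) = rtOp W θ β a b * rtProd W θ β a l := by
  simp [rtProd]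

theorem rtProd_append (β : ι → ι → K) (a : ι) (l l' : List ι) :
    rtProd W θ β a (l ++ l') = rtProd W θ β a l * rtProd W θ β a l' := by
  simp [rtProd]

theorem Commute.rtOp_right {Y : SiteMatrix ι J W} {β : ι → ι → K} {a b : ι}
    (h : Commute Y (pairOp W θ a b)) : Commute Y (rtOp W θ β a b) :=
  (Commute.one_right _).add_right (h.smul_right _)

theorem Commute.rtProd_right {Y : SiteMatrix ι J W} {β : ι → ι → K} {a : ι} {l : List ι}
    (h : ∀ b ∈ l, Commute Y (pairOp W θ a b)) : Commute Y (rtProd W θ β a l) := by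
  refine Commute.list_prod_right _ _ fun x hx => ?_
  obtain ⟨b, hb, rfl⟩ := List.mem_map.mp hx
  exact Commute.rtOp_right (h b hb)

theorem Commute.bracket_right {Y : SiteMatrix ι J W} {S : ι → Matrix J J W} {β : ι → ι → K}
    {l : List ι} (hS : ∀ a ∈ l, Commute Y (siteOp (S a) a))
    (hQ : ∀ a ∈ l, ∀ b ∈ l, Commute Y (pairOp W θ a b)) : Commute Y (bracket θ S β l) := by
  induction l with
  | nil => exact Commute.one_right _
  | cons a l ih =>
    refine ((hS a (by simp)).mul_right (Commute.rtProd_right fun b hb => ?_)).mul_right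
      (ih (fun b hb => hS b (by simp [hb])) fun b hb c hc => hQ b (by simp [hb]) c (by simp [hc]))
    exact hQ a (by simp) b (by simp [hb])

theorem rtOp_comm (hθ : IsSignForm θ) {β : ι → ι → K} (hβ : ∀ a b, β a b = β b a) (a b : ι) :
    rtOp W θ β a b = rtOp W θ β b a := by
  rw [rtOp, rtOp, hβ, pairOp_comm hθ]

/-- The operator `1 - α P` acting on the sites `a` and `b`. -/
def rOp (J W : Type*) [Fintype J] [DecidableEq J] [Ring W] [Algebra K W] (α : K) (a b : ι) :
    SiteMatrix ι J W :=
  1 - α • permOp J W (swap a b)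

theorem rOp_commute {Y : SiteMatrix ι J W} (α : K) {a b : ι}
    (h : Commute (permOp J W (swap a b)) Y) : Commute (rOp J W α a b) Y :=
  (Commute.one_left _).sub_left (h.smul_left _)

theorem rOp_mul_rOp_neg (α : K) (a b : ι) :
    rOp J W α a b * rOp J W (-α) a b = (1 - α ^ 2) • (1 : SiteMatrix ι J W) := by
  have h : permOp J W (swap a b) * permOp J W (swap a b) = 1 := by
    rw [permOp_mul_permOp, swap_mul_self, permOp_one]
  simp only [rOp, sub_mul, mul_sub, one_mul, mul_one, smul_mul_assoc, mul_smul_comm, h]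
  module

/-- The Yang--Baxter equation with two partially transposed factors. -/
theorem rOp_mul_rtOp_mul_rtOp (hθ : IsSignForm θ) {α : K} {β : ι → ι → K} {a b j : ι}
    (hja : j ≠ a) (hjb : j ≠ b) (hab : a ≠ b) (hβ : β j a * β j b = α * (β j b - β j a)) :
    rOp J W α a b * (rtOp W θ β j a * rtOp W θ β j b) =
      rtOp W θ β j b * rtOp W θ β j a * rOp J W α a b := by
  have e1 := pairOp_mul_pairOp (W := W) hθ hja hjb hab
  have e2 := pairOp_mul_pairOp (W := W) hθ hjb hja hab.symm
  have e3 := permOp_mul_pairOp (W := W) θ (swap a b) j a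
  have e4 := permOp_mul_pairOp (W := W) θ (swap a b) j b
  rw [swap_comm b a] at e2
  simp only [swap_apply_left, swap_apply_right, swap_apply_of_ne_of_ne hja hjb] at e3 e4
  unfold rOp rtOp
  generalize pairOp W θ j a = A at *
  generalize pairOp W θ j b = B at *
  generalize permOp J W (swap a b) = P at *
  have e5 : P * A * P = P * (P * B) := by rw [mul_assoc, ← e4]
  simp only [add_mul, mul_add, sub_mul, mul_sub, one_mul, mul_one, smul_mul_assoc, mul_smul_comm,
    smul_add, smul_sub, e5, e1, e2, ← e3, ← e4]
  -- Once every word is reduced by `Q_{ja} Q_{jb} = P_{ab} Q_{jb}` and its mirror image, this is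
  -- exactly the difference of the two sides.
  have key : (β j a * β j b - α * (β j b - β j a)) • (P * B - P * A) = 0 := by
    rw [hβ, sub_self, zero_smul]
  rw [← sub_eq_zero, ← key]
  module

/-- The relation `(1 - α P) T_1 (1 + β Q) T'_2 = T'_2 (1 + β Q) T_1 (1 - α P)`, in terms of
matrix entries. -/
def Quat (θ : J → J → ℤ) (T T' : Matrix J J W) (α β : K) : Prop :=
  ∀ i j k l : J,
    T i j * T' k l + β • (((θ (-j) k : ℤ) : W) * (T i (-k) * T' (-j) l))
      - α • (T k j * T' i l + β • (((θ (-j) i : ℤ) : W) * (T k (-i) * T' (-j) l))) =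
    T' k l * T i j + β • (((θ l (-i) : ℤ) : W) * (T' k (-i) * T (-l) j))
      - α • (T' k j * T i l + β • (((θ j (-i) : ℤ) : W) * (T' k (-i) * T (-j) l)))

theorem siteOp_mul_apply (T : Matrix J J W) (a : ι) (Y : SiteMatrix ι J W) (p q : ι → J) :
    (siteOp T a * Y) p q = ∑ j, T (p a) j * Y (Function.update p a j) q := by
  rw [Matrix.mul_apply, ← sum_subset (subset_univ (univ.image (Function.update p a)))]
  · rw [sum_image fun x _ y _ h => Function.update_injective p a h]
    refine sum_congr rfl fun j _ => ?_
    rw [siteOp, if_pos fun c hc => by simp [hc]]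
    simp
  · intro r _ hr
    rw [siteOp, if_neg, zero_mul]
    refine fun h => hr (mem_image.mpr ⟨r a, mem_univ _, funext fun c => ?_⟩)
    by_cases hc : c = a
    · subst hc; simp
    · simp [hc, h c hc]

theorem mul_siteOp_apply (T : Matrix J J W) (a : ι) (Y : SiteMatrix ι J W) (p q : ι → J) :
    (Y * siteOp T a) p q = ∑ j, Y p (Function.update q a j) * T j (q a) := by
  rw [Matrix.mul_apply, ← sum_subset (subset_univ (univ.image (Function.update q a)))]
  · rw [sum_image fun x _ y _ h => Function.update_injective q a h]
    refine sum_congr rfl fun j _ => ?_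
    rw [siteOp, if_pos fun c hc => by simp [hc]]
    simp
  · intro r _ hr
    rw [siteOp, if_neg, mul_zero]
    refine fun h => hr (mem_image.mpr ⟨r a, mem_univ _, funext fun c => ?_⟩)
    by_cases hc : c = a
    · subst hc; simp
    · simp [hc, h c hc]

theorem siteOp_mul_siteOp_apply (T T' : Matrix J J W) {a b : ι} (hab : a ≠ b) (p q : ι → J) :
    (siteOp T a * siteOp T' b) p q =
      if ∀ c, c ≠ a → c ≠ b → p c = q c then T (p a) (q a) * T' (p b) (q b) else 0 := by
  rw [siteOp_mul_apply, sum_eq_single (q a)]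
  · by_cases h : ∀ c, c ≠ a → c ≠ b → p c = q c
    · rw [if_pos h, siteOp, if_pos]
      · simp [hab.symm]
      · intro c hc
        by_cases hca : c = a
        · simp [hca]
        · simp [hca, h c hca hc]
    · rw [if_neg h, siteOp, if_neg, mul_zero]
      intro h'
      refine h fun c hca hcb => ?_
      simpa [hca] using h' c hcb
  · intro j _ hj
    rw [siteOp, if_neg, mul_zero]
    intro h
    exact hj (by simpa using h a hab)
  · simp

theorem siteOp_mul_pairOp_mul_siteOp_apply (T T' : Matrix J J W) {a b : ι} (hab : a ≠ b)
    (p q : ι → J) :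
    (siteOp T a * pairOp W θ a b * siteOp T' b) p q =
      if ∀ c, c ≠ a → c ≠ b → p c = q c then
        ((θ (-q a) (p b) : ℤ) : W) * (T (p a) (-p b) * T' (-q a) (q b)) else 0 := by
  rw [mul_assoc, siteOp_mul_apply, sum_eq_single (-p b)]
  · rw [mul_siteOp_apply, sum_eq_single (-q a)]
    · by_cases h : ∀ c, c ≠ a → c ≠ b → p c = q c
      · rw [if_pos h, pairOp_of]
        · simp only [Function.update_self, Function.update_of_ne hab.symm, ← mul_assoc]
          rw [(Int.cast_commute _ _).eq]
        · simp [hab.symm]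
        · simp [hab]
        · intro c h1 h2
          simp [h1, h2, h c h1 h2]
      · rw [if_neg h]
        by_contra h0
        have h1 := of_pairOp_ne_zero (left_ne_zero_of_mul (right_ne_zero_of_mul h0))
        refine h fun c hca hcb => ?_
        simpa [hca, hcb] using h1.2.2 c hca hcb
    · intro j _ hj
      by_contra h0
      have h1 := of_pairOp_ne_zero (left_ne_zero_of_mul h0)
      have h2 : q a = -j := by simpa [hab] using h1.2.1
      exact hj (by rw [h2, neg_neg])
    · simp
  · intro j _ hj
    rw [mul_siteOp_apply, sum_eq_zero, mul_zero]
    intro k _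
    by_contra h0
    have h1 := of_pairOp_ne_zero (left_ne_zero_of_mul h0)
    exact hj (by simpa [hab.symm] using h1.1)
  · simp

theorem rOp_relation_apply (T T' : Matrix J J W) {a b : ι} (hab : a ≠ b) (α β : K)
    (p q : ι → J) :
    (rOp J W α a b * (siteOp T a * (1 + β • pairOp W θ a b) * siteOp T' b)) p q =
      if ∀ c, c ≠ a → c ≠ b → p c = q c then
        T (p a) (q a) * T' (p b) (q b) +
            β • (((θ (-q a) (p b) : ℤ) : W) * (T (p a) (-p b) * T' (-q a) (q b)))
          - α • (T (p b) (q a) * T' (p a) (q b) +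
            β • (((θ (-q a) (p a) : ℤ) : W) * (T (p b) (-p a) * T' (-q a) (q b)))) else 0 := by
  have h : (∀ c, c ≠ a → c ≠ b → (p ∘ ⇑(swap a b)) c = q c) ↔
      ∀ c, c ≠ a → c ≠ b → p c = q c := by
    refine forall_congr' fun c => forall_congr' fun h1 => forall_congr' fun h2 => ?_
    rw [Function.comp_apply, swap_apply_of_ne_of_ne h1 h2]
  simp only [rOp, sub_mul, one_mul, smul_mul_assoc, Matrix.sub_apply, Matrix.smul_apply,
    permOp_mul_apply, mul_add, add_mul, mul_one, mul_smul_comm, Matrix.add_apply,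
    siteOp_mul_siteOp_apply _ _ hab, siteOp_mul_pairOp_mul_siteOp_apply _ _ hab, h]
  simp only [Function.comp_apply, swap_apply_left, swap_apply_right]
  split_ifs
  · module
  · simp

theorem relation_rOp_apply (T T' : Matrix J J W) {a b : ι} (hab : a ≠ b) (α β : K)
    (p q : ι → J) (hθ : IsSignForm θ) :
    (siteOp T' b * (1 + β • pairOp W θ a b) * siteOp T a * rOp J W α a b) p q =
      if ∀ c, c ≠ a → c ≠ b → p c = q c then
        T' (p b) (q b) * T (p a) (q a) +
            β • (((θ (q b) (-p a) : ℤ) : W) * (T' (p b) (-p a) * T (-q b) (q a)))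
          - α • (T' (p b) (q a) * T (p a) (q b) +
            β • (((θ (q a) (-p a) : ℤ) : W) * (T' (p b) (-p a) * T (-q a) (q b)))) else 0 := by
  have h : (∀ c, c ≠ b → c ≠ a → p c = (q ∘ ⇑(swap a b)) c) ↔
      ∀ c, c ≠ a → c ≠ b → p c = q c := by
    rw [forall_congr']
    intro c
    rw [forall_comm]
    refine forall_congr' fun h1 => forall_congr' fun h2 => ?_
    rw [Function.comp_apply, swap_apply_of_ne_of_ne h1 h2]
  have h' : (∀ c, c ≠ b → c ≠ a → p c = q c) ↔ ∀ c, c ≠ a → c ≠ b → p c = q c :=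
    forall_congr' fun c => forall_comm
  rw [pairOp_comm hθ]
  simp only [rOp, mul_sub, mul_one, mul_smul_comm, Matrix.sub_apply, Matrix.smul_apply,
    mul_permOp_apply, mul_add, add_mul, smul_mul_assoc, Matrix.add_apply, swap_inv,
    siteOp_mul_siteOp_apply _ _ hab.symm, siteOp_mul_pairOp_mul_siteOp_apply _ _ hab.symm, h, h']
  simp only [Function.comp_apply, swap_apply_left, swap_apply_right]
  have e : ∀ i j, θ (-i) j = θ i (-j) := fun i j => by rw [← hθ.neg, neg_neg]
  simp only [e]
  split_ifs
  · module
  · simp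

theorem Quat.rOp_relation (hθ : IsSignForm θ) {T T' : Matrix J J W} {a b : ι} (hab : a ≠ b)
    {α : K} {β : ι → ι → K} (h : Quat θ T T' α (β a b)) :
    rOp J W α a b * (siteOp T a * rtOp W θ β a b * siteOp T' b) =
      siteOp T' b * rtOp W θ β a b * siteOp T a * rOp J W α a b := by
  ext p q
  rw [rtOp, rOp_relation_apply _ _ hab, relation_rOp_apply _ _ hab _ _ _ _ hθ, h]

theorem Quat.of_rOp_relation (hθ : IsSignForm θ) {T T' : Matrix J J W} {α β : K}
    (h : rOp J W α (0 : Fin 2) 1 * (siteOp T 0 * (1 + β • pairOp W θ 0 1) * siteOp T' 1) =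
      siteOp T' 1 * (1 + β • pairOp W θ 0 1) * siteOp T 0 * rOp J W α 0 1) :
    Quat θ T T' α β := by
  intro i j k l
  have h1 := congrFun (congrFun h ![i, k]) ![j, l]
  rw [rOp_relation_apply _ _ (by simp), relation_rOp_apply _ _ (by simp) _ _ _ _ hθ, if_pos,
    if_pos] at h1
  · simpa using h1
  all_goals
    intro c h0 h1
    fin_cases c <;> simp_all

end Bracket

/-! ### Exchanging sites, splitting and inverting the products `⟨S₁, …, S_k⟩` -/

section Bracket

variable {ι J K W : Type*} [Fintype ι] [DecidableEq ι] [Fintype J] [DecidableEq J]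
  [CommRing K] [Ring W] [Algebra K W] [InvolutiveNeg J] {θ : J → J → ℤ}

theorem commute_rtProd_siteOp (T : Matrix J J W) (β : ι → ι → K) {a b : ι} {l : List ι}
    (hba : b ≠ a) (hb : b ∉ l) : Commute (rtProd W θ β a l) (siteOp T b) :=
  (Commute.rtProd_right fun _ hc =>
    (commute_pairOp_siteOp θ T hba fun h => hb (h ▸ hc)).symm).symm

theorem commute_rtProd_pairOp (β : ι → ι → K) {a b c : ι} {l : List ι}
    (hba : b ≠ a) (hca : c ≠ a) (hb : b ∉ l) (hc : c ∉ l) :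
    Commute (rtProd W θ β a l) (pairOp W θ b c) :=
  (Commute.rtProd_right fun _ hd =>
    (commute_pairOp_pairOp θ hba (fun h => hb (h ▸ hd)) hca fun h => hc (h ▸ hd)).symm).symm

/-- The Yang–Baxter equation is used once for each `j` in `l`; the factors for different `j` in rows
`a` and `b` act on disjoint sites, so the two rows can be interleaved. -/
theorem rOp_mul_rtProd_mul_rtProd (hθ : IsSignForm θ) {α : K} {β : ι → ι → K}
    (hs : ∀ a b, β a b = β b a) {a b : ι} (hab : a ≠ b)
    (hβ : ∀ j, j ≠ a → j ≠ b → β j a * β j b = α * (β j b - β j a)) {l : List ι}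
    (hl : l.Nodup) (ha : a ∉ l) (hb : b ∉ l) :
    rOp J W α a b * (rtProd W θ β a l * rtProd W θ β b l) =
      rtProd W θ β b l * rtProd W θ β a l * rOp J W α a b := by
  induction l with
  | nil => simp [rtProd]
  | cons j l ih =>
    simp only [List.mem_cons, not_or, List.nodup_cons] at ha hb hl
    have h1 : Commute (rtProd W θ β a l) (rtOp W θ β b j) :=
      Commute.rtOp_right (commute_rtProd_pairOp β hab.symm (Ne.symm ha.1) hb.2 hl.1)
    have h2 : Commute (rtProd W θ β b l) (rtOp W θ β a j) :=
      Commute.rtOp_right (commute_rtProd_pairOp β hab (Ne.symm hb.1) ha.2 hl.1)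
    have h3 := rOp_mul_rtOp_mul_rtOp (W := W) hθ (Ne.symm ha.1) (Ne.symm hb.1) hab
      (hβ j (Ne.symm ha.1) (Ne.symm hb.1))
    rw [rtOp_comm hθ hs j a, rtOp_comm hθ hs j b] at h3
    have h4 := ih hl.2 ha.2 hb.2
    rw [rtProd_cons, rtProd_cons]
    calc rOp J W α a b * (rtOp W θ β a j * rtProd W θ β a l *
          (rtOp W θ β b j * rtProd W θ β b l))
        = rOp J W α a b * (rtOp W θ β a j * (rtProd W θ β a l *
          rtOp W θ β b j) * rtProd W θ β b l) := by simp only [mul_assoc]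
      _ = rOp J W α a b * (rtOp W θ β a j * rtOp W θ β b j) *
          (rtProd W θ β a l * rtProd W θ β b l) := by rw [h1.eq]; simp only [mul_assoc]
      _ = rtOp W θ β b j * rtOp W θ β a j * (rOp J W α a b *
          (rtProd W θ β a l * rtProd W θ β b l)) := by rw [h3]; simp only [mul_assoc]
      _ = rtOp W θ β b j * (rtOp W θ β a j * rtProd W θ β b l) * rtProd W θ β a l *
          rOp J W α a b := by rw [h4]; simp only [mul_assoc]
      _ = _ := by rw [← h2.eq]; simp only [mul_assoc]

/-- Interchanging two adjacent sites in the product `⟨S_1, …, S_k⟩`. -/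
theorem rOp_mul_bracket (hθ : IsSignForm θ) {S : ι → Matrix J J W} {α : K} {β : ι → ι → K}
    (hs : ∀ a b, β a b = β b a) {a b : ι} (hQ : Quat θ (S a) (S b) α (β a b))
    (hβ : ∀ j, j ≠ a → j ≠ b → β j a * β j b = α * (β j b - β j a)) (l₁ : List ι) {l₂ : List ι}
    (hl : (l₁ ++ a :: b :: l₂).Nodup) :
    rOp J W α a b * bracket θ S β (l₁ ++ a :: b :: l₂) =
      bracket θ S β (l₁ ++ b :: a :: l₂) * rOp J W α a b := by
  induction l₁ with
  | nil =>
    simp only [List.nil_append, List.nodup_cons, List.mem_cons, not_or] at hl ⊢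
    obtain ⟨⟨hab, ha⟩, hb, hl⟩ := hl
    simp only [bracket, rtProd_cons]
    have h1 : Commute (rtProd W θ β a l₂) (siteOp (S b) b) :=
      commute_rtProd_siteOp _ β (Ne.symm hab) hb
    have h2 : Commute (rtProd W θ β b l₂) (siteOp (S a) a) := commute_rtProd_siteOp _ β hab ha
    have h3 := hQ.rOp_relation hθ hab
    have h4 := rOp_mul_rtProd_mul_rtProd (W := W) hθ hs hab hβ hl ha hb
    have h5 : Commute (rOp J W α a b) (bracket θ S β l₂) := by
      refine Commute.bracket_right (fun c hc => ?_) fun c hc d hd => ?_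
      · exact rOp_commute _ (commute_swap_siteOp _ (fun h => ha (h ▸ hc)) fun h => hb (h ▸ hc))
      · exact rOp_commute _ (commute_swap_pairOp θ (fun h => ha (h ▸ hc)) (fun h => hb (h ▸ hc))
          (fun h => ha (h ▸ hd)) fun h => hb (h ▸ hd))
    -- Moving `S_b` left past the tail of row `a` exposes the two-site relation; after it `1 - αP`
    -- meets the two tails, which the previous lemma interchanges, and finally sites where it acts
    -- trivially.
    calc rOp J W α a b * (siteOp (S a) a * (rtOp W θ β a b * rtProd W θ β a l₂) *
          (siteOp (S b) b * rtProd W θ β b l₂ * bracket θ S β l₂))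
        = rOp J W α a b * (siteOp (S a) a * rtOp W θ β a b * (rtProd W θ β a l₂ *
          siteOp (S b) b) * rtProd W θ β b l₂ * bracket θ S β l₂) := by simp only [mul_assoc]
      _ = rOp J W α a b * (siteOp (S a) a * rtOp W θ β a b * siteOp (S b) b) *
          (rtProd W θ β a l₂ * rtProd W θ β b l₂) * bracket θ S β l₂ := by
          rw [h1.eq]; simp only [mul_assoc]
      _ = siteOp (S b) b * rtOp W θ β a b * siteOp (S a) a * (rOp J W α a b *
          (rtProd W θ β a l₂ * rtProd W θ β b l₂)) * bracket θ S β l₂ := by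
          rw [h3]; simp only [mul_assoc]
      _ = siteOp (S b) b * rtOp W θ β a b * siteOp (S a) a *
          (rtProd W θ β b l₂ * rtProd W θ β a l₂) * (rOp J W α a b * bracket θ S β l₂) := by
          rw [h4]; simp only [mul_assoc]
      _ = siteOp (S b) b * rtOp W θ β a b * (siteOp (S a) a *
          rtProd W θ β b l₂) * rtProd W θ β a l₂ * (bracket θ S β l₂ * rOp J W α a b) := by
          rw [h5.eq]; simp only [mul_assoc]
      _ = _ := by rw [← h2.eq, rtOp_comm hθ hs a b]; simp only [mul_assoc]
  | cons j l₁ ih =>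
    rw [List.cons_append, List.nodup_cons] at hl
    have h0 := ih hl.2
    have hj := hl.1
    simp only [List.mem_append, List.mem_cons, not_or] at hj
    have hl2 := hl.2
    simp only [List.nodup_append, List.nodup_cons, List.mem_cons, not_or] at hl2
    obtain ⟨-, ⟨⟨hab, ha⟩, hb, -⟩, hd⟩ := hl2
    have ha1 : a ∉ l₁ := fun h => hd a h a (by simp) rfl
    have hb1 : b ∉ l₁ := fun h => hd b h b (by simp) rfl
    have hja := hj.2.1
    have hjb := hj.2.2.1
    simp only [List.cons_append, bracket, rtProd_append, rtProd_cons]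
    have h1 : Commute (rOp J W α a b) (siteOp (S j) j) :=
      rOp_commute _ (commute_swap_siteOp _ hja hjb)
    have h2 : ∀ l : List ι, a ∉ l → b ∉ l → Commute (rOp J W α a b) (rtProd W θ β j l) :=
      fun l h h' => Commute.rtProd_right fun c hc => rOp_commute _
        (commute_swap_pairOp θ hja hjb (fun e => h (e ▸ hc)) fun e => h' (e ▸ hc))
    have h3 := rOp_mul_rtOp_mul_rtOp (W := W) hθ hja hjb hab (hβ j hja hjb)
    -- For a leading site `j` only the adjacent pair of factors `(j, a)`, `(j, b)` is affected, and
    -- the Yang–Baxter equation reverses it; everything else in row `j` commutes with `1 - αP`.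
    calc rOp J W α a b * (siteOp (S j) j * (rtProd W θ β j l₁ * (rtOp W θ β j a *
          (rtOp W θ β j b * rtProd W θ β j l₂))) * bracket θ S β (l₁ ++ a :: b :: l₂))
        = (rOp J W α a b * siteOp (S j) j) * rtProd W θ β j l₁ * (rtOp W θ β j a *
          rtOp W θ β j b) * rtProd W θ β j l₂ * bracket θ S β (l₁ ++ a :: b :: l₂) := by
          simp only [mul_assoc]
      _ = siteOp (S j) j * (rOp J W α a b * rtProd W θ β j l₁) * (rtOp W θ β j a *
          rtOp W θ β j b) * rtProd W θ β j l₂ * bracket θ S β (l₁ ++ a :: b :: l₂) := by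
          rw [h1.eq]; simp only [mul_assoc]
      _ = siteOp (S j) j * rtProd W θ β j l₁ * (rOp J W α a b * (rtOp W θ β j a *
          rtOp W θ β j b)) * rtProd W θ β j l₂ * bracket θ S β (l₁ ++ a :: b :: l₂) := by
          rw [(h2 l₁ ha1 hb1).eq]; simp only [mul_assoc]
      _ = siteOp (S j) j * rtProd W θ β j l₁ * (rtOp W θ β j b * rtOp W θ β j a) *
          (rOp J W α a b * rtProd W θ β j l₂) * bracket θ S β (l₁ ++ a :: b :: l₂) := by
          rw [h3]; simp only [mul_assoc]
      _ = siteOp (S j) j * rtProd W θ β j l₁ * (rtOp W θ β j b * rtOp W θ β j a) *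
          rtProd W θ β j l₂ * (rOp J W α a b * bracket θ S β (l₁ ++ a :: b :: l₂)) := by
          rw [(h2 l₂ ha hb).eq]; simp only [mul_assoc]
      _ = _ := by rw [h0]; simp only [mul_assoc]

/-- The product of the operators `1 + β Q` over the pairs from two lists of sites. -/
def crossProd (W : Type*) [Ring W] [Algebra K W] (θ : J → J → ℤ) (β : ι → ι → K)
    (l l' : List ι) : SiteMatrix ι J W :=
  (l.map fun a => rtProd W θ β a l').prod

/-- The factors joining a site of `l` to `l'` act on sites disjoint from the rest of `l`, so they
can be pushed right past the remaining product over `l`. -/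
theorem bracket_append (S : ι → Matrix J J W) (β : ι → ι → K) {l l' : List ι}
    (hl : (l ++ l').Nodup) :
    bracket θ S β (l ++ l') = bracket θ S β l * crossProd W θ β l l' * bracket θ S β l' := by
  induction l with
  | nil => simp [bracket, crossProd]
  | cons a l ih =>
    rw [List.cons_append, List.nodup_cons, List.mem_append, not_or] at hl
    have hd := List.disjoint_of_nodup_append hl.2
    have h : Commute (rtProd W θ β a l') (bracket θ S β l) := by
      refine Commute.bracket_right (fun c hc => ?_) fun c hc d hd' => ?_
      · exact commute_rtProd_siteOp _ _ (fun h => hl.1.1 (h ▸ hc)) fun h => hd hc h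
      · exact commute_rtProd_pairOp _ (fun h => hl.1.1 (h ▸ hc)) (fun h => hl.1.1 (h ▸ hd'))
          (fun h => hd hc h) fun h => hd hd' h
    calc bracket θ S β (a :: l ++ l')
        = siteOp (S a) a * (rtProd W θ β a l * rtProd W θ β a l') *
          (bracket θ S β l * crossProd W θ β l l' * bracket θ S β l') := by
          rw [← ih hl.2, ← rtProd_append]; rfl
      _ = siteOp (S a) a * rtProd W θ β a l * (rtProd W θ β a l' * bracket θ S β l) *
          crossProd W θ β l l' * bracket θ S β l' := by simp only [mul_assoc]
      _ = _ := by
        rw [h.eq, bracket, crossProd, crossProd, List.map_cons, List.prod_cons]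
        simp only [mul_assoc]

theorem siteOp_mul_siteOp (T T' : Matrix J J W) (a : ι) :
    siteOp T a * siteOp T' a = siteOp (T * T') a := by
  ext p q
  rw [siteOp_mul_apply, siteOp]
  by_cases h : ∀ c, c ≠ a → p c = q c
  · rw [if_pos h, Matrix.mul_apply]
    refine sum_congr rfl fun j _ => ?_
    rw [siteOp, if_pos fun c hc => by simp [hc, h c hc]]
    simp
  · rw [if_neg h]
    refine sum_eq_zero fun j _ => ?_
    rw [siteOp, if_neg, mul_zero]
    exact fun h' => h fun c hc => by simpa [hc] using h' c hc

theorem siteOp_one (a : ι) : siteOp (1 : Matrix J J W) a = 1 := by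
  ext p q
  by_cases h : p = q
  · subst h
    simp [siteOp]
  · rw [Matrix.one_apply_ne h, siteOp]
    split_ifs with h'
    · refine Matrix.one_apply_ne fun ha => h (funext fun c => ?_)
      by_cases hc : c = a
      · rw [hc, ha]
      · exact h' c hc
    · rfl

/-- By `Q² = |J| Q` the product is `1` plus the left side of `h` times `Q`. -/
theorem rtOp_mul_rtOp_eq_one (hθ : IsSignForm θ) {β β' : ι → ι → K} {a b : ι} (hab : a ≠ b)
    (h : β a b + β' a b + Fintype.card J * (β a b * β' a b) = 0) :
    rtOp W θ β a b * rtOp W θ β' a b = 1 := by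
  have hc : (Fintype.card J : W) • pairOp W θ a b =
      ((Fintype.card J : ℕ) : K) • pairOp W θ a b := by
    rw [Nat.cast_smul_eq_nsmul, Nat.cast_smul_eq_nsmul]
  simp only [rtOp, add_mul, mul_add, one_mul, mul_one, smul_mul_assoc, mul_smul_comm,
    pairOp_mul_self hθ hab, hc]
  have : (β a b + β' a b + Fintype.card J * (β a b * β' a b)) • pairOp W θ a b = 0 := by
    rw [h, zero_smul]
  rw [← sub_eq_zero, ← this]
  module

/-- The inverses of the factors in the opposite order again form a product of the same kind, for the
reversed list: by `bracket_append` the site `a` contributes its cross factors and `S'_a` at the far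
right, where they cancel `S_a Rᵗ_{ab} ⋯` from outside in. -/
theorem bracket_mul_bracket_reverse (hθ : IsSignForm θ) {S S' : ι → Matrix J J W}
    {β β' : ι → ι → K} {l : List ι} (hl : l.Nodup) (hS : ∀ a ∈ l, S a * S' a = 1)
    (hs : ∀ a b, β' a b = β' b a)
    (hβ : ∀ a b, a ≠ b → β a b + β' a b + Fintype.card J * (β a b * β' a b) = 0) :
    bracket θ S β l * bracket θ S' β' l.reverse = 1 := by
  induction l with
  | nil => simp [bracket]
  | cons a l ih =>
    rw [List.nodup_cons] at hl
    have h1 : ∀ m : List ι, a ∉ m → rtProd W θ β a m * crossProd W θ β' m.reverse [a] = 1 := by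
      intro m hm
      induction m with
      | nil => simp [rtProd, crossProd]
      | cons b m ihm =>
        simp only [List.mem_cons, not_or] at hm
        have h2 := ihm hm.2
        simp only [crossProd, List.reverse_cons, List.map_append, List.prod_append, List.map_cons,
          List.map_nil, List.prod_cons, List.prod_nil, mul_one] at h2 ⊢
        rw [rtProd_cons, mul_assoc, ← mul_assoc (rtProd W θ β a m), h2, one_mul, rtProd,
          List.map_cons, List.map_nil, List.prod_cons, List.prod_nil, mul_one, rtOp_comm hθ hs b a]
        exact rtOp_mul_rtOp_eq_one hθ hm.1 (hβ _ _ hm.1)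
    have h3 := ih hl.2 fun b hb => hS b (by simp [hb])
    rw [List.reverse_cons, bracket_append _ _ (by
      rw [← List.reverse_cons, List.nodup_reverse]; exact List.nodup_cons.mpr hl)]
    simp only [bracket, rtProd, List.map_nil, List.prod_nil, mul_one]
    calc siteOp (S a) a * (l.map (rtOp W θ β a)).prod * bracket θ S β l *
          (bracket θ S' β' l.reverse * crossProd W θ β' l.reverse [a] * siteOp (S' a) a)
        = siteOp (S a) a * (l.map (rtOp W θ β a)).prod * (bracket θ S β l *
          bracket θ S' β' l.reverse) * crossProd W θ β' l.reverse [a] * siteOp (S' a) a := by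
          simp only [mul_assoc]
      _ = siteOp (S a) a * ((l.map (rtOp W θ β a)).prod * crossProd W θ β' l.reverse [a]) *
          siteOp (S' a) a := by rw [h3, mul_one]; simp only [mul_assoc]
      _ = 1 := by
        have := h1 l hl.1
        rw [rtProd] at this
        rw [this, mul_one, siteOp_mul_siteOp, hS a (by simp), siteOp_one]

/-- The relation satisfied by the inverse matrices. -/
theorem Quat.inverse (hθ : IsSignForm θ) {T T' Ti Ti' : Matrix J J W} {α β β' : K}
    (h : Quat θ T T' α β) (h1 : T * Ti = 1) (h2 : Ti * T = 1) (h1' : T' * Ti' = 1)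
    (h2' : Ti' * T' = 1) (hβ : β + β' + Fintype.card J * (β * β') = 0) :
    Quat θ Ti' Ti α β' := by
  -- `T` is put on site `1` and `T'` on site `0`, so that after inversion `Ti'` stands on site `0`,
  -- as needed for the order of arguments in the conclusion.
  have h3 := h.rOp_relation (β := fun _ _ : Fin 2 => β) hθ one_ne_zero
  have e1 : rtOp W θ (fun _ _ : Fin 2 => β) 1 0 * rtOp W θ (fun _ _ : Fin 2 => β') 1 0 = 1 :=
    rtOp_mul_rtOp_eq_one hθ one_ne_zero hβ
  have e2 : rtOp W θ (fun _ _ : Fin 2 => β') 1 0 * rtOp W θ (fun _ _ : Fin 2 => β) 1 0 = 1 :=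
    rtOp_mul_rtOp_eq_one hθ one_ne_zero (by linear_combination hβ)
  have s1 : siteOp T (1 : Fin 2) * siteOp Ti 1 = 1 := by rw [siteOp_mul_siteOp, h1, siteOp_one]
  have s2 : siteOp Ti (1 : Fin 2) * siteOp T 1 = 1 := by rw [siteOp_mul_siteOp, h2, siteOp_one]
  have s3 : siteOp T' (0 : Fin 2) * siteOp Ti' 0 = 1 := by rw [siteOp_mul_siteOp, h1', siteOp_one]
  have s4 : siteOp Ti' (0 : Fin 2) * siteOp T' 0 = 1 := by rw [siteOp_mul_siteOp, h2', siteOp_one]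
  refine Quat.of_rOp_relation hθ ?_
  have e3 : rtOp W θ (fun _ _ : Fin 2 => β') 1 0 = 1 + β' • pairOp W θ 0 1 := by
    rw [rtOp, pairOp_comm hθ]
  have e4 : rOp J W α (1 : Fin 2) 0 = rOp J W α 0 1 := by rw [rOp, rOp, swap_comm]
  rw [← e3, ← e4]
  generalize rtOp W θ (fun _ _ : Fin 2 => β) 1 0 = B at *
  generalize rtOp W θ (fun _ _ : Fin 2 => β') 1 0 = B' at *
  generalize rOp J W α (1 : Fin 2) 0 = R at *
  generalize siteOp T (1 : Fin 2) = A1 at *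
  generalize siteOp Ti (1 : Fin 2) = A1' at *
  generalize siteOp T' (0 : Fin 2) = A2 at *
  generalize siteOp Ti' (0 : Fin 2) = A2' at *
  have f1 : A1 * B * A2 * (A2' * B' * A1') = 1 := by
    rw [mul_assoc (A1 * B), ← mul_assoc A2, ← mul_assoc A2, s3, one_mul, mul_assoc A1,
      ← mul_assoc B, e1, one_mul, s1]
  have f2 : A1' * B' * A2' * (A2 * B * A1) = 1 := by
    rw [mul_assoc (A1' * B'), ← mul_assoc A2', ← mul_assoc A2', s4, one_mul, mul_assoc A1',
      ← mul_assoc B', e2, one_mul, s2]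
  calc R * (A2' * B' * A1') = A1' * B' * A2' * (A2 * B * A1) * R * (A2' * B' * A1') := by
        rw [f2, one_mul]
    _ = A1' * B' * A2' * (R * (A1 * B * A2)) * (A2' * B' * A1') := by rw [h3]; simp only [mul_assoc]
    _ = A1' * B' * A2' * R * (A1 * B * A2 * (A2' * B' * A1')) := by simp only [mul_assoc]
    _ = _ := by rw [f1, mul_one]

end Bracket

/-! ### Adding sites on which an operator acts trivially -/

section Ext

variable {ι ι' J K W : Type*} [Fintype ι] [DecidableEq ι] [Fintype ι'] [DecidableEq ι']
  [Fintype J] [DecidableEq J] [CommRing K] [Ring W] [Algebra K W]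

open Classical in
/-- The operator on more sites obtained from `Y` along a map of sites. -/
def extOp (f : ι → ι') (Y : SiteMatrix ι J W) : SiteMatrix ι' J W := fun p q =>
  if ∀ c ∉ Set.range f, p c = q c then Y (p ∘ f) (q ∘ f) else 0

theorem extOp_of {f : ι → ι'} {Y : SiteMatrix ι J W} {p q : ι' → J}
    (h : ∀ c ∉ Set.range f, p c = q c) : extOp f Y p q = Y (p ∘ f) (q ∘ f) :=
  if_pos h

theorem extOp_of_not {f : ι → ι'} {Y : SiteMatrix ι J W} {p q : ι' → J}
    (h : ¬ ∀ c ∉ Set.range f, p c = q c) : extOp f Y p q = 0 :=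
  if_neg h

theorem actsOn_extOp (f : ι → ι') (Y : SiteMatrix ι J W) : ActsOn (Set.range f) (extOp f Y) := by
  constructor
  · intro p q h
    by_contra h'
    exact h (extOp_of_not h')
  · intro p q p' q' hp hq h h'
    rw [extOp_of h, extOp_of h']
    congr 1
    · exact funext fun c => hp _ ⟨c, rfl⟩
    · exact funext fun c => hq _ ⟨c, rfl⟩

theorem ActsOn.eq_zero {s : Set ι} {Y : SiteMatrix ι J W} (hY : ActsOn s Y) {p q : ι → J}
    (h : ¬ ∀ c ∉ s, p c = q c) : Y p q = 0 :=
  by_contra fun h0 => h (hY.1 p q h0)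

/-- An operator supported on the image of `f` is determined by its entries there. -/
theorem extOp_eq {f : ι → ι'} (hf : f.Injective) {Y : SiteMatrix ι J W} {Z : SiteMatrix ι' J W}
    (hZ : ActsOn (Set.range f) Z)
    (h : ∀ p q : ι' → J, (∀ c ∉ Set.range f, p c = q c) → Y (p ∘ f) (q ∘ f) = Z p q) :
    extOp f Y = Z := by
  ext p q
  by_cases hpq : ∀ c ∉ Set.range f, p c = q c
  · rw [extOp_of hpq, h _ _ hpq]
  · rw [extOp_of_not hpq, hZ.eq_zero hpq]

theorem extOp_mul {f : ι → ι'} (hf : f.Injective) (Y Z : SiteMatrix ι J W) :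
    extOp f (Y * Z) = extOp f Y * extOp f Z := by
  ext p q
  rw [Matrix.mul_apply]
  by_cases h : ∀ c ∉ Set.range f, p c = q c
  · rw [extOp_of h, Matrix.mul_apply]
    -- The contributing intermediate multi-indices are arbitrary on the image of `f` and equal to
    -- `p` off it.
    refine sum_of_injOn (fun r => Function.extend f r p) ?_ (by simp) ?_ ?_
    · intro x _ y _ hxy
      have := congrArg (· ∘ f) hxy
      simpa [Function.extend_comp hf] using this
    · intro r _ hr
      by_contra h0
      have h1 := (actsOn_extOp f Y).1 _ _ (left_ne_zero_of_mul h0)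
      refine hr ⟨r ∘ f, by simp, funext fun c => ?_⟩
      by_cases hc : c ∈ Set.range f
      · obtain ⟨c, rfl⟩ := hc
        simp [hf.extend_apply]
      · simp only
        rw [Function.extend_apply' _ _ _ hc, h1 c hc]
    · intro r _
      rw [extOp_of, extOp_of, Function.extend_comp hf]
      · intro c hc
        rw [Function.extend_apply' _ _ _ hc, h c hc]
      · intro c hc
        rw [Function.extend_apply' _ _ _ hc]
  · rw [extOp_of_not h, eq_comm]
    refine sum_eq_zero fun r _ => ?_
    by_contra h0
    have h1 := (actsOn_extOp f Y).1 _ _ (left_ne_zero_of_mul h0)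
    have h2 := (actsOn_extOp f Z).1 _ _ (right_ne_zero_of_mul h0)
    exact h fun c hc => (h1 c hc).trans (h2 c hc)

theorem extOp_one {f : ι → ι'} (hf : f.Injective) :
    extOp f (1 : SiteMatrix ι J W) = 1 := by
  refine extOp_eq hf (ActsOn.one _) fun p q h => ?_
  by_cases hpq : p = q
  · subst hpq
    simp
  · rw [Matrix.one_apply_ne hpq, Matrix.one_apply_ne]
    intro h'
    refine hpq (funext fun c => ?_)
    by_cases hc : c ∈ Set.range f
    · obtain ⟨c, rfl⟩ := hc
      exact congrFun h' c
    · exact h c hc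

theorem extOp_add (f : ι → ι') (Y Z : SiteMatrix ι J W) :
    extOp f (Y + Z) = extOp f Y + extOp f Z := by
  ext p q
  by_cases h : ∀ c ∉ Set.range f, p c = q c
  · simp only [Matrix.add_apply, extOp_of h]
  · simp only [Matrix.add_apply, extOp_of_not h, add_zero]

theorem extOp_smul {R : Type*} [SMulZeroClass R W] (f : ι → ι') (k : R) (Y : SiteMatrix ι J W) :
    extOp f (k • Y) = k • extOp f Y := by
  ext p q
  by_cases h : ∀ c ∉ Set.range f, p c = q c
  · simp only [Matrix.smul_apply, extOp_of h]
  · simp only [Matrix.smul_apply, extOp_of_not h, smul_zero]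

theorem extOp_siteOp {f : ι → ι'} (hf : f.Injective) (T : Matrix J J W) (a : ι) :
    extOp f (siteOp T a) = siteOp T (f a) := by
  refine extOp_eq hf ((actsOn_siteOp T (f a)).mono (by simp)) fun p q h => ?_
  have : (∀ c, c ≠ a → (p ∘ f) c = (q ∘ f) c) ↔ ∀ c, c ≠ f a → p c = q c := by
    constructor
    · intro h' c hc
      by_cases hc' : c ∈ Set.range f
      · obtain ⟨c, rfl⟩ := hc'
        exact h' c fun e => hc (e ▸ rfl)
      · exact h c hc'
    · exact fun h' c hc => h' _ fun e => hc (hf e)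
  simp only [siteOp, this]
  rfl

theorem extOp_pairOp [Neg J] (θ : J → J → ℤ) {f : ι → ι'} (hf : f.Injective) (a b : ι) :
    extOp f (pairOp W θ a b) = pairOp W θ (f a) (f b) := by
  refine extOp_eq hf ((actsOn_pairOp θ (f a) (f b)).mono
    (by rintro _ (rfl | rfl) <;> simp)) fun p q h => ?_
  have : (∀ c, c ≠ a → c ≠ b → (p ∘ f) c = (q ∘ f) c) ↔
      ∀ c, c ≠ f a → c ≠ f b → p c = q c := by
    constructor
    · intro h' c hc hcb
      by_cases hc' : c ∈ Set.range f
      · obtain ⟨c, rfl⟩ := hc'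
        exact h' c (fun e => hc (e ▸ rfl)) fun e => hcb (e ▸ rfl)
      · exact h c hc'
    · exact fun h' c hc hcb => h' _ (fun e => hc (hf e)) fun e => hcb (hf e)
  simp only [pairOp, this]
  rfl

theorem extOp_rtProd [InvolutiveNeg J] (θ : J → J → ℤ) {f : ι → ι'} (hf : f.Injective)
    (β : ι' → ι' → K) (a : ι) (l : List ι) :
    extOp f (rtProd W θ (fun a b => β (f a) (f b)) a l) = rtProd W θ β (f a) (l.map f) := by
  induction l with
  | nil => simpa [rtProd] using extOp_one hf
  | cons b l ih =>
    rw [List.map_cons, rtProd_cons, rtProd_cons, extOp_mul hf, ih, rtOp, rtOp, extOp_add,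
      extOp_one hf, extOp_smul, extOp_pairOp _ hf]

theorem extOp_bracket [InvolutiveNeg J] (θ : J → J → ℤ) {f : ι → ι'} (hf : f.Injective)
    (S : ι' → Matrix J J W) (β : ι' → ι' → K) (l : List ι) :
    extOp f (bracket θ (S ∘ f) (fun a b => β (f a) (f b)) l) = bracket θ S β (l.map f) := by
  induction l with
  | nil => simpa [bracket] using extOp_one hf
  | cons b l ih =>
    rw [List.map_cons, bracket, bracket, extOp_mul hf, extOp_mul hf, ih, extOp_rtProd _ hf,
      extOp_siteOp hf, Function.comp_apply]

theorem bracket_map_equiv_apply [InvolutiveNeg J] (θ : J → J → ℤ) (e : ι ≃ ι')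
    (S : ι' → Matrix J J W) (β : ι' → ι' → K) (l : List ι) (p q : ι' → J) :
    bracket θ S β (l.map e) p q =
      bracket θ (S ∘ e) (fun a b => β (e a) (e b)) l (p ∘ e) (q ∘ e) := by
  rw [← extOp_bracket θ e.injective, extOp_of (by simp)]

end Ext

/-! ### Ring homomorphisms, central factors and entrywise commutation -/

section Functoriality

variable {ι J K W K' W' : Type*} [Fintype ι] [DecidableEq ι] [Fintype J] [DecidableEq J]
  [CommRing K] [Ring W] [Algebra K W] [CommRing K'] [Ring W'] [Algebra K' W']
  [InvolutiveNeg J] {θ : J → J → ℤ}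

theorem map_rtProd (φ : W →+* W') {β : ι → ι → K} {β' : ι → ι → K'}
    (hβ : ∀ a b, φ (algebraMap K W (β a b)) = algebraMap K' W' (β' a b)) (a : ι) (l : List ι) :
    (rtProd W θ β a l).map φ = rtProd W' θ β' a l := by
  induction l with
  | nil => simp [rtProd]
  | cons b l ih =>
    rw [rtProd_cons, rtProd_cons, Matrix.map_mul, ih]
    congr 1
    ext p q
    simp only [rtOp, Matrix.map_apply, Matrix.add_apply, Matrix.smul_apply, map_add,
      Matrix.one_apply, pairOp]
    rw [Algebra.smul_def, Algebra.smul_def, map_mul, hβ]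
    congr 1
    · split_ifs <;> simp
    · split_ifs <;> simp

theorem map_bracket (φ : W →+* W') (S : ι → Matrix J J W) {β : ι → ι → K} {β' : ι → ι → K'}
    (hβ : ∀ a b, φ (algebraMap K W (β a b)) = algebraMap K' W' (β' a b)) (l : List ι) :
    (bracket θ S β l).map φ = bracket θ (fun a => (S a).map φ) β' l := by
  induction l with
  | nil => simp [bracket]
  | cons b l ih =>
    rw [bracket, bracket, Matrix.map_mul, Matrix.map_mul, ih, map_rtProd φ hβ]
    congr 2
    ext p q
    simp only [Matrix.map_apply, siteOp]
    split_ifs <;> simp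

/-- This turns commutation with all entries into commutation of operators, to which the product
lemmas such as `Commute.bracket_right` apply. -/
theorem commute_scalar_iff {n : Type*} [Fintype n] [DecidableEq n] (w : W) (Y : Matrix n n W) :
    Commute (Matrix.scalar n w) Y ↔ ∀ p q, Commute w (Y p q) := by
  constructor
  · intro h p q
    have := congrFun (congrFun h.eq p) q
    simpa [Commute, SemiconjBy] using this
  · intro h
    ext p q
    simpa using (h p q).eq

theorem commute_bracket_apply {S : ι → Matrix J J W} (β : ι → ι → K) {w : W} {l : List ι}
    (h : ∀ a ∈ l, ∀ i j, Commute w (S a i j)) (p q : ι → J) :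
    Commute w (bracket θ S β l p q) := by
  refine (commute_scalar_iff w _).mp (Commute.bracket_right (fun a ha => ?_) fun a _ b _ => ?_) p q
  · refine (commute_scalar_iff w _).mpr fun p q => ?_
    unfold siteOp
    split_ifs
    · exact h a ha _ _
    · exact Commute.zero_right _
  · exact (commute_scalar_iff w _).mpr fun p q => (commute_pairOp_apply ..).symm

theorem bracket_smul {S : ι → Matrix J J W} (β : ι → ι → K) (c : ι → W) (l : List ι)
    (h : ∀ a ∈ l, ∀ b ∈ l, ∀ i j, Commute (c a) (S b i j)) :
    bracket θ (fun a => c a • S a) β l = (l.map c).prod • bracket θ S β l := by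
  induction l with
  | nil => simp [bracket]
  | cons b l ih =>
    have hs : siteOp (c b • S b) b = c b • siteOp (S b) b := by
      ext p q
      simp only [siteOp, Matrix.smul_apply]
      split_ifs <;> simp
    have hc : ∀ Y : SiteMatrix ι J W, (l.map c).prod • Y = Matrix.scalar _ (l.map c).prod * Y := by
      intro Y
      ext p q
      simp
    have h1 : Commute (Matrix.scalar _ (l.map c).prod)
        (siteOp (S b) b * rtProd W θ β b l) := by
      refine Commute.mul_right ((commute_scalar_iff _ _).mpr fun p q => ?_)
        (Commute.rtProd_right fun d _ => (commute_scalar_iff _ _).mpr fun p q =>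
          (commute_pairOp_apply ..).symm)
      unfold siteOp
      split_ifs
      · refine Commute.list_prod_left _ _ fun x hx => ?_
        obtain ⟨a, ha, rfl⟩ := List.mem_map.mp hx
        exact h a (by simp [ha]) b (by simp) _ _
      · exact Commute.zero_right _
    rw [bracket, bracket, ih fun a ha d hd => h a (by simp [ha]) d (by simp [hd]), hs, hc,
      ← mul_assoc, smul_mul_assoc, smul_mul_assoc, ← h1.eq, List.map_cons, List.prod_cons,
      mul_smul, hc]
    simp only [mul_assoc, smul_mul_assoc]

end Functoriality

/-! ### Restriction to a symmetric subset of indices -/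

section Restriction

variable {ι J J' K W : Type*} [Fintype ι] [DecidableEq ι] [Fintype J] [DecidableEq J]
  [Fintype J'] [DecidableEq J'] [CommRing K] [Ring W] [Algebra K W] [InvolutiveNeg J]
  [InvolutiveNeg J'] {θ : J → J → ℤ} {B : J' → J}

theorem apply_eq_of_rtProd_ne_zero (β : ι → ι → K) {a : ι} {l : List ι} {x y : ι → J}
    (h : rtProd W θ β a l x y ≠ 0) {c : ι} (hca : c ≠ a) (hc : c ∉ l) : x c = y c := by
  induction l generalizing x with
  | nil =>
    by_contra hxy
    exact h (by simp [rtProd, Matrix.one_apply_ne fun e : x = y => hxy (e ▸ rfl)])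
  | cons b l ih =>
    simp only [List.mem_cons, not_or] at hc
    rw [rtProd_cons, Matrix.mul_apply] at h
    obtain ⟨r, -, hr⟩ := exists_ne_zero_of_sum_ne_zero h
    rw [← ih (right_ne_zero_of_mul hr) hc.2]
    have h1 := left_ne_zero_of_mul hr
    by_contra h2
    refine h1 ?_
    have h3 : pairOp W θ a b x r = 0 := by
      by_contra h3
      exact h2 ((of_pairOp_ne_zero h3).2.2 c hca hc.1)
    rw [rtOp, Matrix.add_apply, Matrix.smul_apply, h3, smul_zero, add_zero,
      Matrix.one_apply_ne fun e : x = r => h2 (e ▸ rfl)]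

theorem apply_eq_of_bracket_ne_zero {S : ι → Matrix J J W} (β : ι → ι → K) {l : List ι}
    {x y : ι → J} (h : bracket θ S β l x y ≠ 0) {c : ι} (hc : c ∉ l) : x c = y c := by
  induction l generalizing x with
  | nil =>
    by_contra hxy
    exact h (by simp [bracket, Matrix.one_apply_ne fun e : x = y => hxy (e ▸ rfl)])
  | cons b l ih =>
    simp only [List.mem_cons, not_or] at hc
    rw [bracket, Matrix.mul_apply] at h
    obtain ⟨r, -, hr⟩ := exists_ne_zero_of_sum_ne_zero h
    rw [← ih (right_ne_zero_of_mul hr) hc.2]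
    have h1 := left_ne_zero_of_mul hr
    rw [Matrix.mul_apply] at h1
    obtain ⟨s, -, hs⟩ := exists_ne_zero_of_sum_ne_zero h1
    rw [← apply_eq_of_rtProd_ne_zero β (right_ne_zero_of_mul hs) hc.1 hc.2]
    exact (actsOn_siteOp _ _).1 _ _ (left_ne_zero_of_mul hs) c hc.1

/-- Each `Q_{ab}` requires opposite indices at its two sites, in its row and in its column, so
membership in the symmetric set passes between the sites. The mixed boundary data (rows on `l`,
column at `a`) are those available inside `⟨S₁, …⟩`: `S_a` changes only site `a`, and the later
factors do not touch `a`. -/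
theorem range_of_rtProd_ne_zero (hneg : ∀ i, B (-i) = -B i) (β : ι → ι → K) {a : ι} {l : List ι}
    (hl : l.Nodup) (ha : a ∉ l) {x y : ι → J} (hx : ∀ c ∈ l, x c ∈ Set.range B)
    (hy : y a ∈ Set.range B) (h : rtProd W θ β a l x y ≠ 0) :
    x a ∈ Set.range B ∧ ∀ c ∈ l, y c ∈ Set.range B := by
  have hneg' : ∀ j, j ∈ Set.range B → -j ∈ Set.range B := by
    rintro j ⟨i, hi⟩
    exact ⟨-i, by rw [hneg, hi]⟩
  induction l generalizing x with
  | nil =>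
    have : x = y := by
      by_contra hxy
      exact h (by simp [rtProd, Matrix.one_apply_ne hxy])
    exact ⟨this ▸ hy, by simp⟩
  | cons b l ih =>
    simp only [List.nodup_cons, List.mem_cons, not_or] at hl ha
    rw [rtProd_cons, Matrix.mul_apply] at h
    obtain ⟨r, -, hr⟩ := exists_ne_zero_of_sum_ne_zero h
    have h1 := left_ne_zero_of_mul hr
    have h2 := right_ne_zero_of_mul hr
    have hb := apply_eq_of_rtProd_ne_zero β h2 (Ne.symm ha.1) hl.1
    by_cases hxr : x = r
    · subst hxr
      obtain ⟨h3, h4⟩ := ih hl.2 ha.2 (fun c hc => hx c (by simp [hc])) h2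
      refine ⟨h3, fun c hc => ?_⟩
      rcases List.mem_cons.mp hc with rfl | hc
      · rw [← hb]
        exact hx _ (by simp)
      · exact h4 c hc
    · have h3 : pairOp W θ a b x r ≠ 0 := by
        intro h3
        refine h1 ?_
        rw [rtOp, Matrix.add_apply, Matrix.smul_apply, h3, smul_zero, add_zero,
          Matrix.one_apply_ne hxr]
      obtain ⟨e1, e2, e3⟩ := of_pairOp_ne_zero h3
      have hxb := hx b (by simp)
      obtain ⟨h4, h5⟩ := ih hl.2 ha.2 (fun c hc => by
        rw [← e3 c (fun e => ha.2 (e ▸ hc)) fun e => hl.1 (e ▸ hc)]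
        exact hx c (by simp [hc])) h2
      refine ⟨e1 ▸ hneg' _ hxb, fun c hc => ?_⟩
      rcases List.mem_cons.mp hc with rfl | hc
      · rw [← hb, ← neg_neg (r c), ← e2]
        exact hneg' _ h4
      · exact h5 c hc

theorem mul_apply_comp (hB : B.Injective) {Y Z : SiteMatrix ι J W} {p : ι → J} {q : ι → J}
    (h : ∀ r, Y p r ≠ 0 → Z r q ≠ 0 → ∀ c, r c ∈ Set.range B) :
    (Y * Z) p q = ∑ r : ι → J', Y p (B ∘ r) * Z (B ∘ r) q := by
  rw [Matrix.mul_apply, eq_comm]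
  refine sum_of_injOn (fun r => B ∘ r) ?_ (by simp) ?_ (fun _ _ => rfl)
  · intro x _ y _ hxy
    exact hB.comp_left hxy
  · intro r _ hr
    by_contra h0
    choose r' hr' using h r (left_ne_zero_of_mul h0) (right_ne_zero_of_mul h0)
    exact hr ⟨r', by simp, funext hr'⟩

theorem pairOp_apply_comp (hB : B.Injective) (hneg : ∀ i, B (-i) = -B i) (a b : ι)
    (p q : ι → J') :
    pairOp W θ a b (B ∘ p) (B ∘ q) = pairOp W (fun i j => θ (B i) (B j)) a b p q := by
  simp only [pairOp, Function.comp_apply, ← hneg, hB.eq_iff]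

theorem one_apply_comp (hB : B.Injective) (p q : ι → J') :
    (1 : SiteMatrix ι J W) (B ∘ p) (B ∘ q) = (1 : SiteMatrix ι J' W) p q := by
  simp only [Matrix.one_apply, hB.comp_left.eq_iff]

theorem rtProd_apply_comp (hB : B.Injective) (hneg : ∀ i, B (-i) = -B i) (β : ι → ι → K) {a : ι}
    {l : List ι} (hl : l.Nodup) (ha : a ∉ l) (p q : ι → J') :
    rtProd W θ β a l (B ∘ p) (B ∘ q) = rtProd W (fun i j => θ (B i) (B j)) β a l p q := by
  induction l generalizing p with
  | nil => simpa [rtProd] using one_apply_comp hB p q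
  | cons b l ih =>
    simp only [List.nodup_cons, List.mem_cons, not_or] at hl ha
    rw [rtProd_cons, rtProd_cons, mul_apply_comp hB, Matrix.mul_apply]
    · refine sum_congr rfl fun r _ => ?_
      rw [ih hl.2 ha.2]
      simp only [rtOp, Matrix.add_apply, Matrix.smul_apply, pairOp_apply_comp hB hneg,
        one_apply_comp hB]
    · intro r h1 h2
      by_cases hpr : B ∘ p = r
      · subst hpr
        simp
      · have h3 : pairOp W θ a b (B ∘ p) r ≠ 0 := by
          intro h3
          refine h1 ?_
          rw [rtOp, Matrix.add_apply, Matrix.smul_apply, h3, smul_zero, add_zero,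
            Matrix.one_apply_ne hpr]
        obtain ⟨e1, e2, e3⟩ := of_pairOp_ne_zero h3
        have h4 := (range_of_rtProd_ne_zero hneg β hl.2 ha.2 (fun c hc => by
          rw [← e3 c (fun e => ha.2 (e ▸ hc)) fun e => hl.1 (e ▸ hc)]
          simp) (by simp) h2).1
        intro c
        by_cases hca : c = a
        · exact hca ▸ h4
        · by_cases hcb : c = b
          · obtain ⟨i, hi⟩ := h4
            exact ⟨-i, by rw [hneg, hi, e2, neg_neg, hcb]⟩
          · rw [← e3 c hca hcb]
            simp

/-- The entries of `⟨S_1, …, S_k⟩` with indices in a symmetric subset only involve the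
corresponding submatrix. -/
theorem bracket_apply_comp (hB : B.Injective) (hneg : ∀ i, B (-i) = -B i)
    (S : ι → Matrix J J W) (β : ι → ι → K) {l : List ι} (hl : l.Nodup) (p q : ι → J') :
    bracket θ S β l (B ∘ p) (B ∘ q) =
      bracket (fun i j => θ (B i) (B j)) (fun a => (S a).submatrix B B) β l p q := by
  induction l generalizing p with
  | nil => simpa [bracket] using one_apply_comp hB p q
  | cons a l ih =>
    simp only [List.nodup_cons] at hl
    -- The factors to the right do not act on `a`, so the index there is already that of the final
    -- column.
    have key : ∀ r s, rtProd W θ β a l r s ≠ 0 → bracket θ S β l s (B ∘ q) ≠ 0 →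
        s a ∈ Set.range B := by
      intro r s _ h2
      rw [apply_eq_of_bracket_ne_zero β h2 hl.1]
      simp
    rw [bracket, bracket, mul_assoc, mul_assoc, mul_apply_comp hB, Matrix.mul_apply]
    · refine sum_congr rfl fun r _ => ?_
      congr 1
      · simp only [siteOp, Function.comp_apply, hB.eq_iff]
        rfl
      · rw [mul_apply_comp hB, Matrix.mul_apply]
        · refine sum_congr rfl fun s _ => ?_
          rw [ih hl.2, rtProd_apply_comp hB hneg _ hl.2 hl.1]
        · intro s h1 h2 c
          have h3 := key _ s h1 h2
          have h4 := (range_of_rtProd_ne_zero hneg β hl.2 hl.1 (by simp) h3 h1).2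
          by_cases hca : c = a
          · exact hca ▸ h3
          · by_cases hc : c ∈ l
            · exact h4 c hc
            · rw [← apply_eq_of_rtProd_ne_zero β h1 hca hc]
              simp
    · intro r h1 h2 c
      have hr : ∀ c, c ≠ a → r c ∈ Set.range B := fun c hc => by
        rw [← (actsOn_siteOp _ _).1 _ _ h1 c hc]
        simp
      by_cases hca : c = a
      · subst hca
        rw [Matrix.mul_apply] at h2
        obtain ⟨s, -, hs⟩ := exists_ne_zero_of_sum_ne_zero h2
        exact (range_of_rtProd_ne_zero hneg β hl.2 hl.1
          (fun d hd => hr d fun e => hl.1 (e ▸ hd))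
          (key r s (left_ne_zero_of_mul hs) (right_ne_zero_of_mul hs))
          (left_ne_zero_of_mul hs)).1
      · exact hr c hca

end Restriction

/-! ### Antisymmetrized products: skew symmetry in rows and columns -/

section Alternating

variable {ι ι' J K W : Type*} [Fintype ι] [DecidableEq ι] [Fintype ι'] [DecidableEq ι']
  [Fintype J] [DecidableEq J] [CommRing K] [Ring W] [Algebra K W]

theorem altOp_apply_of_not_injective {p : ι → J} (hp : ¬ p.Injective) (q : ι → J)
    (Y : SiteMatrix ι J W) : (altOp ι J W * Y) p q = 0 := by
  rw [altOp_mul_apply]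
  simp only [Function.Injective, not_forall] at hp
  obtain ⟨i, j, hij, hne⟩ := hp
  refine sum_involution (fun σ _ => swap i j * σ) (fun σ _ => ?_) (fun σ _ _ => ?_) (by simp)
    fun σ _ => by simp [← mul_assoc]
  · have : p ∘ ⇑(swap i j * σ) = p ∘ σ := by
      funext c
      simp only [Function.comp_apply, Perm.mul_apply]
      by_cases h1 : σ c = i
      · rw [h1, swap_apply_left, hij]
      · by_cases h2 : σ c = j
        · rw [h2, swap_apply_right, hij]
        · rw [swap_apply_of_ne_of_ne h1 h2]
    rw [this, Perm.sign_mul, Perm.sign_swap hne]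
    simp
  · simpa using hne

theorem altOp_apply_self {p : ι → J} (hp : p.Injective) : altOp ι J W p p = 1 := by
  rw [altOp_apply, sum_eq_single 1]
  · simp
  · intro σ _ hσ
    rw [if_neg, smul_zero]
    exact fun h => hσ (Equiv.ext fun c => hp (congrFun h c))
  · simp

theorem altOp_apply_comp_right (p q : ι → J) (σ : Perm ι) :
    altOp ι J W p (q ∘ σ) = (Perm.sign σ : ℤ) • altOp ι J W p q := by
  have := congrFun (congrFun (altOp_mul_permOp (J := J) (W := W) σ⁻¹) p) q
  rw [mul_permOp_apply, inv_inv, Perm.sign_inv] at this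
  exact this

/-- The anti-symmetrized entry of an operator acting on a subset of the sites. -/
theorem altOp_mul_extOp_apply {f : ι → ι'} (hf : f.Injective) (Z : SiteMatrix ι J W)
    {p q : ι' → J} (hp : p.Injective) (h : ∀ c ∉ Set.range f, p c = q c) :
    (altOp ι' J W * extOp f Z) p q = (altOp ι J W * Z) (p ∘ f) (q ∘ f) := by
  rw [altOp_mul_apply, altOp_mul_apply, eq_comm]
  -- Off the image of `f` the operator is diagonal and `p = q`. As `p` is injective, only
  -- permutations fixing those sites contribute, and these are the extensions of permutations of
  -- `ι`.
  refine sum_of_injOn (fun τ : Perm ι => τ.viaFintypeEmbedding ⟨f, hf⟩) ?_ (by simp) ?_ ?_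
  · intro τ _ τ' _ h
    refine Equiv.ext fun a => hf ?_
    have := congrArg (· (f a)) h
    have e1 := τ.viaFintypeEmbedding_apply_image ⟨f, hf⟩ a
    have e2 := τ'.viaFintypeEmbedding_apply_image ⟨f, hf⟩ a
    simp only [Function.Embedding.coeFn_mk] at e1 e2 this
    rw [← e1, ← e2, this]
  · intro σ _ hσ
    by_cases hfix : ∀ c ∉ Set.range f, σ c = c
    · exfalso
      have hr : ∀ a, ∃ b, f b = σ (f a) := by
        intro a
        by_contra hn
        have := σ.injective (hfix (σ (f a)) hn)
        exact hn ⟨a, this.symm⟩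
      choose g hg using hr
      have hgi : g.Injective := fun x y hxy => hf (σ.injective (by rw [← hg, ← hg, hxy]))
      refine hσ ⟨Equiv.ofBijective g (Finite.injective_iff_bijective.mp hgi), by simp, ?_⟩
      refine Equiv.ext fun c => ?_
      by_cases hc : c ∈ Set.range f
      · obtain ⟨a, rfl⟩ := hc
        have := Perm.viaFintypeEmbedding_apply_image
          (Equiv.ofBijective g (Finite.injective_iff_bijective.mp hgi)) ⟨f, hf⟩ a
        simp only [Function.Embedding.coeFn_mk, ofBijective_apply] at this
        rw [this, hg]
      · rw [hfix c hc]
        exact Perm.viaFintypeEmbedding_apply_notMem_range _ _ hc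
    · rw [extOp_of_not, smul_zero]
      intro h'
      exact hfix fun c hc => hp ((h' c hc).trans (h c hc).symm)
  · intro τ _
    have hn : ∀ c ∉ Set.range f, τ.viaFintypeEmbedding ⟨f, hf⟩ c = c := fun c hc =>
      Perm.viaFintypeEmbedding_apply_notMem_range _ _ hc
    rw [Perm.viaFintypeEmbedding_sign, extOp_of]
    · congr 2
      funext a
      have e1 := τ.viaFintypeEmbedding_apply_image ⟨f, hf⟩ a
      simp only [Function.Embedding.coeFn_mk] at e1
      simp [e1]
    · intro c hc
      rw [Function.comp_apply, hn c hc, h c hc]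

theorem altOp_mul_extOp_apply_eq_zero {f : ι → ι'} (Z : SiteMatrix ι J W)
    {p q : ι' → J} {c : ι'} (hc : c ∉ Set.range f) (h : q c ∉ Set.range p) :
    (altOp ι' J W * extOp f Z) p q = 0 := by
  rw [altOp_mul_apply]
  refine sum_eq_zero fun σ _ => ?_
  rw [extOp_of_not, smul_zero]
  exact fun h' => h ⟨σ c, h' c hc⟩

theorem altOp_mul_apply_equiv (e : ι ≃ ι') (Y : SiteMatrix ι' J W) (p q : ι' → J) :
    (altOp ι' J W * Y) p q =
      (altOp ι J W * Y.submatrix (· ∘ e.symm) (· ∘ e.symm)) (p ∘ e) (q ∘ e) := by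
  rw [altOp_mul_apply, altOp_mul_apply]
  refine Fintype.sum_equiv e.symm.permCongr _ _ fun σ => ?_
  rw [Perm.sign_permCongr]
  congr 2
  · funext c
    simp
  · funext c
    simp

variable [InvolutiveNeg J] {θ : J → J → ℤ}

/-- The entries of the anti-symmetrized product `⟨S_1, …, S_k⟩`. -/
def qminor (θ : J → J → ℤ) (S : ι → Matrix J J W) (β : ι → ι → K) (l : List ι) (p q : ι → J) : W :=
  (altOp ι J W * bracket θ S β l) p q

theorem qminor_comp_left (S : ι → Matrix J J W) (β : ι → ι → K) (l : List ι) (p q : ι → J)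
    (σ : Perm ι) : qminor θ S β l (p ∘ σ) q = (Perm.sign σ : ℤ) • qminor θ S β l p q :=
  altOp_mul_apply_comp _ _ _ _

theorem qminor_map_equiv (e : ι ≃ ι') (S : ι' → Matrix J J W) (β : ι' → ι' → K) (l : List ι)
    (p q : ι' → J) : qminor θ S β (l.map e) p q =
      qminor θ (S ∘ e) (fun a b => β (e a) (e b)) l (p ∘ e) (q ∘ e) := by
  rw [qminor, qminor, altOp_mul_apply_equiv e]
  have : (bracket θ S β (l.map e)).submatrix (· ∘ e.symm) (· ∘ e.symm) =
      bracket θ (S ∘ e) (fun a b => β (e a) (e b)) l := by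
    ext p q
    rw [Matrix.submatrix_apply, bracket_map_equiv_apply]
    congr 1 <;> (funext c; simp)
  rw [this]

/-- A family of matrices, numbered by sites, satisfying the pairwise twisted relations with
parameters for which the Yang--Baxter equation holds. -/
structure IsQuatFamily (θ : J → J → ℤ) (S : ι → Matrix J J W) (α β : ι → ι → K) : Prop where
  symm : ∀ a b, β a b = β b a
  quat : ∀ a b, a ≠ b → Quat θ (S a) (S b) (α a b) (β a b)
  yangBaxter : ∀ a b j, a ≠ b → j ≠ a → j ≠ b → β j a * β j b = α a b * (β j b - β j a)

theorem finRange_eq_append (n : ℕ) (i : Fin n) : ∃ l₁ l₂ : List (Fin (n + 1)),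
    List.finRange (n + 1) = l₁ ++ i.castSucc :: i.succ :: l₂ := by
  refine ⟨(List.finRange (n + 1)).take i, (List.finRange (n + 1)).drop (i + 2), ?_⟩
  have h1 : (i : ℕ) < (List.finRange (n + 1)).length := by
    rw [List.length_finRange]; omega
  have h2 : (i : ℕ) + 1 < (List.finRange (n + 1)).length := by
    rw [List.length_finRange]; omega
  conv_lhs => rw [← List.take_append_drop i (List.finRange (n + 1)), List.drop_eq_getElem_cons h1,
    List.drop_eq_getElem_cons h2]
  simp [List.getElem_finRange, Fin.ext_iff]

/-- At adjacent sites `α = 1`, so the exchange operator is `1 - P`. As `A(1 - P) = 2A`, twice the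
antisymmetrized product has the right factor `1 - P`, and `(1 - P)P = -(1 - P)` gives skew symmetry
in the columns. -/
theorem qminor_comp_right [Invertible (2 : K)] (hθ : IsSignForm θ) {k : ℕ}
    {S : Fin k → Matrix J J W} {α β : Fin k → Fin k → K} (h : IsQuatFamily θ S α β)
    (hα : ∀ i j : Fin k, (j : ℕ) = i + 1 → α i j = 1) (p q : Fin k → J) (σ : Perm (Fin k)) :
    qminor θ S β (List.finRange k) p (q ∘ σ) =
      (Perm.sign σ : ℤ) • qminor θ S β (List.finRange k) p q := by
  obtain - | n := k
  · rw [Subsingleton.elim σ 1]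
    simp
  have key : ∀ σ : Perm (Fin (n + 1)), altOp (Fin (n + 1)) J W *
      bracket θ S β (List.finRange (n + 1)) * permOp J W σ =
      (Perm.sign σ : ℤ) • (altOp (Fin (n + 1)) J W * bracket θ S β (List.finRange (n + 1))) := by
    intro σ
    -- Adjacent transpositions generate, and only for them is the parameter `α` equal to `1`.
    have hσ : σ ∈ Submonoid.closure (Set.range fun i : Fin n ↦ swap i.castSucc i.succ) := by
      rw [Perm.mclosure_swap_castSucc_succ]
      trivial
    induction hσ using Submonoid.closure_induction with
    | mem σ hσ =>
      obtain ⟨i, rfl⟩ := hσ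
      obtain ⟨l₁, l₂, hl⟩ := finRange_eq_append n i
      have hne : i.castSucc ≠ i.succ := by simp [Fin.ext_iff]
      have hswap := rOp_mul_bracket hθ h.symm (h.quat i.castSucc i.succ hne)
        (fun j h1 h2 => h.yangBaxter _ _ j hne h1 h2) l₁ (l₂ := l₂)
        (hl ▸ List.nodup_finRange _)
      rw [← hl, hα _ _ (by simp)] at hswap
      generalize bracket θ S β (l₁ ++ i.succ :: i.castSucc :: l₂) = Z at hswap
      generalize bracket θ S β (List.finRange (n + 1)) = Y at hswap ⊢
      have hA : altOp (Fin (n + 1)) J W * rOp J W (1 : K) i.castSucc i.succ =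
          (2 : K) • altOp (Fin (n + 1)) J W := by
        rw [rOp, mul_sub, mul_one, one_smul, altOp_mul_permOp, Perm.sign_swap hne]
        simp only [Units.val_neg, Units.val_one, neg_smul, one_smul, two_smul, sub_neg_eq_add]
      have hR : rOp J W (1 : K) i.castSucc i.succ * permOp J W (swap i.castSucc i.succ) =
          -rOp J W (1 : K) i.castSucc i.succ := by
        rw [rOp, sub_mul, one_mul, one_smul, permOp_mul_permOp, swap_mul_self, permOp_one, neg_sub]
      have h2 : (2 : K) • (altOp (Fin (n + 1)) J W * Y) =
          altOp (Fin (n + 1)) J W * Z * rOp J W (1 : K) i.castSucc i.succ := by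
        rw [← smul_mul_assoc, ← hA, mul_assoc, hswap, mul_assoc]
      have h3 : (2 : K) • (altOp (Fin (n + 1)) J W * Y * permOp J W (swap i.castSucc i.succ)) =
          (2 : K) • -(altOp (Fin (n + 1)) J W * Y) := by
        rw [← smul_mul_assoc, h2, mul_assoc, hR, smul_neg, h2, mul_neg]
      have h4 := congrArg ((⅟2 : K) • ·) h3
      simp only [smul_smul, invOf_mul_self, one_smul] at h4
      rw [h4, Perm.sign_swap hne]
      simp
    | one => simp [permOp_one]
    | mul x y _ _ hx hy =>
      rw [← permOp_mul_permOp, ← mul_assoc, hx, smul_mul_assoc, hy, smul_smul, Perm.sign_mul,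
        Units.val_mul]
  have := congrFun (congrFun (key σ⁻¹) p) q
  rw [mul_permOp_apply, inv_inv, Perm.sign_inv] at this
  exact this

theorem qminor_eq_zero [Invertible (2 : K)] (hθ : IsSignForm θ) {k : ℕ}
    {S : Fin k → Matrix J J W} {α β : Fin k → Fin k → K} (h : IsQuatFamily θ S α β)
    (hα : ∀ i j : Fin k, (j : ℕ) = i + 1 → α i j = 1) (p : Fin k → J) {q : Fin k → J}
    (hq : ¬ q.Injective) : qminor θ S β (List.finRange k) p q = 0 := by
  simp only [Function.Injective, not_forall] at hq
  obtain ⟨i, j, hij, hne⟩ := hq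
  have e : q ∘ swap i j = q := by
    funext c
    simp only [Function.comp_apply]
    by_cases h1 : c = i
    · rw [h1, swap_apply_left, hij]
    · by_cases h2 : c = j
      · rw [h2, swap_apply_right, hij]
      · rw [swap_apply_of_ne_of_ne h1 h2]
  have h1 := qminor_comp_right hθ h hα p q (swap i j)
  rw [e, Perm.sign_swap hne] at h1
  have h2 : (2 : K) • qminor θ S β (List.finRange k) p q = 0 := by
    rw [two_smul]
    nth_rewrite 2 [h1]
    simp
  have h4 := congrArg ((⅟2 : K) • ·) h2
  simpa only [smul_smul, invOf_mul_self, one_smul, smul_zero] using h4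

theorem exists_perm_of_bijective {p q : ι → J} (hp : p.Bijective) (hq : q.Bijective) :
    ∃ σ : Perm ι, q = p ∘ σ :=
  ⟨(Equiv.ofBijective q hq).trans (Equiv.ofBijective p hp).symm, funext fun c => by
    simp [Equiv.ofBijective_apply_symm_apply p hp]⟩

/-- The top exterior power is one-dimensional: `A⟨S₁, …, S_k⟩` is skew in rows and in columns, so it
is a multiple of `A`. The multiple is the Sklyanin determinant. -/
theorem qminor_eq_mul_altOp [Invertible (2 : K)] (hθ : IsSignForm θ) {k : ℕ}
    {S : Fin k → Matrix J J W} {α β : Fin k → Fin k → K} (h : IsQuatFamily θ S α β)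
    (hα : ∀ i j : Fin k, (j : ℕ) = i + 1 → α i j = 1) {p : Fin k → J} (hp : p.Bijective)
    (p' q : Fin k → J) :
    qminor θ S β (List.finRange k) p' q =
      qminor θ S β (List.finRange k) p p * altOp (Fin k) J W p' q := by
  have hcard : Fintype.card (Fin k) = Fintype.card J := Fintype.card_of_bijective hp
  have hbij : ∀ {r : Fin k → J}, r.Injective → r.Bijective := fun hr =>
    (Fintype.bijective_iff_injective_and_card _).mpr ⟨hr, hcard⟩
  by_cases hp' : p'.Injective
  · by_cases hq : q.Injective
    · obtain ⟨σ, rfl⟩ := exists_perm_of_bijective hp (hbij hp')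
      obtain ⟨τ, rfl⟩ := exists_perm_of_bijective hp (hbij hq)
      have h1 := altOp_mul_apply_comp (W := W) (1 : SiteMatrix (Fin k) J W) σ p (p ∘ τ)
      rw [mul_one] at h1
      rw [qminor_comp_left, qminor_comp_right hθ h hα, h1, altOp_apply_comp_right,
        altOp_apply_self hp.1]
      simp only [zsmul_eq_mul, mul_one]
      rw [← mul_assoc, ← Int.cast_mul, (Int.cast_commute _ _).eq]
    · rw [qminor_eq_zero hθ h hα _ hq, altOp_apply, sum_eq_zero, mul_zero]
      intro σ _
      rw [if_neg, smul_zero]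
      exact fun h1 => hq (h1 ▸ hp'.comp σ.injective)
  · have h1 := altOp_apply_of_not_injective hp' q (1 : SiteMatrix (Fin k) J W)
    rw [mul_one] at h1
    rw [qminor, altOp_apply_of_not_injective hp', h1, mul_zero]

end Alternating

/-! ### Complementary minors and the inverse matrix -/

section Complement

variable {ι ι' J K W : Type*} [Fintype ι] [DecidableEq ι] [Fintype ι'] [DecidableEq ι']
  [Fintype J] [DecidableEq J] [CommRing K] [Ring W] [Algebra K W] [InvolutiveNeg J]
  {θ : J → J → ℤ}

theorem IsQuatFamily.comp {S : ι → Matrix J J W} {α β : ι → ι → K} (h : IsQuatFamily θ S α β)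
    {f : ι' → ι} (hf : f.Injective) :
    IsQuatFamily θ (S ∘ f) (fun a b => α (f a) (f b)) fun a b => β (f a) (f b) where
  symm _ _ := h.symm _ _
  quat _ _ hab := h.quat _ _ (hf.ne hab)
  yangBaxter _ _ _ h1 h2 h3 := h.yangBaxter _ _ _ (hf.ne h1) (hf.ne h2) (hf.ne h3)

/-- An entry of `Q_{ab}` needs opposite column indices at `a` and `b`; at columns without such a
pair every factor `1 + βQ` acts as the identity. -/
theorem mul_rtProd_apply (Y : SiteMatrix ι J W) (β : ι → ι → K) {a : ι} {l : List ι}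
    {q : ι → J} (h : ∀ b ∈ l, q a ≠ -q b) (p : ι → J) : (Y * rtProd W θ β a l) p q = Y p q := by
  induction l generalizing Y with
  | nil => simp [rtProd]
  | cons b l ih =>
    have hz : (Y * pairOp W θ a b) p q = 0 := by
      rw [Matrix.mul_apply]
      refine sum_eq_zero fun r _ => ?_
      by_contra h0
      exact h b (by simp) (of_pairOp_ne_zero (right_ne_zero_of_mul h0)).2.1
    rw [rtProd_cons, ← mul_assoc, ih _ fun c hc => h c (by simp [hc]), rtOp, mul_add, mul_one,
      mul_smul_comm, Matrix.add_apply, Matrix.smul_apply, hz, smul_zero, add_zero]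

theorem rtProd_mul_apply (Y : SiteMatrix ι J W) (β : ι → ι → K) {a : ι} {l : List ι}
    {p : ι → J} (h : ∀ b ∈ l, p a ≠ -p b) (q : ι → J) : (rtProd W θ β a l * Y) p q = Y p q := by
  induction l with
  | nil => simp [rtProd]
  | cons b l ih =>
    have hz : (pairOp W θ a b * (rtProd W θ β a l * Y)) p q = 0 := by
      rw [Matrix.mul_apply]
      refine sum_eq_zero fun r _ => ?_
      by_contra h0
      exact h b (by simp) (of_pairOp_ne_zero (left_ne_zero_of_mul h0)).1
    rw [rtProd_cons, mul_assoc, rtOp, add_mul, one_mul, smul_mul_assoc, Matrix.add_apply,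
      Matrix.smul_apply, hz, smul_zero, add_zero, ih fun c hc => h c (by simp [hc])]

theorem mul_crossProd_apply (Y : SiteMatrix ι J W) (β : ι → ι → K) {l l' : List ι}
    {q : ι → J} (h : ∀ a ∈ l, ∀ b ∈ l', q a ≠ -q b) (p : ι → J) :
    (Y * crossProd W θ β l l') p q = Y p q := by
  induction l generalizing Y with
  | nil => simp [crossProd]
  | cons a l ih =>
    have h1 := ih (Y * rtProd W θ β a l') fun c hc => h c (by simp [hc])
    rw [crossProd] at h1
    rw [crossProd, List.map_cons, List.prod_cons, ← mul_assoc, h1,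
      mul_rtProd_apply _ _ (h a (by simp))]

theorem finRange_add_eq_append (m r : ℕ) : List.finRange (m + r) =
    (List.finRange m).map (Fin.castAdd r) ++ (List.finRange r).map (Fin.natAdd m) := by
  refine List.ext_getElem (by simp) fun i h1 h2 => ?_
  rw [List.getElem_append]
  split_ifs with h
  · simp [Fin.ext_iff]
  · simp only [List.length_map, List.length_finRange] at h
    simp [Fin.ext_iff]
    omega

/-- The Sklyanin determinant, divided by a complementary minor of the inverse matrix. -/
theorem qminor_complement [Invertible (2 : K)] (hθ : IsSignForm θ) {m r : ℕ}
    {S : Fin (m + r) → Matrix J J W} {α β : Fin (m + r) → Fin (m + r) → K}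
    (h : IsQuatFamily θ S α β) (hα : ∀ i j : Fin (m + r), (j : ℕ) = i + 1 → α i j = 1)
    {p : Fin (m + r) → J} (hp : p.Bijective)
    (hneg : ∀ i j, p (Fin.castAdd r i) ≠ -p (Fin.natAdd m j))
    {S' : Fin r → Matrix J J W} {β' : Fin r → Fin r → K} (hS : ∀ j, S (Fin.natAdd m j) * S' j = 1)
    (hs : ∀ a b, β' a b = β' b a)
    (hβ : ∀ i j, i ≠ j → β (Fin.natAdd m i) (Fin.natAdd m j) + β' i j +
      Fintype.card J * (β (Fin.natAdd m i) (Fin.natAdd m j) * β' i j) = 0) :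
    qminor θ (S ∘ Fin.castAdd r) (fun a b => β (Fin.castAdd r a) (Fin.castAdd r b))
        (List.finRange m) (p ∘ Fin.castAdd r) (p ∘ Fin.castAdd r) =
      qminor θ S β (List.finRange (m + r)) p p *
        qminor θ S' β' (List.finRange r).reverse (p ∘ Fin.natAdd m) (p ∘ Fin.natAdd m) := by
  have hc : (Fin.castAdd r : Fin m → Fin (m + r)).Injective := Fin.castAdd_injective m r
  have hn : (Fin.natAdd m : Fin r → Fin (m + r)).Injective := Fin.natAdd_injective r m
  have hsplit := bracket_append (θ := θ) S β (l := (List.finRange m).map (Fin.castAdd r))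
    (l' := (List.finRange r).map (Fin.natAdd m))
    (finRange_add_eq_append m r ▸ List.nodup_finRange _)
  rw [← finRange_add_eq_append, ← extOp_bracket θ hc, ← extOp_bracket θ hn] at hsplit
  have hinv := bracket_mul_bracket_reverse hθ (S := S ∘ Fin.natAdd m)
    (β := fun a b => β (Fin.natAdd m a) (Fin.natAdd m b)) (List.nodup_finRange r)
    (fun a _ => hS a) hs hβ
  -- Multiplying by the inverse of the product over the last `r` sites leaves the product over the
  -- first `m` sites and the cross factors.
  have h1 : altOp (Fin (m + r)) J W * bracket θ S β (List.finRange (m + r)) *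
      extOp (Fin.natAdd m) (bracket θ S' β' (List.finRange r).reverse) =
      altOp (Fin (m + r)) J W * extOp (Fin.castAdd r) (bracket θ (S ∘ Fin.castAdd r)
        (fun a b => β (Fin.castAdd r a) (Fin.castAdd r b)) (List.finRange m)) *
      crossProd W θ β ((List.finRange m).map (Fin.castAdd r))
        ((List.finRange r).map (Fin.natAdd m)) := by
    rw [hsplit, mul_assoc, mul_assoc _ (extOp (Fin.natAdd m) _), ← extOp_mul hn, hinv,
      extOp_one hn, mul_one, mul_assoc]
  have h2 := congrFun (congrFun h1 p) p
  -- The column `p` has no opposite indices across the two groups of sites, so the cross factors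
  -- disappear.
  rw [mul_crossProd_apply _ _ (by simpa using hneg),
    altOp_mul_extOp_apply hc _ hp.1 fun _ _ => rfl, Matrix.mul_apply] at h2
  have h3 : qminor θ S' β' (List.finRange r).reverse (p ∘ Fin.natAdd m) (p ∘ Fin.natAdd m) =
      (altOp (Fin (m + r)) J W *
        extOp (Fin.natAdd m) (bracket θ S' β' (List.finRange r).reverse)) p p :=
    (altOp_mul_extOp_apply hn _ hp.1 fun _ _ => rfl).symm
  rw [h3, qminor, ← h2, Matrix.mul_apply, mul_sum]
  refine sum_congr rfl fun q _ => ?_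
  rw [← mul_assoc]
  congr 1
  exact qminor_eq_mul_altOp hθ h hα hp p q

theorem snoc_injective {m : ℕ} {B : Fin m → J} (hB : B.Injective) {a : J}
    (ha : a ∉ Set.range B) : (Fin.snoc (α := fun _ => J) B a : Fin (m + 1) → J).Injective :=
  Fin.snoc_injective_iff.mpr ⟨hB, ha⟩

/-- The minors with one varying row and column, multiplied by the inverse matrix. -/
theorem sum_qminor_snoc_mul {m : ℕ} {S : Fin (m + 1) → Matrix J J W}
    (β : Fin (m + 1) → Fin (m + 1) → K) {S' : Matrix J J W} (hS : S (Fin.last m) * S' = 1)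
    {B : Fin m → J} (hB : B.Injective) {a b : J} (ha : a ∉ Set.range B) (hb : b ∉ Set.range B)
    (hneg : ∀ i, B i ≠ -b) :
    ∑ j, qminor θ S β (List.finRange (m + 1)) (Fin.snoc (α := fun _ => J) B a)
        (Fin.snoc (α := fun _ => J) B j) * S' j b =
      if a = b then qminor θ (S ∘ Fin.castSucc) (fun a b => β a.castSucc b.castSucc)
        (List.finRange m) B B else 0 := by
  have hc : (Fin.castSucc : Fin m → Fin (m + 1)).Injective := Fin.castSucc_injective m
  have hsplit := bracket_append (θ := θ) S β (l := (List.finRange m).map Fin.castSucc)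
    (l' := [Fin.last m]) (List.finRange_succ_last ▸ List.nodup_finRange _)
  rw [← List.finRange_succ_last, ← extOp_bracket θ hc] at hsplit
  -- `S'` cancels the matrix at the last site. The cross factors that remain are invisible in the
  -- column `(B, b)`, because no `B i` is opposite to `b`.
  have h1 : altOp (Fin (m + 1)) J W * bracket θ S β (List.finRange (m + 1)) *
      siteOp S' (Fin.last m) =
      altOp (Fin (m + 1)) J W * extOp Fin.castSucc (bracket θ (S ∘ Fin.castSucc)
        (fun a b => β a.castSucc b.castSucc) (List.finRange m)) *
      crossProd W θ β ((List.finRange m).map Fin.castSucc) [Fin.last m] := by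
    rw [hsplit]
    simp only [bracket, rtProd, List.map_nil, List.prod_nil, mul_one]
    rw [mul_assoc, mul_assoc _ (siteOp _ _), siteOp_mul_siteOp, hS, siteOp_one, mul_one, mul_assoc]
  have h2 := congrFun (congrFun h1 (Fin.snoc (α := fun _ => J) B a))
    (Fin.snoc (α := fun _ => J) B b)
  rw [mul_crossProd_apply _ _ (by simpa using hneg), mul_siteOp_apply] at h2
  have hlast : ∀ c : Fin (m + 1), c ∉ Set.range (Fin.castSucc : Fin m → _) → c = Fin.last m := by
    intro c
    refine Fin.lastCases (fun _ => rfl) (fun i hi => absurd ⟨i, rfl⟩ hi) c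
  simp only [Fin.snoc_last, Fin.update_snoc_last] at h2
  rw [show (∑ j, qminor θ S β (List.finRange (m + 1)) (Fin.snoc (α := fun _ => J) B a)
        (Fin.snoc (α := fun _ => J) B j) * S' j b) = _ from h2]
  split_ifs with hab
  · subst hab
    rw [altOp_mul_extOp_apply hc _ (snoc_injective hB ha) fun _ _ => rfl]
    simp [qminor, Function.comp_def]
  · refine altOp_mul_extOp_apply_eq_zero _ (c := Fin.last m) ?_ ?_
    · rintro ⟨i, hi⟩
      exact (Fin.castSucc_lt_last i).ne hi
    · rintro ⟨c, hc⟩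
      rw [Fin.snoc_last] at hc
      revert hc
      refine Fin.lastCases (fun hc => ?_) (fun i hi => ?_) c
      · rw [Fin.snoc_last] at hc
        exact hab hc
      · rw [Fin.snoc_castSucc] at hi
        exact hb ⟨i, hi⟩

end Complement

/-! ### Moving one site through a whole product -/

section Chain

variable {ι J K W : Type*} [Fintype ι] [DecidableEq ι]
  [Fintype J] [DecidableEq J] [CommRing K] [Ring W] [Algebra K W] [InvolutiveNeg J]
  {θ : J → J → ℤ}

/-- The product of the operators `1 - γ P` acting on `o` and the elements of a list. -/
def rChain (J W : Type*) [Fintype J] [DecidableEq J] [Ring W] [Algebra K W] (γ : ι → K) (o : ι)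
    (l : List ι) : SiteMatrix ι J W :=
  (l.map fun b => rOp J W (γ b) o b).prod

theorem rChain_append (γ : ι → K) (o : ι) (l l' : List ι) :
    rChain J W γ o (l ++ l') = rChain J W γ o l * rChain J W γ o l' := by
  simp [rChain]

theorem rChain_cons (γ : ι → K) (o b : ι) (l : List ι) :
    rChain J W γ o (b :: l) = rOp J W (γ b) o b * rChain J W γ o l := by
  simp [rChain]

theorem rChain_singleton (γ : ι → K) (o b : ι) :
    rChain J W γ o [b] = rOp J W (γ b) o b := by
  simp [rChain]

theorem rChain_reverse_mul (γ : ι → K) (o : ι) (l : List ι) :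
    rChain J W γ o l.reverse * rChain J W (-γ) o l =
      (l.map fun b => 1 - γ b ^ 2).prod • (1 : SiteMatrix ι J W) := by
  induction l with
  | nil => simp [rChain]
  | cons b l ih =>
    rw [List.reverse_cons, rChain_append, rChain_singleton, rChain_cons, mul_assoc,
      ← mul_assoc (rOp J W (γ b) o b), Pi.neg_apply, rOp_mul_rOp_neg, smul_mul_assoc, one_mul,
      mul_smul_comm, ih, smul_smul, List.map_cons, List.prod_cons]

theorem rChain_mul_reverse (γ : ι → K) (o : ι) (l : List ι) :
    rChain J W (-γ) o l * rChain J W γ o l.reverse =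
      (l.map fun b => 1 - γ b ^ 2).prod • (1 : SiteMatrix ι J W) := by
  have := rChain_reverse_mul (J := J) (W := W) (-γ) o l.reverse
  rw [List.reverse_reverse, neg_neg, List.map_reverse, List.prod_reverse] at this
  simpa using this

theorem mul_rOp_apply (Y : SiteMatrix ι J W) (c : K) (a b : ι) (p q : ι → J) :
    (Y * rOp J W c a b) p q = Y p q - c • Y p (q ∘ swap a b) := by
  rw [rOp, mul_sub, mul_one, mul_smul_comm, Matrix.sub_apply, Matrix.smul_apply, mul_permOp_apply,
    swap_inv]

theorem rOp_mul_apply (Y : SiteMatrix ι J W) (c : K) (a b : ι) (p q : ι → J) :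
    (rOp J W c a b * Y) p q = Y p q - c • Y (p ∘ swap a b) q := by
  rw [rOp, sub_mul, one_mul, smul_mul_assoc, Matrix.sub_apply, Matrix.smul_apply, permOp_mul_apply]

/-- A swap with a site of `l` puts a value from `s` at `o`, and later swaps can only replace it by
another value from `s`. A column with a value outside `s` at `o` therefore sees only the identity
term. -/
theorem rChain_apply_of_left (γ : ι → K) {o : ι} {l : List ι} (hl : l.Nodup) (ho : o ∉ l)
    {s : Set J} {p r : ι → J} (hp : ∀ c ∈ l, p c ∈ s) (hr : r o ∉ s) :
    rChain J W γ o l p r = (1 : SiteMatrix ι J W) p r := by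
  induction l generalizing p with
  | nil => simp [rChain]
  | cons b l ih =>
    simp only [List.nodup_cons, List.mem_cons, not_or] at hl ho
    have hb : p b ∈ s := hp b (by simp)
    rw [rChain_cons, rOp_mul_apply, ih hl.2 ho.2 fun c hc => hp c (by simp [hc]),
      ih hl.2 ho.2, Matrix.one_apply_ne (i := p ∘ swap o b), smul_zero, sub_zero]
    · intro e
      refine hr (e ▸ ?_)
      simpa using hb
    · intro c hc
      have hco : c ≠ o := fun e => ho.2 (e ▸ hc)
      have hcb : c ≠ b := fun e => hl.1 (e ▸ hc)
      rw [Function.comp_apply, swap_apply_of_ne_of_ne hco hcb]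
      exact hp c (by simp [hc])

theorem rChain_apply_of_right (γ : ι → K) {o : ι} {l : List ι} (hl : l.Nodup) (ho : o ∉ l)
    {s : Set J} {r q : ι → J} (hq : ∀ c ∈ l, q c ∈ s) (hr : r o ∉ s) :
    rChain J W γ o l r q = (1 : SiteMatrix ι J W) r q := by
  induction l using List.reverseRecOn generalizing q with
  | nil => simp [rChain]
  | append_singleton l b ih =>
    have hl' := List.nodup_append.mp hl
    have hbl : b ∉ l := fun h => hl'.2.2 b h b (by simp) rfl
    simp only [List.mem_append, List.mem_singleton, not_or] at ho
    have hb : q b ∈ s := hq b (by simp)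
    rw [rChain_append, rChain_singleton, mul_rOp_apply,
      ih hl'.1 ho.1 fun c hc => hq c (by simp [hc]),
      ih hl'.1 ho.1, Matrix.one_apply_ne (j := q ∘ swap o b), smul_zero, sub_zero]
    · intro e
      refine hr (e ▸ ?_)
      simpa using hb
    · intro c hc
      have hco : c ≠ o := fun e => ho.1 (e ▸ hc)
      have hcb : c ≠ b := fun e => hbl (e ▸ hc)
      rw [Function.comp_apply, swap_apply_of_ne_of_ne hco hcb]
      exact hq c (by simp [hc])

/-- The two-site exchange is iterated: `o` passes the elements of `l` one at a time, and the
operators accumulate in reverse order. -/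
theorem rChain_mul_bracket (hθ : IsSignForm θ) {S : ι → Matrix J J W} {α β : ι → ι → K}
    (h : IsQuatFamily θ S α β) {o : ι} (l₁ l : List ι) (hl : (l₁ ++ o :: l).Nodup) :
    rChain J W (α o) o l.reverse * bracket θ S β (l₁ ++ o :: l) =
      bracket θ S β (l₁ ++ l ++ [o]) * rChain J W (α o) o l.reverse := by
  induction l generalizing l₁ with
  | nil => simp [rChain]
  | cons b l ih =>
    have hob : o ≠ b := by
      intro e
      subst e
      exact absurd (List.nodup_append.mp hl).2.1 (by simp)
    have h1 := rOp_mul_bracket hθ h.symm (h.quat o b hob)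
      (fun j h1 h2 => h.yangBaxter _ _ j hob h1 h2) l₁ hl
    have hl2 : (l₁ ++ [b] ++ o :: l).Nodup := by
      refine (List.Perm.nodup_iff ?_).mp hl
      rw [List.append_assoc]
      exact List.Perm.append_left _ (List.Perm.swap _ _ _)
    have h2 := ih (l₁ ++ [b]) hl2
    rw [List.append_assoc, List.singleton_append] at h2
    rw [List.reverse_cons, rChain_append, rChain_singleton, mul_assoc, h1, ← mul_assoc, h2,
      mul_assoc]
    simp

theorem crossProd_singleton (hθ : IsSignForm θ) {β : ι → ι → K} (hs : ∀ a b, β a b = β b a)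
    (l : List ι) (o : ι) : crossProd W θ β l [o] = rtProd W θ β o l := by
  simp only [crossProd, rtProd, List.map_cons, List.map_nil, List.prod_cons, List.prod_nil, mul_one]
  congr 1
  exact List.map_congr_left fun a _ => rtOp_comm hθ hs a o

/-- Moving the operator with site `o` through the product `⟨S_1, …, S_k⟩`. -/
theorem rChain_mul_siteOp_mul (hθ : IsSignForm θ) {S : ι → Matrix J J W} {α β : ι → ι → K}
    (h : IsQuatFamily θ S α β) {o : ι} {l : List ι} (hl : (o :: l).Nodup) :
    rChain J W (α o) o l.reverse * (siteOp (S o) o * rtProd W θ β o l * bracket θ S β l) =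
      bracket θ S β l * rtProd W θ β o l * siteOp (S o) o * rChain J W (α o) o l.reverse := by
  have h1 := rChain_mul_bracket hθ h [] l hl
  have hl2 : (l ++ [o]).Nodup := (List.perm_append_singleton o l).nodup_iff.mpr hl
  rw [List.nil_append, List.nil_append, bracket_append _ _ hl2, crossProd_singleton hθ h.symm] at h1
  simpa [bracket, rtProd] using h1

end Chain

/-! ### Entries of the inverse commute with complementary minors -/

section Commutation

variable {J K W : Type*}
  [Fintype J] [DecidableEq J] [CommRing K] [Ring W] [Algebra K W]

theorem extOp_succ_mul_apply {m : ℕ} (Y : SiteMatrix (Fin m) J W)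
    (Z : SiteMatrix (Fin (m + 1)) J W) (p q : Fin (m + 1) → J) :
    (extOp Fin.succ Y * Z) p q =
      ∑ r, Y (Fin.tail p) r * Z (Fin.cons (α := fun _ => J) (p 0) r) q := by
  rw [Matrix.mul_apply, eq_comm]
  have hs : ∀ c : Fin (m + 1), c ∉ Set.range (Fin.succ : Fin m → _) ↔ c = 0 := by
    intro c
    refine Fin.cases (by simp) (fun i => by simp) c
  refine sum_of_injOn (fun r => Fin.cons (α := fun _ => J) (p 0) r) ?_ (by simp) ?_ ?_
  · intro x _ y _ hxy
    exact (Fin.cons_right_injective (α := fun _ => J) (p 0)) hxy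
  · intro r _ hr
    rw [extOp_of_not, zero_mul]
    intro h
    refine hr ⟨Fin.tail r, by simp, ?_⟩
    rw [h 0 (by simp)]
    exact Fin.cons_self_tail r
  · intro r _
    rw [extOp_of (by simp [hs])]
    congr 1

variable [InvolutiveNeg J] {θ : J → J → ℤ}

theorem cons_mem_of_mem_map_succ {m : ℕ} (x : J) (r : Fin m → J) {s : Set J} (hr : ∀ i, r i ∈ s)
    (c : Fin (m + 1)) (hc : c ∈ (List.finRange m).map Fin.succ) :
    (Fin.cons (α := fun _ => J) x r : Fin (m + 1) → J) c ∈ s := by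
  obtain ⟨i, -, rfl⟩ := List.mem_map.mp hc
  simpa using hr i

/-- Minors with indices in `B` commute with the entries of the inverse matrix with indices outside
of `B`. -/
theorem commute_inverse_qminor (hθ : IsSignForm θ) {m : ℕ} {S : Fin (m + 1) → Matrix J J W}
    {α β : Fin (m + 1) → Fin (m + 1) → K} (h : IsQuatFamily θ S α β)
    (hα : ∀ i : Fin m, IsUnit (1 - α 0 i.succ ^ 2)) {S' : Matrix J J W} (h1 : S 0 * S' = 1)
    (h2 : S' * S 0 = 1) {B : Fin m → J} {a b : J} (ha : a ∉ Set.range B) (hb : b ∉ Set.range B)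
    (ha' : ∀ i, a ≠ -B i) (hb' : ∀ i, b ≠ -B i) :
    Commute (S' a b) (qminor θ (S ∘ Fin.succ) (fun a b => β a.succ b.succ)
      (List.finRange m) B B) := by
  set l := (List.finRange m).map Fin.succ with hl
  have hs : (Fin.succ : Fin m → Fin (m + 1)).Injective := Fin.succ_injective m
  have hl0 : (0 : Fin (m + 1)) ∉ l := by simp [hl]
  have hnd : ((0 : Fin (m + 1)) :: l).Nodup := by
    rw [hl, ← List.finRange_succ]
    exact List.nodup_finRange _
  have hln : l.Nodup := (List.nodup_cons.mp hnd).2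
  have key := rChain_mul_siteOp_mul hθ h hnd
  set X' := bracket θ (S ∘ Fin.succ) (fun a b => β a.succ b.succ) (List.finRange m) with hX'
  have hX : bracket θ S β l = extOp Fin.succ X' := (extOp_bracket θ hs S β _).symm
  rw [hX] at key
  set X := extOp Fin.succ X' with hXd
  set T := rtProd W θ β 0 l with hT
  set R := rChain J W (α 0) 0 l.reverse with hR
  set R' := rChain J W (-α 0) 0 l with hR'
  set κ := (l.map fun b => 1 - α 0 b ^ 2).prod with hκ
  have hRR : R * R' = κ • 1 := rChain_reverse_mul _ _ _
  have hRR' : R' * R = κ • 1 := rChain_mul_reverse _ _ _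
  have hκu : IsUnit κ := by
    rw [hκ, hl, List.map_map]
    have : ∀ l' : List (Fin m), IsUnit
        (l'.map ((fun b => 1 - α 0 b ^ 2) ∘ Fin.succ)).prod := by
      intro l'
      induction l' with
      | nil => simp
      | cons c l' ih => simpa using ⟨hα c, ih⟩
    exact this _
  have s1 : siteOp (S 0) (0 : Fin (m + 1)) * siteOp S' 0 = 1 := by
    rw [siteOp_mul_siteOp, h1, siteOp_one]
  have s2 : siteOp S' (0 : Fin (m + 1)) * siteOp (S 0) 0 = 1 := by
    rw [siteOp_mul_siteOp, h2, siteOp_one]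
  set U := siteOp (S 0) (0 : Fin (m + 1))
  set V := siteOp S' (0 : Fin (m + 1)) with hV
  -- The relation for moving site `0` is conjugated by the inverse of `R`, which is `R'` up to the
  -- unit `κ`, and by the inverse `V` of `S` at site `0`. An entry of `V` is thereby compared on
  -- both sides of `X`.
  have e1 : T * X * R' * V = V * (R' * X * T) := by
    have e2 : κ • (U * T * X * R') = κ • (R' * X * T * U) := by
      calc κ • (U * T * X * R') = κ • (1 : SiteMatrix (Fin (m + 1)) J W) * (U * T * X * R') := by
            rw [smul_mul_assoc, one_mul]
        _ = R' * (R * (U * T * X)) * R' := by rw [← hRR']; simp only [mul_assoc]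
        _ = R' * X * T * U * (R * R') := by rw [key]; simp only [mul_assoc]
        _ = _ := by rw [hRR, mul_smul_comm, mul_one]
    have e3 : U * T * X * R' = R' * X * T * U := by
      obtain ⟨u, hu⟩ := hκu
      have := congrArg ((↑u⁻¹ : K) • ·) e2
      simpa only [← hu, smul_smul, Units.inv_mul, one_smul] using this
    calc T * X * R' * V = V * U * (T * X * R' * V) := by rw [s2, one_mul]
      _ = V * (U * T * X * R') * V := by simp only [mul_assoc]
      _ = V * (R' * X * T) * (U * V) := by rw [e3]; simp only [mul_assoc]
      _ = _ := by rw [s1, mul_one]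
  set A := extOp Fin.succ (altOp (Fin m) J W) with hA
  have hAV : A * V = V * A := by
    refine ActsOn.commute (s := Set.range Fin.succ) (t := {0}) (by simp) (actsOn_extOp _ _)
      (actsOn_siteOp _ _) fun p q p' q' => ?_
    by_cases hc : ∀ c ∉ Set.range (Fin.succ : Fin m → _), p c = q c
    · rw [hA, extOp_of hc, altOp_apply]
      refine Commute.sum_left _ _ _ fun σ _ => Commute.smul_left ?_ _
      split_ifs
      · exact Commute.one_left _
      · exact Commute.zero_left _
    · rw [hA, extOp_of_not hc]
      exact Commute.zero_left _
  have hAX : A * X = extOp Fin.succ (altOp (Fin m) J W * X') := (extOp_mul hs _ _).symm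
  have hAapp : ∀ (x : J) (Y : SiteMatrix (Fin (m + 1)) J W) (q : Fin (m + 1) → J),
      (A * Y) (Fin.cons (α := fun _ => J) x B) q =
        ∑ σ : Perm (Fin m), (Perm.sign σ : ℤ) • Y (Fin.cons (α := fun _ => J) x (B ∘ σ)) q := by
    intro x Y q
    rw [extOp_succ_mul_apply]
    simp only [Fin.tail_cons, Fin.cons_zero, altOp_apply, sum_mul]
    rw [sum_comm]
    refine sum_congr rfl fun σ _ => ?_
    rw [sum_eq_single (B ∘ σ)]
    · simp
    · intro r _ hr
      rw [if_neg (Ne.symm hr), smul_zero, zero_mul]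
    · simp
  set D := (altOp (Fin m) J W * X') B B with hD
  have hAXapp : ∀ j, (A * X) (Fin.cons (α := fun _ => J) j B) (Fin.cons (α := fun _ => J) b B) =
      if j = b then D else 0 := by
    intro j
    rw [hAX]
    split_ifs with hj
    · subst hj
      rw [extOp_of fun _ _ => rfl]
      rfl
    · exact extOp_of_not fun hc => hj (by simpa using hc 0 (by simp))
  have e4 := congrFun (congrFun (congrArg (A * ·) e1) (Fin.cons (α := fun _ => J) a B))
    (Fin.cons (α := fun _ => J) b B)
  -- Here `T` acts trivially since `a` is opposite to no element of `B`, and `R'` acts trivially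
  -- since `a` is not in `B`; only the minor followed by the entry of the inverse survives.
  have left : (A * (T * X * R' * V)) (Fin.cons (α := fun _ => J) a B)
      (Fin.cons (α := fun _ => J) b B) = D * S' a b := by
    have f1 : (A * (T * X * R' * V)) (Fin.cons (α := fun _ => J) a B)
        (Fin.cons (α := fun _ => J) b B) = (A * X * R' * V) (Fin.cons (α := fun _ => J) a B)
        (Fin.cons (α := fun _ => J) b B) := by
      rw [mul_assoc A X R', mul_assoc A _ V, hAapp, hAapp]
      refine sum_congr rfl fun σ _ => ?_
      rw [mul_assoc T, mul_assoc T, hT, rtProd_mul_apply, mul_assoc]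
      intro c hc
      refine cons_mem_of_mem_map_succ (s := {x | a ≠ -x}) _ _ (fun i => ?_) c hc
      exact ha' _
    rw [f1, hV, mul_siteOp_apply, sum_eq_single a]
    · rw [Fin.update_cons_zero, hAX, extOp_succ_mul_apply, sum_eq_single B]
      · rw [Fin.tail_cons, Fin.cons_zero, hR', rChain_apply_of_right _ hln hl0 (s := Set.range B)
          (cons_mem_of_mem_map_succ _ _ fun i => ⟨i, rfl⟩) (by simpa using ha),
          Matrix.one_apply_eq, mul_one]
        rfl
      · intro r _ hr
        rw [hR', rChain_apply_of_right _ hln hl0 (s := Set.range B)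
          (cons_mem_of_mem_map_succ _ _ fun i => ⟨i, rfl⟩) (by simpa using ha),
          Matrix.one_apply_ne, mul_zero]
        exact fun e => hr (Fin.cons_right_injective (α := fun _ => J) _ e)
      · simp
    · intro j _ hj
      rw [Fin.update_cons_zero, hAX, extOp_succ_mul_apply, sum_eq_zero, zero_mul]
      intro r _
      rw [hR', rChain_apply_of_right _ hln hl0 (s := Set.range B)
        (cons_mem_of_mem_map_succ _ _ fun i => ⟨i, rfl⟩) (by simpa using ha),
        Matrix.one_apply_ne, mul_zero]
      exact fun e => hj (by simpa using (congrFun e 0).symm)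
    · simp
  -- The mirror image, with the conditions on `b`: `A` passes `V` because they act on different
  -- sites, `T` is invisible in the column, and `X` keeps the value `b` at site `0`, so that `R'` is
  -- trivial as well.
  have right : (A * (V * (R' * X * T))) (Fin.cons (α := fun _ => J) a B)
      (Fin.cons (α := fun _ => J) b B) = S' a b * D := by
    have f1 : ∀ j, (A * (R' * X * T)) (Fin.cons (α := fun _ => J) j B)
        (Fin.cons (α := fun _ => J) b B) = if j = b then D else 0 := by
      intro j
      rw [← hAXapp, hAapp, hAapp]
      refine sum_congr rfl fun σ _ => ?_
      rw [hT, mul_rtProd_apply, Matrix.mul_apply, sum_eq_single (Fin.cons (α := fun _ => J) j (B ∘ σ))]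
      · by_cases hjb : j = b
        · rw [hR', rChain_apply_of_left _ hln hl0 (s := Set.range B)
            (cons_mem_of_mem_map_succ j (B ∘ σ) fun i => ⟨σ i, rfl⟩) (r := Fin.cons (α := fun _ => J) j (B ∘ σ)) (by simpa [hjb] using hb),
            Matrix.one_apply_eq, one_mul]
        · have hz : X (Fin.cons (α := fun _ => J) j (B ∘ σ)) (Fin.cons (α := fun _ => J) b B) = 0 :=
            extOp_of_not fun hc => hjb (by simpa using hc 0 (by simp))
          rw [hz, mul_zero]
      · intro r _ hr
        by_cases hrb : r 0 = b
        · rw [hR', rChain_apply_of_left _ hln hl0 (s := Set.range B)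
            (cons_mem_of_mem_map_succ j (B ∘ σ) fun i => ⟨σ i, rfl⟩) (r := r) (by simpa [hrb] using hb),
            Matrix.one_apply_ne (Ne.symm hr), zero_mul]
        · have hz : X r (Fin.cons (α := fun _ => J) b B) = 0 :=
            extOp_of_not fun hc => hrb (by simpa using hc 0 (by simp))
          rw [hz, mul_zero]
      · simp
      · intro c hc
        refine cons_mem_of_mem_map_succ (s := {x | b ≠ -x}) _ _ (fun i => ?_) c hc
        exact hb' _
    rw [← mul_assoc, hAV, mul_assoc, hV, siteOp_mul_apply]
    simp only [Fin.update_cons_zero, f1, Fin.cons_zero]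
    simp
  exact (left.symm.trans (e4.trans right)).symm

end Commutation

/-! ### Fusion of chains behind an antisymmetrizer -/

section Fusion

variable {ι J K W : Type*} [Fintype ι] [DecidableEq ι]
  [Fintype J] [DecidableEq J] [CommRing K] [Ring W] [Algebra K W] [InvolutiveNeg J]
  {θ : J → J → ℤ}

/-- A product of operators `1 - γ P` with consecutive parameters, anti-symmetrized. -/
theorem mul_rChain_eq {A : SiteMatrix ι J W} {γ : ι → K} {o b : ι} {l : List ι}
    (hl : (l ++ [b]).Nodup) (ho : o ∉ l ++ [b])
    (hA : ∀ x ∈ l ++ [b], ∀ y ∈ l ++ [b], x ≠ y → A * permOp J W (swap x y) = -A)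
    (hγ : List.IsChain (fun x y => γ x * (1 + γ y) = γ y) (l ++ [b])) :
    A * rChain J W γ o (l ++ [b]) =
      A * (1 - γ b • ((l ++ [b]).map fun c => permOp J W (swap o c)).sum) := by
  induction l using List.reverseRecOn generalizing b with
  | nil => simp [rChain, rOp]
  | append_singleton l c ih =>
    have hl' := List.nodup_append.mp hl
    have hγ' := List.isChain_append.mp hγ
    rw [List.mem_append, not_or, List.mem_singleton] at ho
    have h1 := ih hl'.1 ho.1 (fun x hx y hy => hA x (List.mem_append_left _ hx) y (List.mem_append_left _ hy)) hγ'.1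
    have hcb : γ c * (1 + γ b) = γ b := hγ'.2.2 c (by simp) b (by simp)
    rw [rChain_append, ← mul_assoc, h1, rChain_singleton, List.map_append (l₁ := l ++ [c]),
      List.sum_append]
    -- `A P_{ox} P_{ob} = A P_{xb} P_{ox} = -A P_{ox}`, so the quadratic terms become linear and
    -- change the coefficient `γ c` to `γ c (1 + γ b) = γ b`.
    have h2 : ∀ L : List ι, (∀ x ∈ L, x ∈ l ++ [c]) →
        A * (L.map fun x => permOp J W (swap o x)).sum * permOp J W (swap o b) =
          -(A * (L.map fun x => permOp J W (swap o x)).sum) := by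
      intro L hL
      induction L with
      | nil => simp
      | cons x L ihL =>
        have hx := hL x (by simp)
        have hxb : x ≠ b := fun e => hl'.2.2 x hx b (by simp) e
        have hxo : o ≠ x := fun e => ho.1 (e ▸ hx)
        have e1 : A * permOp J W (swap o x) * permOp J W (swap o b) =
            -(A * permOp J W (swap o x)) := by
          rw [mul_assoc, permOp_mul_permOp, mul_swap_eq_swap_mul, swap_apply_left,
            swap_apply_of_ne_of_ne (Ne.symm ho.2) (Ne.symm hxb), ← permOp_mul_permOp, ← mul_assoc,
            hA x (List.mem_append_left _ hx) b (by simp) hxb, neg_mul]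
        rw [List.map_cons, List.sum_cons, mul_add, add_mul, e1,
          ihL fun y hy => hL y (by simp [hy]), neg_add]
    have h3 := h2 (l ++ [c]) fun _ => id
    generalize ((l ++ [c]).map fun x => permOp J W (swap o x)).sum = Y at h3 ⊢
    simp only [List.map_cons, List.map_nil, List.sum_cons, List.sum_nil, add_zero, rOp]
    have h4 : (γ c * (1 + γ b)) • (A * Y) = γ b • (A * Y) := by rw [hcb]
    simp only [mul_sub, sub_mul, mul_one, mul_smul_comm, smul_mul_assoc, mul_add, smul_sub,
      h3, smul_add, smul_neg]
    rw [← h4]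
    module

/-- A product of operators `1 + β Q` with consecutive parameters, anti-symmetrized. -/
theorem mul_rtProd_eq (hθ : IsSignForm θ) {A : SiteMatrix ι J W} {β : ι → ι → K} {o : ι} {β₀ : K}
    {l : List ι} (hl : l.Nodup) (ho : o ∉ l)
    (hA : ∀ x ∈ l, ∀ y ∈ l, x ≠ y → A * permOp J W (swap x y) = -A)
    (hβ : ∀ (i : ℕ) (h : i < l.length), β o l[i] * (1 - i * β₀) = β₀) :
    A * rtProd W θ β o l = A * (1 + β₀ • (l.map fun c => pairOp W θ o c).sum) := by
  induction l using List.reverseRecOn with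
  | nil => simp [rtProd]
  | append_singleton l b ih =>
    have hl' := List.nodup_append.mp hl
    rw [List.mem_append, not_or, List.mem_singleton] at ho
    have h1 := ih hl'.1 ho.1 (fun x hx y hy => hA x (List.mem_append_left _ hx) y (List.mem_append_left _ hy))
      fun i h => by
        have := hβ i (by simp; omega)
        rwa [List.getElem_append_left h] at this
    have hb : β o b * (1 - (l.length : K) * β₀) = β₀ := by
      have := hβ l.length (by simp)
      simpa using this
    rw [rtProd_append, ← mul_assoc, h1, List.map_append, List.sum_append]
    -- `A Q_{ox} Q_{ob} = A P_{xb} Q_{ob} = -A Q_{ob}`: each earlier site lowers the coefficient of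
    -- the new `Q` by the same amount, which the condition on `β` compensates.
    have h2 : ∀ L : List ι, (∀ x ∈ L, x ∈ l) →
        A * (L.map fun x => pairOp W θ o x).sum * pairOp W θ o b =
          -((L.length : K) • (A * pairOp W θ o b)) := by
      intro L hL
      induction L with
      | nil => simp
      | cons x L ihL =>
        have hx := hL x (by simp)
        have hxb : x ≠ b := fun e => hl'.2.2 x hx b (by simp) e
        have hxo : o ≠ x := fun e => ho.1 (e ▸ hx)
        have e1 : A * pairOp W θ o x * pairOp W θ o b = -(A * pairOp W θ o b) := by
          rw [mul_assoc, pairOp_mul_pairOp hθ hxo ho.2 hxb, ← mul_assoc,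
            hA x (List.mem_append_left _ hx) b (by simp) hxb, neg_mul]
        rw [List.map_cons, List.sum_cons, mul_add, add_mul, e1,
          ihL fun y hy => hL y (by simp [hy]), List.length_cons]
        push_cast
        module
    have h3 := h2 l fun _ => id
    generalize (l.map fun x => pairOp W θ o x).sum = Y at h3 ⊢
    simp only [List.map_cons, List.map_nil, List.sum_cons, List.sum_nil, add_zero, rtProd, rtOp,
      List.prod_cons, List.prod_nil, mul_one]
    have h4 : (β o b * (1 - (l.length : K) * β₀)) • (A * pairOp W θ o b) =
        β₀ • (A * pairOp W θ o b) := by rw [hb]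
    simp only [mul_one, mul_smul_comm, smul_mul_assoc, mul_add, add_mul, h3, smul_add, smul_neg]
    rw [← h4]
    module

end Fusion

/-! ### The Sklyanin determinant commutes with the matrix entries -/

section Central

variable {J K W : Type*}
  [Fintype J] [DecidableEq J] [CommRing K] [Ring W] [Algebra K W] [InvolutiveNeg J]
  {θ : J → J → ℤ}

theorem extOp_permOp {m : ℕ} (τ : Perm (Fin m)) : extOp Fin.succ (permOp J W τ) =
    permOp J W (Perm.decomposeFin.symm (0, τ)) := by
  ext p q
  have hs : ∀ c : Fin (m + 1), c ∉ Set.range (Fin.succ : Fin m → _) ↔ c = 0 := fun c =>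
    Fin.cases (by simp) (fun i => by simp) c
  by_cases h : p 0 = q 0
  · rw [extOp_of (by simp [hs, h])]
    simp [permOp, Fin.forall_fin_succ, h]
  · rw [extOp_of_not (by simpa [hs] using h)]
    simp [permOp, Fin.forall_fin_succ, h]

theorem extOp_altOp (m : ℕ) : extOp Fin.succ (altOp (Fin m) J W) =
    ∑ τ : Perm (Fin m), (Perm.sign τ : ℤ) • permOp J W (Perm.decomposeFin.symm (0, τ)) := by
  ext p q
  simp only [← extOp_permOp, Matrix.sum_apply, Matrix.smul_apply]
  by_cases h : ∀ c ∉ Set.range (Fin.succ : Fin m → _), p c = q c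
  · simp only [extOp_of h, altOp, Matrix.sum_apply, Matrix.smul_apply]
  · simp only [extOp_of_not h, smul_zero, sum_const_zero]

theorem decomposeFin_symm_inv {m : ℕ} (x : Fin (m + 1)) (e : Perm (Fin m)) :
    (Perm.decomposeFin.symm (x, e))⁻¹ = Perm.decomposeFin.symm (0, e⁻¹) * swap 0 x := by
  rw [inv_eq_iff_mul_eq_one]
  ext c
  refine congrArg Fin.val ?_
  simp only [Perm.mul_apply, Perm.one_apply]
  obtain ⟨d, rfl⟩ := (swap 0 x).surjective c
  rw [swap_apply_self]
  refine Fin.cases ?_ (fun i => ?_) d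
  · simp
  · simp

/-- Decomposition of the symmetric group into cosets of the stabilizer of `0`, with the swaps `(0
i)` as representatives. -/
theorem altOp_succ (m : ℕ) : altOp (Fin (m + 1)) J W =
    extOp Fin.succ (altOp (Fin m) J W) *
      (1 - ∑ i : Fin m, permOp J W (swap (0 : Fin (m + 1)) i.succ)) := by
  have h1 : altOp (Fin (m + 1)) J W = ∑ x : Fin (m + 1), (if x = 0 then (1 : ℤ) else -1) •
      (extOp Fin.succ (altOp (Fin m) J W) * permOp J W (swap 0 x)) := by
    -- Summing over inverses puts the swap on the right of the subgroup element, where the formula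
    -- needs it.
    rw [altOp, ← Equiv.sum_comp (Equiv.inv (Perm (Fin (m + 1)))),
      ← Perm.decomposeFin.symm.sum_comp, Fintype.sum_prod_type]
    refine sum_congr rfl fun x _ => ?_
    rw [extOp_altOp, ← Equiv.sum_comp (Equiv.inv (Perm (Fin m))), sum_mul, smul_sum]
    refine sum_congr rfl fun e _ => ?_
    simp only [Equiv.inv_apply, Perm.sign_inv, decomposeFin_symm_inv, smul_mul_assoc, smul_smul,
      ← permOp_mul_permOp, Perm.decomposeFin.symm_sign]
    by_cases hx : x = 0
    · simp [hx]
    · simp [hx, Ne.symm hx]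
  rw [h1, Fin.sum_univ_succ, mul_sub, mul_one, mul_sum]
  simp [Fin.succ_ne_zero, permOp_one, sub_eq_add_neg, sum_neg_distrib, ← Perm.one_def]

theorem extOp_altOp_mul_permOp_swap {m : ℕ} {i j : Fin m} (hij : i ≠ j) :
    extOp Fin.succ (altOp (Fin m) J W) * permOp J W (swap i.succ j.succ) =
      -extOp Fin.succ (altOp (Fin m) J W) := by
  have h1 : permOp J W (swap i.succ j.succ) = extOp Fin.succ (permOp J W (swap i j)) := by
    rw [extOp_permOp]
    congr 1
    ext c
    refine congrArg Fin.val (Fin.cases ?_ (fun k => ?_) c)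
    · rw [Perm.decomposeFin_symm_apply_zero, swap_apply_of_ne_of_ne] <;> simp [Ne, eq_comm]
    · rw [Perm.decomposeFin_symm_apply_succ, swap_self, refl_apply,
        (Fin.succ_injective m).map_swap]
  rw [h1, ← extOp_mul (Fin.succ_injective m), altOp_mul_permOp, Perm.sign_swap hij]
  ext p q
  by_cases h : ∀ c ∉ Set.range (Fin.succ : Fin m → _), p c = q c
  · simp [extOp_of h]
  · simp [extOp_of_not h]

/-- The antisymmetrizer on one more site than there are indices vanishes; `altOp_succ` reads this
off as an identity for the swaps. -/
theorem extOp_altOp_mul_sum_permOp {m : ℕ} (hm : Fintype.card J = m) :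
    extOp Fin.succ (altOp (Fin m) J W) *
        (∑ i : Fin m, permOp J W (swap (0 : Fin (m + 1)) i.succ)) =
      extOp Fin.succ (altOp (Fin m) J W) := by
  have h0 : altOp (Fin (m + 1)) J W = 0 := by
    ext p q
    have := altOp_apply_of_not_injective (p := p) (q := q) (Y := (1 : SiteMatrix (Fin (m + 1)) J W))
      (fun h => by simpa [hm] using Fintype.card_le_of_injective p h)
    simpa using this
  have := altOp_succ (J := J) (W := W) m
  rw [h0, mul_sub, mul_one] at this
  exact (sub_eq_zero.mp this.symm).symm

/-- `Q` is the transpose of `P` at site `0` with respect to the form given by `θ`. An operator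
trivial on site `0` does not notice this transposition, so identities for sums of `P` carry over to
sums of `Q`. -/
theorem extOp_mul_pairOp_apply (hθ : IsSignForm θ) {m : ℕ} (Y : SiteMatrix (Fin m) J W) (i : Fin m)
    (p q : Fin (m + 1) → J) :
    (extOp Fin.succ Y * pairOp W θ 0 i.succ) p q =
      ((θ (q 0) (p 0) : ℤ) : W) * (extOp Fin.succ Y * permOp J W (swap 0 i.succ))
        (Fin.cons (α := fun _ => J) (-q 0) (Fin.tail p))
        (Fin.cons (α := fun _ => J) (-p 0) (Fin.tail q)) := by
  rw [extOp_succ_mul_apply, extOp_succ_mul_apply, mul_sum]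
  refine sum_congr rfl fun r _ => ?_
  rw [← mul_assoc, (Int.cast_commute _ _).eq, mul_assoc, Fin.tail_cons, Fin.cons_zero]
  congr 1
  by_cases h : p 0 = -r i ∧ q 0 = -q i.succ ∧ ∀ c, c ≠ i → r c = q c.succ
  · obtain ⟨h1, h2, h3⟩ := h
    rw [pairOp_of (by simpa using h1) h2, permOp, if_pos]
    · rw [h1, h2, hθ.neg]
      simp
    · refine Fin.cases (by simp [h1]) fun c => ?_
      by_cases hc : c = i
      · subst hc
        simp [h2, Fin.tail]
      · rw [swap_apply_of_ne_of_ne (by simp) (by simpa using hc)]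
        simpa [Fin.tail] using h3 c hc
    · refine Fin.cases (by simp) fun c _ hc => ?_
      simpa using h3 c fun e => hc (e ▸ rfl)
  · rw [pairOp, if_neg, permOp, if_neg, mul_zero]
    · intro h'
      refine h ⟨?_, ?_, fun c hc => ?_⟩
      · simpa using congrArg (-·) (h' 0).symm
      · simpa [Fin.tail, neg_eq_iff_eq_neg] using h' i.succ
      · have := h' c.succ
        rw [swap_apply_of_ne_of_ne (by simp) (by simpa using hc)] at this
        simpa [Fin.tail] using this
    · rintro ⟨h1, h2, h3⟩
      exact h ⟨by simpa using h1, h2, fun c hc => by simpa using h3 c.succ (by simp) (by simpa using hc)⟩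

theorem extOp_altOp_mul_sum_pairOp (hθ : IsSignForm θ) {m : ℕ} (hm : Fintype.card J = m) :
    extOp Fin.succ (altOp (Fin m) J W) * (∑ i : Fin m, pairOp W θ (0 : Fin (m + 1)) i.succ) =
      extOp Fin.succ (altOp (Fin m) J W) := by
  ext p q
  have h1 := congrFun (congrFun (extOp_altOp_mul_sum_permOp (J := J) (W := W) hm)
    (Fin.cons (α := fun _ => J) (-q 0) (Fin.tail p)))
    (Fin.cons (α := fun _ => J) (-p 0) (Fin.tail q))
  rw [mul_sum, Matrix.sum_apply] at h1 ⊢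
  simp only [extOp_mul_pairOp_apply hθ, ← mul_sum, h1]
  have hs : ∀ c : Fin (m + 1), c ∉ Set.range (Fin.succ : Fin m → _) ↔ c = 0 := fun c =>
    Fin.cases (by simp) (fun i => by simp) c
  by_cases hpq : p 0 = q 0
  · rw [extOp_of (by simp [hs, hpq]), extOp_of (by simp [hs, hpq]), hpq, hθ.self, Int.cast_one,
      one_mul]
    rfl
  · rw [extOp_of_not, extOp_of_not (p := p), mul_zero]
    · simpa [hs] using hpq
    · simpa [hs] using Ne.symm hpq

/-- The Sklyanin determinant commutes with the entries of the matrix at all other values of the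
parameter. -/
theorem commute_qminor_of_bijective [Invertible (2 : K)] (hθ : IsSignForm θ) {m : ℕ}
    {S : Fin (m + 1) → Matrix J J W} {α β : Fin (m + 1) → Fin (m + 1) → K}
    (h : IsQuatFamily θ S α β) (hα : ∀ i j : Fin m, (j : ℕ) = i + 1 → α i.succ j.succ = 1)
    (hα0 : ∀ i j : Fin m, (j : ℕ) = i + 1 → α 0 j.succ * (1 + α 0 i.succ) = α 0 i.succ)
    (hαu : ∀ i : Fin m, IsUnit (1 - α 0 i.succ)) {β₀ : K} (hβ₀ : IsUnit (1 + β₀))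
    (hβ : ∀ i : Fin m, β 0 i.succ * (1 - (i : ℕ) * β₀) = β₀)
    {B : Fin m → J} (hB : B.Bijective) (a b : J) :
    Commute (S 0 a b) (qminor θ (S ∘ Fin.succ) (fun a b => β a.succ b.succ)
      (List.finRange m) B B) := by
  have hm : Fintype.card J = m := by
    rw [← Fintype.card_of_bijective hB, Fintype.card_fin]
  obtain - | n := m
  · obtain ⟨i, -⟩ := hB.2 a
    exact i.elim0
  set l := (List.finRange (n + 1)).map Fin.succ with hl
  have hs : (Fin.succ : Fin (n + 1) → Fin (n + 2)).Injective := Fin.succ_injective _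
  have hl0 : (0 : Fin (n + 2)) ∉ l := by simp [hl]
  have hnd : ((0 : Fin (n + 2)) :: l).Nodup := by
    rw [hl, ← List.finRange_succ]
    exact List.nodup_finRange _
  have hln : l.Nodup := (List.nodup_cons.mp hnd).2
  have key := rChain_mul_siteOp_mul hθ h hnd
  set A := extOp Fin.succ (altOp (Fin (n + 1)) J W) with hA
  have hAP : ∀ x ∈ l, ∀ y ∈ l, x ≠ y → A * permOp J W (swap x y) = -A := by
    intro x hx y hy hxy
    obtain ⟨i, -, rfl⟩ := List.mem_map.mp hx
    obtain ⟨j, -, rfl⟩ := List.mem_map.mp hy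
    exact extOp_altOp_mul_permOp_swap fun e => hxy (e ▸ rfl)
  -- Fusion leaves one coefficient, that of the last element of the reversed list, which is site
  -- `1`; the sum of swaps then acts as `1` behind `A`.
  have hAR : A * rChain J W (α 0) 0 l.reverse = (1 - α 0 1) • A := by
    obtain ⟨l', hl'⟩ : ∃ l', l.reverse = l' ++ [1] :=
      ⟨((List.finRange n).map (Fin.succ ∘ Fin.succ)).reverse, by
        rw [hl, List.finRange_succ]; simp⟩
    have hmem : ∀ x ∈ l' ++ [1], x ∈ l := fun x hx => by rwa [← List.mem_reverse, hl']
    rw [hl', mul_rChain_eq (hl' ▸ List.nodup_reverse.mpr hln) (hl' ▸ by simpa using hl0)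
      (fun x hx y hy => hAP x (hmem x hx) y (hmem y hy)), ← hl', List.map_reverse,
      List.sum_reverse, hl, List.map_map]
    · have := extOp_altOp_mul_sum_permOp (J := J) (W := W) hm
      rw [← List.ofFn_eq_map, List.sum_ofFn]
      simp only [Function.comp_apply]
      rw [mul_sub, mul_one, mul_smul_comm, this]
      module
    · rw [← hl', hl]
      rw [List.isChain_reverse, List.isChain_map, List.isChain_iff_getElem]
      intro i hi
      simp only [List.getElem_finRange]
      exact hα0 _ _ (by simp)
  have hAT : A * rtProd W θ β 0 l = (1 + β₀) • A := by
    rw [mul_rtProd_eq hθ hln hl0 hAP (β₀ := β₀), hl, List.map_map, ← List.ofFn_eq_map,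
      List.sum_ofFn]
    · have := extOp_altOp_mul_sum_pairOp (W := W) hθ hm
      simp only [Function.comp_apply]
      rw [mul_add, mul_one, mul_smul_comm, this]
      module
    · intro i hi
      simp only [hl, List.getElem_map, List.getElem_finRange]
      exact hβ _
  set D := qminor θ (S ∘ Fin.succ) (fun a b => β a.succ b.succ) (List.finRange (n + 1)) B B with hD
  -- All indices occur on the sites of `l`, so the antisymmetrized product is the determinant times
  -- `A`.
  have hAX : A * bracket θ S β l = D • A := by
    rw [hl, ← extOp_bracket θ hs, hA, ← extOp_mul hs, ← extOp_smul]
    congr 1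
    ext p q
    exact qminor_eq_mul_altOp hθ (h.comp hs) hα hB p q
  set U := siteOp (S 0) (0 : Fin (n + 2)) with hU
  have hAU : A * U = U * A := by
    refine ActsOn.commute (s := Set.range Fin.succ) (t := {0}) (by simp) (actsOn_extOp _ _)
      (actsOn_siteOp _ _) fun p q p' q' => ?_
    by_cases hc : ∀ c ∉ Set.range (Fin.succ : Fin (n + 1) → _), p c = q c
    · rw [hA, extOp_of hc, altOp_apply]
      refine Commute.sum_left _ _ _ fun σ _ => Commute.smul_left ?_ _
      split_ifs
      · exact Commute.one_left _
      · exact Commute.zero_left _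
    · rw [hA, extOp_of_not hc]
      exact Commute.zero_left _
  -- Behind `A` both chains are scalars, equal on the two sides of the exchange relation, and only
  -- the order of `U` and `D` differs.
  have e1 : ((1 - α 0 1) * (1 + β₀)) • (U * (D • A)) =
      ((1 - α 0 1) * (1 + β₀)) • (D • (U * A)) := by
    have e0 := congrArg (A * ·) key
    calc ((1 - α 0 1) * (1 + β₀)) • (U * (D • A))
        = (1 - α 0 1) • (U * ((1 + β₀) • A * bracket θ S β l)) := by
          rw [← hAX, smul_mul_assoc, mul_smul_comm, mul_smul]
      _ = (1 - α 0 1) • A * (U * rtProd W θ β 0 l * bracket θ S β l) := by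
          rw [← hAT, smul_mul_assoc]
          congr 1
          simp only [← mul_assoc, hAU]
      _ = A * bracket θ S β l * rtProd W θ β 0 l * U * rChain J W (α 0) 0 l.reverse := by
          rw [← hAR, mul_assoc A, e0]
          simp only [mul_assoc]
      _ = D • ((1 + β₀) • (U * (A * rChain J W (α 0) 0 l.reverse))) := by
          rw [hAX, smul_mul_assoc, hAT, smul_mul_assoc, smul_mul_assoc, smul_mul_assoc,
            smul_mul_assoc, hAU, mul_assoc]
      _ = _ := by
          rw [hAR, mul_smul_comm, smul_smul, mul_comm, smul_comm]
  have e2 : U * (D • A) = D • (U * A) := by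
    obtain ⟨u, hu⟩ := (hαu 0).mul hβ₀
    have := congrArg ((↑u⁻¹ : K) • ·) e1
    rw [Fin.succ_zero_eq_one] at hu
    simpa only [← hu, smul_smul, Units.inv_mul, one_smul] using this
  have e3 := congrFun (congrFun e2 (Fin.cons (α := fun _ => J) a B))
    (Fin.cons (α := fun _ => J) b B)
  have hs0 : ∀ c : Fin (n + 2), c ∉ Set.range (Fin.succ : Fin (n + 1) → _) ↔ c = 0 := fun c =>
    Fin.cases (by simp) (fun i => by simp) c
  have e4 : ∀ k, A (Fin.cons (α := fun _ => J) k B) (Fin.cons (α := fun _ => J) b B) =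
      if k = b then 1 else 0 := by
    intro k
    by_cases hk : k = b
    · rw [if_pos hk, hA, extOp_of (by simp [hs0, hk])]
      exact altOp_apply_self hB.1
    · rw [if_neg hk, hA, extOp_of_not (by simpa [hs0] using hk)]
  rw [Matrix.smul_apply, siteOp_mul_apply, siteOp_mul_apply] at e3
  have e5 : S 0 a b * D = D * S 0 a b := by simpa [e4] using e3
  exact e5

end Central

/-! ### Substitution in power series over a noncommutative ring -/

section Substitution

open PowerSeries

variable {A B : Type*} [Ring A] [Ring B]

/-- The series `(F - F_0) / X`. -/
def tail (F : A⟦X⟧) : A⟦X⟧ := mk fun n => coeff (n + 1) F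

theorem eq_C_add_X_mul_tail (F : A⟦X⟧) : F = C (coeff 0 F) + X * tail F := by
  rw [add_comm]
  simpa [tail] using eq_X_mul_shift_add_const F

theorem coeff_mul_congr {d : ℕ} (k : A⟦X⟧) {f g : A⟦X⟧} (h : ∀ b ≤ d, coeff b f = coeff b g) :
    coeff d (k * f) = coeff d (k * g) := by
  rw [coeff_mul, coeff_mul]
  refine sum_congr rfl fun x hx => ?_
  rw [h x.2 (by rw [HasAntidiagonal.mem_antidiagonal] at hx; omega)]

theorem coeff_pow_mul_eq_zero {η : A⟦X⟧} (hη : coeff 0 η = 0) {d q : ℕ} (h : d < q) (w : A⟦X⟧) :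
    coeff d (η ^ q * w) = 0 := by
  induction q generalizing d w with
  | zero => omega
  | succ q ih =>
    rw [pow_succ', mul_assoc, coeff_mul]
    refine sum_eq_zero fun x hx => ?_
    rw [HasAntidiagonal.mem_antidiagonal] at hx
    rcases Nat.eq_zero_or_pos x.1 with h0 | h0
    · rw [h0, hη, zero_mul]
    · rw [ih (by omega), mul_zero]

/-- The value at `y = η` of a series in `y` with coefficients in `A⟦x⟧`. -/
def ev (η : A⟦X⟧) (F : A⟦X⟧⟦X⟧) : A⟦X⟧ :=
  mk fun d => ∑ q ∈ range (d + 1), coeff d (η ^ q * coeff q F)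

theorem coeff_ev {η : A⟦X⟧} (hη : coeff 0 η = 0) (F : A⟦X⟧⟦X⟧) {d n : ℕ} (h : d < n) :
    coeff d (ev η F) = ∑ q ∈ range n, coeff d (η ^ q * coeff q F) := by
  rw [ev, coeff_mk]
  refine sum_subset (range_subset_range.mpr h) fun q _ hq => ?_
  exact coeff_pow_mul_eq_zero hη (by simpa using hq) _

/-- Horner's recursion. With `eq_zero_of_eq_mul_tail` it characterizes the evaluation, and the
algebraic rules are derived from it without returning to the sums. -/
theorem ev_eq {η : A⟦X⟧} (hη : coeff 0 η = 0) (F : A⟦X⟧⟦X⟧) :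
    ev η F = coeff 0 F + η * ev η (tail F) := by
  ext d
  have h : ∀ b ≤ d, coeff b (ev η (tail F)) =
      coeff b (∑ q ∈ range (d + 1), η ^ q * coeff (q + 1) F) := by
    intro b hb
    rw [coeff_ev hη _ (Nat.lt_succ_of_le hb), map_sum]
    simp [tail]
  rw [coeff_ev hη F (n := d + 1 + 1) (by omega), sum_range_succ', map_add, coeff_mul_congr _ h,
    mul_sum, map_sum, add_comm]
  simp [pow_succ', mul_assoc]

theorem ev_add (η : A⟦X⟧) (F G : A⟦X⟧⟦X⟧) : ev η (F + G) = ev η F + ev η G := by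
  ext d
  simp [ev, mul_add, sum_add_distrib]

/-- Every use of the recursion gains a factor `η` without constant term, so the value is divisible
by arbitrarily high powers of the variable. -/
theorem eq_zero_of_eq_mul_tail {η : B⟦X⟧} (hη : coeff 0 η = 0) {e : A⟦X⟧ → B⟦X⟧}
    (h : ∀ F, e F = η * e (tail F)) (F : A⟦X⟧) : e F = 0 := by
  have : ∀ n d F, d < n → coeff d (e F) = 0 := by
    intro n
    induction n with
    | zero => intro d F hd; omega
    | succ n ih =>
      intro d F hd
      rw [h, coeff_mul]
      refine sum_eq_zero fun x hx => ?_
      rw [HasAntidiagonal.mem_antidiagonal] at hx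
      rcases Nat.eq_zero_or_pos x.1 with h0 | h0
      · rw [h0, hη, zero_mul]
      · rw [ih _ _ (by omega), mul_zero]
  ext d
  rw [this (d + 1) d F (by omega), map_zero]

theorem tail_X_mul (F : A⟦X⟧) : tail (X * F) = F := by
  ext n
  simp [tail, coeff_succ_X_mul]

theorem tail_C (a : A) : tail (C a) = 0 := by
  ext n
  simp [tail, coeff_C]

theorem tail_C_mul (a : A) (F : A⟦X⟧) : tail (C a * F) = C a * tail F := by
  ext n
  simp [tail]

theorem ev_zero (η : A⟦X⟧) : ev η 0 = 0 := by
  ext d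
  simp [ev]

theorem ev_C {η : A⟦X⟧} (hη : coeff 0 η = 0) (w : A⟦X⟧) : ev η (C w) = w := by
  rw [ev_eq hη, tail_C, ev_zero]
  simp

theorem ev_X_mul {η : A⟦X⟧} (hη : coeff 0 η = 0) (F : A⟦X⟧⟦X⟧) :
    ev η (X * F) = η * ev η F := by
  rw [ev_eq hη, tail_X_mul]
  simp

theorem ev_C_mul {η : A⟦X⟧} (hη : coeff 0 η = 0) (hc : ∀ w, Commute η w) (w : A⟦X⟧)
    (F : A⟦X⟧⟦X⟧) : ev η (C w * F) = w * ev η F := by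
  refine sub_eq_zero.mp (eq_zero_of_eq_mul_tail hη (e := fun F => ev η (C w * F) - w * ev η F)
    (fun F => ?_) F)
  rw [ev_eq hη, ev_eq hη F, tail_C_mul, mul_sub, mul_add, ← mul_assoc w η, ← (hc w).eq]
  simp [mul_assoc]

theorem ev_mul {η : A⟦X⟧} (hη : coeff 0 η = 0) (hc : ∀ w, Commute η w)
    (F G : A⟦X⟧⟦X⟧) : ev η (F * G) = ev η F * ev η G := by
  refine sub_eq_zero.mp (eq_zero_of_eq_mul_tail hη (e := fun F => ev η (F * G) - ev η F * ev η G)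
    (fun F => ?_) F)
  conv_lhs => rw [eq_C_add_X_mul_tail F]
  rw [add_mul, ev_add, ev_add, ev_C_mul hη hc, ev_C hη, mul_assoc, ev_X_mul hη, ev_X_mul hη]
  noncomm_ring

/-- Evaluation at a central element without constant term. -/
def evHom (η : A⟦X⟧) (hη : coeff 0 η = 0) (hc : ∀ w, Commute η w) : A⟦X⟧⟦X⟧ →+* A⟦X⟧ where
  toFun := ev η
  map_zero' := ev_zero η
  map_one' := by simpa using ev_C hη 1
  map_add' := ev_add η
  map_mul' := ev_mul hη hc

theorem evHom_C {η : A⟦X⟧} (hη : coeff 0 η = 0) (hc : ∀ w, Commute η w) (w : A⟦X⟧) :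
    evHom η hη hc (C w) = w := ev_C hη w

theorem evHom_X {η : A⟦X⟧} (hη : coeff 0 η = 0) (hc : ∀ w, Commute η w) :
    evHom η hη hc X = η := by
  have := ev_X_mul hη (C 1)
  rw [ev_C hη, map_one, mul_one, mul_one] at this
  exact this

/-- A root of a series gives a linear factor. -/
theorem exists_eq_sub_mul_of_ev_eq_zero {η : A⟦X⟧} (hη : coeff 0 η = 0) {F : A⟦X⟧⟦X⟧}
    (h : ev η F = 0) : ∃ G, F = (X - C η) * G := by
  -- Synthetic division: the coefficients of the quotient are the partial values in Horner's scheme.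
  refine ⟨mk fun q => ev η (tail^[q + 1] F), ?_⟩
  have ht : ∀ q (F : A⟦X⟧⟦X⟧), coeff 0 (tail^[q] F) = coeff q F := by
    intro q
    induction q with
    | zero => simp
    | succ q ih => intro F; rw [Function.iterate_succ_apply, ih]; simp [tail]
  have key : ∀ q, ev η (tail^[q] F) = coeff q F + η * ev η (tail^[q + 1] F) := by
    intro q
    rw [ev_eq hη, ht, Function.iterate_succ_apply' tail q]
  refine PowerSeries.ext fun q => ?_
  rw [sub_mul, map_sub, coeff_C_mul, coeff_mk]
  cases q with
  | zero =>
    have := key 0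
    rw [Function.iterate_zero, id, h] at this
    rw [coeff_zero_X_mul, zero_sub]
    exact eq_neg_of_add_eq_zero_left this.symm
  | succ q =>
    rw [coeff_succ_X_mul, coeff_mk, key (q + 1)]
    abel

/-- Ring homomorphisms of power series rings that are continuous in the `X`-adic topology are
determined by the images of the constants and of `X`. -/
theorem ringHom_ext_of_X {φ ψ : A⟦X⟧ →+* B⟦X⟧} (h0 : coeff 0 (φ X) = 0) (hX : φ X = ψ X)
    (hC : ∀ a, φ (C a) = ψ (C a)) : φ = ψ := by
  ext1 F
  refine sub_eq_zero.mp (eq_zero_of_eq_mul_tail h0 (e := fun F => φ F - ψ F) (fun F => ?_) F)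
  conv_lhs => rw [eq_C_add_X_mul_tail F]
  rw [map_add, map_add, map_mul, map_mul, hC, hX, mul_sub]
  abel

end Substitution

/-! ### Complex scalar series, linear substitutions and their continuity -/

section Scalars

open PowerSeries

variable {A : Type*} [Ring A] [Algebra ℂ A]

/-- Series with complex coefficients as series with coefficients in an algebra. -/
def emb (A : Type*) [Ring A] [Algebra ℂ A] : ℂ⟦X⟧ →+* A⟦X⟧ := map (algebraMap ℂ A)

theorem coeff_emb (k : ℂ⟦X⟧) (d : ℕ) : coeff d (emb A k) = algebraMap ℂ A (coeff d k) := by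
  simp [emb]

theorem emb_C (c : ℂ) : emb A (C c) = C (algebraMap ℂ A c) := by
  simp [emb]

theorem emb_X : emb A X = X := by
  simp [emb]

theorem commute_emb (k : ℂ⟦X⟧) (w : A⟦X⟧) : Commute (emb A k) w := by
  refine PowerSeries.ext fun d => ?_
  rw [coeff_mul, coeff_mul, ← Nat.sum_antidiagonal_swap]
  refine sum_congr rfl fun x _ => ?_
  rw [coeff_emb]
  exact Algebra.commutes _ _

instance algebraSeries : Algebra ℂ⟦X⟧ A⟦X⟧ := (emb A).toAlgebra' fun k w => commute_emb k w

theorem algebraMap_eq_emb : algebraMap ℂ⟦X⟧ A⟦X⟧ = emb A := rfl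

theorem smul_eq_emb_mul (k : ℂ⟦X⟧) (w : A⟦X⟧) : k • w = emb A k * w := rfl

/-- A nonzero complex series is a power of the variable times a unit, and both factors can be
cancelled over any algebra. -/
theorem eq_zero_of_emb_mul_eq_zero {k : ℂ⟦X⟧} (hk : k ≠ 0) {w : A⟦X⟧} (h : emb A k * w = 0) :
    w = 0 := by
  obtain ⟨k', n, hk'⟩ : ∃ (k' : ℂ⟦X⟧) (n : ℕ), k' * k = X ^ n := by
    refine ⟨(divXPowOrder k)⁻¹, k.order.toNat, ?_⟩
    conv_lhs => enter [2]; rw [← X_pow_order_mul_divXPowOrder (f := k)]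
    rw [mul_left_comm, PowerSeries.inv_mul_cancel, mul_one]
    rw [← Unit_of_divided_by_X_pow_order_nonzero hk]
    exact (isUnit_iff_constantCoeff.mp (Units.isUnit _)).ne_zero
  have h1 : X ^ n * w = 0 := by
    rw [← emb_X, ← map_pow, ← hk', map_mul, mul_assoc, h, mul_zero]
  ext d
  have := congrArg (coeff (d + n)) h1
  rwa [coeff_X_pow_mul, map_zero] at this

/-- The series `(ε u + c)⁻¹`. -/
def invLin (ε c : ℂ) : ℂ⟦X⟧ := X * (C ε + C c * X)⁻¹

theorem invLin_mul {ε : ℂ} (hε : ε ≠ 0) (c : ℂ) : invLin ε c * (C ε + C c * X) = X := by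
  rw [invLin, mul_assoc, PowerSeries.inv_mul_cancel, mul_one]
  simpa using hε

theorem lin_ne_zero {ε : ℂ} (hε : ε ≠ 0) (c : ℂ) : (C ε + C c * X : ℂ⟦X⟧) ≠ 0 := by
  intro h
  have := congrArg constantCoeff h
  simp [hε] at this

theorem eq_invLin {ε c : ℂ} (hε : ε ≠ 0) {k : ℂ⟦X⟧} (h : k * (C ε + C c * X) = X) :
    k = invLin ε c :=
  mul_right_cancel₀ (lin_ne_zero hε c) (h.trans (invLin_mul hε c).symm)

theorem coeff_zero_invLin (ε c : ℂ) : coeff 0 (invLin ε c) = 0 := by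
  simp [invLin]

theorem coeff_zero_emb_invLin (ε c : ℂ) : coeff 0 (emb A (invLin ε c)) = 0 := by
  rw [coeff_emb, coeff_zero_invLin, map_zero]

theorem invLin_ne_zero {ε : ℂ} (hε : ε ≠ 0) (c : ℂ) : invLin ε c ≠ 0 := by
  intro h
  have := invLin_mul hε c
  rw [h, zero_mul] at this
  exact X_ne_zero this.symm

variable (A) in
/-- The substitution `v ↦ ε u + c` in series in `v⁻¹` with coefficients that are series in
`u⁻¹`. -/
def evLin (ε c : ℂ) : A⟦X⟧⟦X⟧ →+* A⟦X⟧ :=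
  evHom (emb A (invLin ε c)) (coeff_zero_emb_invLin ε c) (commute_emb _)

variable (A) in
/-- The substitution `u ↦ ε u + c` in series in `u⁻¹`. -/
def lin (ε c : ℂ) : A⟦X⟧ →+* A⟦X⟧ := (evLin A ε c).comp (map C)

theorem evLin_C (ε c : ℂ) (w : A⟦X⟧) : evLin A ε c (C w) = w := evHom_C _ _ w

theorem evLin_X (ε c : ℂ) : evLin A ε c X = emb A (invLin ε c) := evHom_X _ _

theorem evLin_map (ε c : ℂ) (w : A⟦X⟧) : evLin A ε c (map C w) = lin A ε c w := rfl

theorem lin_C (ε c : ℂ) (a : A) : lin A ε c (C a) = C a := by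
  rw [← evLin_map, map_C, evLin_C]

theorem lin_X (ε c : ℂ) : lin A ε c X = emb A (invLin ε c) := by
  rw [← evLin_map, map_X, evLin_X]

theorem emb_complex : emb ℂ = RingHom.id _ := by
  ext k
  simp [emb]

theorem lin_emb (ε c : ℂ) (k : ℂ⟦X⟧) : lin A ε c (emb A k) = emb A (lin ℂ ε c k) := by
  refine RingHom.congr_fun (ringHom_ext_of_X (φ := (lin A ε c).comp (emb A))
    (ψ := (emb A).comp (lin ℂ ε c)) ?_ ?_ ?_) k
  · simp only [RingHom.comp_apply]
    rw [emb_X, lin_X, coeff_zero_emb_invLin]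
  · simp only [RingHom.comp_apply]
    rw [emb_X, lin_X, lin_X, emb_complex, RingHom.id_apply]
  · intro a
    simp only [RingHom.comp_apply]
    rw [emb_C, lin_C, lin_C, emb_C]

theorem lin_invLin {ε ε' : ℂ} (hε : ε ≠ 0) (hε' : ε' ≠ 0) (c c' : ℂ) :
    lin ℂ ε c (invLin ε' c') = invLin (ε' * ε) (ε' * c + c') := by
  refine eq_invLin (mul_ne_zero hε' hε) ?_
  have h1 := congrArg (lin ℂ ε c) (invLin_mul hε' c')
  rw [map_mul, map_add, map_mul, lin_C, lin_C, lin_X, emb_complex, RingHom.id_apply] at h1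
  have h2 := invLin_mul hε c
  refine mul_left_cancel₀ (invLin_ne_zero hε c) ?_
  simp only [map_add, map_mul]
  linear_combination X * h1 + (lin ℂ ε c (invLin ε' c')) * C ε' * h2

theorem lin_lin {ε ε' : ℂ} (hε : ε ≠ 0) (hε' : ε' ≠ 0) (c c' : ℂ) (f : A⟦X⟧) :
    lin A ε c (lin A ε' c' f) = lin A (ε' * ε) (ε' * c + c') f := by
  refine RingHom.congr_fun (ringHom_ext_of_X (φ := (lin A ε c).comp (lin A ε' c'))
    (ψ := lin A (ε' * ε) (ε' * c + c')) ?_ ?_ ?_) f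
  · simp only [RingHom.comp_apply]
    rw [lin_X, lin_emb, lin_invLin hε hε', coeff_zero_emb_invLin]
  · simp only [RingHom.comp_apply]
    rw [lin_X, lin_emb, lin_invLin hε hε', lin_X]
  · intro a
    simp only [RingHom.comp_apply, lin_C]

theorem lin_one_zero (f : A⟦X⟧) : lin A 1 0 f = f := by
  refine RingHom.congr_fun (ringHom_ext_of_X (φ := lin A 1 0) (ψ := RingHom.id _) ?_ ?_ ?_) f
  · rw [lin_X, coeff_zero_emb_invLin]
  · rw [lin_X, RingHom.id_apply, ← eq_invLin (k := X) one_ne_zero (by simp), emb_X]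
  · intro a
    rw [lin_C, RingHom.id_apply]

theorem shift_eq_lin (c : ℂ) (f : A⟦X⟧) : shift c f = lin A 1 c f := by
  refine PowerSeries.ext fun d => ?_
  rw [shift, ← evLin_map, coeff_mk]
  change _ = coeff d (ev _ _)
  rw [ev, coeff_mk]
  refine sum_congr rfl fun r _ => ?_
  rw [← map_pow, coeff_map, coeff_mul_C, coeff_emb, Algebra.smul_def, invLin, map_one]

theorem invTwoSub_eq_emb (c : ℂ) : invTwoSub A c = emb A (invLin 2 (-c)) := by
  rw [invTwoSub, emb, invLin, map_neg, neg_mul, ← sub_eq_add_neg]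
  rfl

theorem coeff_zero_lin (ε c : ℂ) (f : A⟦X⟧) : coeff 0 (lin A ε c f) = coeff 0 f := by
  conv_lhs => rw [eq_C_add_X_mul_tail f]
  have h0 := coeff_zero_emb_invLin (A := A) ε c
  rw [map_add, map_mul, lin_C, lin_X, map_add]
  simp only [coeff_zero_eq_constantCoeff] at h0 ⊢
  simp [h0]

theorem invLin_sub (ε c c' : ℂ) (hε : ε ≠ 0) :
    invLin ε c - invLin ε c' = C (c' - c) * (invLin ε c * invLin ε c') := by
  refine mul_right_cancel₀ (lin_ne_zero hε c) (mul_right_cancel₀ (lin_ne_zero hε c') ?_)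
  rw [map_sub]
  have h1 := invLin_mul hε c
  have h2 := invLin_mul hε c'
  linear_combination (C ε + C c' * X) * h1 - (C ε + C c * X) * h2 - (C c' - C c) *
    (invLin ε c' * (C ε + C c' * X) * h1 + X * h2)

/-- A series that vanishes at infinitely many shifts of the parameter is zero. -/
theorem eq_zero_of_evLin_eq_zero {F : A⟦X⟧⟦X⟧} {Z : Set ℂ} (hZ : Z.Infinite)
    (h : ∀ z ∈ Z, evLin A 1 z F = 0) : F = 0 := by
  have key : ∀ (n : ℕ) (F : A⟦X⟧⟦X⟧) (Z : Set ℂ), Z.Infinite → (∀ z ∈ Z, evLin A 1 z F = 0) →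
      ∀ p q, p + q < n → coeff p (coeff q F) = 0 := by
    intro n
    induction n with
    | zero => intro F Z _ _ p q hpq; omega
    | succ n ih =>
      intro F Z hZ h p q hpq
      obtain ⟨z, hz⟩ := hZ.nonempty
      -- One root is split off; the linear factor is cancellable at every other root, so `G`
      -- inherits them. Multiplication by the factor raises the total degree, which drives the
      -- induction on `p + q`.
      obtain ⟨G, hG⟩ := exists_eq_sub_mul_of_ev_eq_zero (coeff_zero_emb_invLin 1 z) (h z hz)
      have hG0 := ih G (Z \ {z}) (hZ.sdiff (Set.finite_singleton z)) fun z' hz' => by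
        have h1 := h z' hz'.1
        rw [hG, map_mul, map_sub, evLin_X, evLin_C, ← map_sub] at h1
        refine eq_zero_of_emb_mul_eq_zero ?_ h1
        rw [invLin_sub _ _ _ one_ne_zero]
        refine mul_ne_zero ?_ (mul_ne_zero (invLin_ne_zero one_ne_zero _)
          (invLin_ne_zero one_ne_zero _))
        rw [Ne, ← map_zero C, C_injective.eq_iff, sub_eq_zero]
        exact fun e => hz'.2 e.symm
      rw [hG, sub_mul, map_sub, map_sub, coeff_C_mul]
      have h2 : coeff p (emb A (invLin 1 z) * coeff q G) = 0 := by
        rw [coeff_mul]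
        refine sum_eq_zero fun x hx => ?_
        rw [HasAntidiagonal.mem_antidiagonal] at hx
        rcases Nat.eq_zero_or_pos x.1 with h0 | h0
        · rw [h0, coeff_zero_emb_invLin, zero_mul]
        · rw [hG0 _ _ (by omega), mul_zero]
      rw [h2, sub_zero]
      cases q with
      | zero => rw [coeff_zero_X_mul, map_zero]
      | succ q => rw [coeff_succ_X_mul, hG0 _ _ (by omega)]
  refine PowerSeries.ext fun q => PowerSeries.ext fun p => ?_
  rw [key (p + q + 1) F Z hZ h p q (by omega)]
  simp

/-- All coefficients of `f` and `g` commute. -/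
def CoeffCommute (f g : A⟦X⟧) : Prop := ∀ p q, Commute (coeff p f) (coeff q g)

/-- The commutator of `f(u)` and `g(v)` is a series in two variables, and it vanishes on the
infinitely many lines `v = u + z`. -/
theorem coeffCommute_of_lin {f g : A⟦X⟧} {Z : Set ℂ} (hZ : Z.Infinite)
    (h : ∀ z ∈ Z, Commute f (lin A 1 z g)) : CoeffCommute f g := by
  have h1 : C f * map C g - map C g * C f = 0 := by
    refine eq_zero_of_evLin_eq_zero hZ fun z hz => ?_
    rw [map_sub, map_mul, map_mul, evLin_C, evLin_map, (h z hz).eq, sub_self]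
  intro p q
  have := congrArg (fun F => coeff p (coeff q F)) h1
  simp only [map_sub, coeff_C_mul, coeff_mul_C, coeff_map, map_zero, sub_eq_zero] at this
  exact this

theorem commute_C_iff {a : A} {g : A⟦X⟧} : Commute (C a) g ↔ ∀ q, Commute a (coeff q g) := by
  constructor
  · intro h q
    have := congrArg (coeff q) h.eq
    rw [coeff_C_mul, coeff_mul_C] at this
    exact this
  · intro h
    refine PowerSeries.ext fun q => ?_
    rw [coeff_C_mul, coeff_mul_C]
    exact h q

theorem commute_lin_of_commute {a : A} {g : A⟦X⟧} (h : Commute (C a) g) (ε c : ℂ) :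
    Commute (C a) (lin A ε c g) := by
  have := h.map (lin A ε c)
  rwa [lin_C] at this

theorem CoeffCommute.commute {f g : A⟦X⟧} (h : CoeffCommute f g) : Commute f g := by
  refine PowerSeries.ext fun d => ?_
  rw [coeff_mul, coeff_mul, ← Nat.sum_antidiagonal_swap]
  exact sum_congr rfl fun x _ => h _ _

theorem CoeffCommute.symm {f g : A⟦X⟧} (h : CoeffCommute f g) : CoeffCommute g f :=
  fun p q => (h q p).symm

theorem CoeffCommute.lin_right {f g : A⟦X⟧} (h : CoeffCommute f g) (ε c : ℂ) :
    CoeffCommute f (lin A ε c g) :=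
  fun p => commute_C_iff.mp (commute_lin_of_commute (commute_C_iff.mpr (h p)) ε c)

theorem CoeffCommute.lin_left {f g : A⟦X⟧} (h : CoeffCommute f g) (ε c : ℂ) :
    CoeffCommute (lin A ε c f) g :=
  (h.symm.lin_right ε c).symm

end Scalars

/-! ### Transport of the quaternary relation -/

section Relation

variable {J J' K W K' W' : Type*} [Fintype J] [DecidableEq J] [CommRing K] [Ring W] [Algebra K W]
  [CommRing K'] [Ring W'] [Algebra K' W'] [InvolutiveNeg J] [InvolutiveNeg J'] {θ : J → J → ℤ}

theorem Quat.map {T T' : Matrix J J W} {α β : K} {α' β' : K'} (h : Quat θ T T' α β) (φ : W →+* W')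
    (hα : φ (algebraMap K W α) = algebraMap K' W' α')
    (hβ : φ (algebraMap K W β) = algebraMap K' W' β') :
    Quat θ (T.map φ) (T'.map φ) α' β' := by
  intro i j k l
  have := congrArg φ (h i j k l)
  simpa only [Algebra.smul_def, map_add, map_sub, map_mul, hα, hβ, map_intCast,
    Matrix.map_apply] using this

theorem Quat.submatrix {T T' : Matrix J J W} {α β : K} (h : Quat θ T T' α β) {f : J' → J}
    (hf : ∀ i, f (-i) = -f i) :
    Quat (fun i j => θ (f i) (f j)) (T.submatrix f f) (T'.submatrix f f) α β := by
  intro i j k l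
  have := h (f i) (f j) (f k) (f l)
  simpa only [Matrix.submatrix_apply, hf] using this

theorem Quat.smul {T T' : Matrix J J W} {α β : K} (h : Quat θ T T' α β) {c c' : W}
    (hc : Commute c c') (h1 : ∀ i j, Commute c (T' i j)) (h2 : ∀ i j, Commute c' (T i j)) :
    Quat θ (c • T) (c' • T') α β := by
  have e1 : ∀ i j k l, c * T i j * (c' * T' k l) = c * c' * (T i j * T' k l) := fun i j k l => by
    rw [mul_assoc, ← mul_assoc (T i j), ← (h2 i j).eq]
    simp only [mul_assoc]
  have e2 : ∀ i j k l, c' * T' i j * (c * T k l) = c * c' * (T' i j * T k l) := fun i j k l => by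
    rw [hc.eq, mul_assoc, ← mul_assoc (T' i j), ← (h1 i j).eq]
    simp only [mul_assoc]
  have e3 : ∀ (n : ℤ) (x : W), (n : W) * (c * c' * x) = c * c' * ((n : W) * x) := fun n x => by
    rw [← mul_assoc, (Int.cast_commute n _).eq, mul_assoc]
  intro i j k l
  have := congrArg (c * c' * ·) (h i j k l)
  have e4 : ∀ (n : K) (x : W), n • (c * c' * x) = c * c' * (n • x) := fun n x =>
    (mul_smul_comm _ _ _).symm
  simp only [Matrix.smul_apply, smul_eq_mul, e1, e2, e3, e4, ← mul_add, ← mul_sub]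
  exact this

end Relation

/-! ### Functorial properties of minors -/

section Minor

variable {ι J K W K' W' : Type*} [Fintype ι] [DecidableEq ι] [Fintype J] [DecidableEq J]
  [CommRing K] [Ring W] [Algebra K W] [CommRing K'] [Ring W'] [Algebra K' W'] [InvolutiveNeg J]
  {θ : J → J → ℤ}

theorem qminor_eq_sum (S : ι → Matrix J J W) (β : ι → ι → K) (l : List ι) (p q : ι → J) :
    qminor θ S β l p q = ∑ σ : Perm ι, (Perm.sign σ : ℤ) • bracket θ S β l (p ∘ σ) q :=
  altOp_mul_apply _ _ _

theorem map_qminor (φ : W →+* W') (S : ι → Matrix J J W) {β : ι → ι → K} {β' : ι → ι → K'}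
    (hβ : ∀ a b, φ (algebraMap K W (β a b)) = algebraMap K' W' (β' a b)) (l : List ι)
    (p q : ι → J) :
    φ (qminor θ S β l p q) = qminor θ (fun a => (S a).map φ) β' l p q := by
  simp only [qminor_eq_sum, ← map_bracket φ S hβ, map_sum, map_zsmul, Matrix.map_apply]

theorem commute_qminor {S : ι → Matrix J J W} (β : ι → ι → K) {w : W} {l : List ι}
    (h : ∀ a ∈ l, ∀ i j, Commute w (S a i j)) (p q : ι → J) : Commute w (qminor θ S β l p q) := by
  rw [qminor_eq_sum]
  exact Commute.sum_right _ _ _ fun σ _ => (commute_bracket_apply β h _ _).smul_right _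

theorem qminor_smul {S : ι → Matrix J J W} (β : ι → ι → K) (c : ι → W) (l : List ι)
    (h : ∀ a ∈ l, ∀ b ∈ l, ∀ i j, Commute (c a) (S b i j)) (p q : ι → J) :
    qminor θ (fun a => c a • S a) β l p q = (l.map c).prod * qminor θ S β l p q := by
  simp only [qminor_eq_sum, bracket_smul β c l h, Matrix.smul_apply, smul_eq_mul, mul_sum,
    mul_smul_comm]

theorem qminor_comp {J' : Type*} [Fintype J'] [DecidableEq J'] [InvolutiveNeg J'] {f : J' → J}
    (hf : f.Injective) (hneg : ∀ i, f (-i) = -f i) (S : ι → Matrix J J W) (β : ι → ι → K)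
    {l : List ι} (hl : l.Nodup) (p q : ι → J') :
    qminor θ S β l (f ∘ p) (f ∘ q) =
      qminor (fun i j => θ (f i) (f j)) (fun a => (S a).submatrix f f) β l p q := by
  simp only [qminor_eq_sum, Function.comp_assoc, bracket_apply_comp hf hneg S β hl]

theorem qminor_of_bijective [Invertible (2 : K)] (hθ : IsSignForm θ) {k : ℕ}
    {S : Fin k → Matrix J J W} {α β : Fin k → Fin k → K} (h : IsQuatFamily θ S α β)
    (hα : ∀ i j : Fin k, (j : ℕ) = i + 1 → α i j = 1) {p p' : Fin k → J} (hp : p.Bijective)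
    (hp' : p'.Bijective) :
    qminor θ S β (List.finRange k) p' p' = qminor θ S β (List.finRange k) p p := by
  obtain ⟨σ, rfl⟩ : ∃ σ : Perm (Fin k), p' = p ∘ σ :=
    ⟨(Equiv.ofBijective p' hp').trans (Equiv.ofBijective p hp).symm, by
      funext c
      exact ((Equiv.ofBijective p hp).apply_symm_apply (p' c)).symm⟩
  rw [qminor_comp_left, qminor_comp_right hθ h hα, smul_smul, ← Units.val_mul, Int.units_mul_self,
    Units.val_one, one_smul]

end Minor

/-! ### Inverting matrices of series -/

section Inverse

variable {A J : Type*} [Ring A] [Fintype J] [DecidableEq J]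

/-- Series with matrix coefficients as matrices with entries in series. -/
def matrixOfSeries (J A : Type*) [Fintype J] [DecidableEq J] [Ring A] :
    (Matrix J J A)⟦X⟧ →+* Matrix J J A⟦X⟧ where
  toFun F := Matrix.of fun i j => PowerSeries.mk fun n => PowerSeries.coeff n F i j
  map_zero' := by
    ext i j n
    simp
  map_one' := by
    ext i j n
    by_cases hij : i = j <;> by_cases hn : n = 0 <;>
      simp [PowerSeries.coeff_one, Matrix.one_apply, hij, hn]
  map_add' F G := by
    ext i j n
    simp
  map_mul' F G := by
    ext i j n
    simp only [Matrix.of_apply, PowerSeries.coeff_mk, Matrix.mul_apply, PowerSeries.coeff_mul,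
      Matrix.sum_apply, map_sum]
    exact sum_comm

/-- A matrix of series is a series of matrices, and a series whose constant term is a unit is
invertible. -/
theorem exists_inverse {S : Matrix J J A⟦X⟧} (h : S.map (PowerSeries.coeff 0) = 1) :
    ∃ T : Matrix J J A⟦X⟧, S * T = 1 ∧ T * S = 1 := by
  set F : (Matrix J J A)⟦X⟧ := PowerSeries.mk fun n => S.map (PowerSeries.coeff n) with hF
  have hS : matrixOfSeries J A F = S := by
    ext i j n
    simp [matrixOfSeries, hF]
  have hF0 : PowerSeries.constantCoeff F = ((1 : (Matrix J J A)ˣ) : Matrix J J A) := by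
    rw [← PowerSeries.coeff_zero_eq_constantCoeff_apply, hF, PowerSeries.coeff_mk, h, Units.val_one]
  refine ⟨matrixOfSeries J A (PowerSeries.invOfUnit F 1), ?_, ?_⟩
  · rw [← hS, ← map_mul, PowerSeries.mul_invOfUnit F 1 hF0, map_one]
  · rw [← hS, ← map_mul, PowerSeries.invOfUnit_mul F 1 hF0, map_one]

theorem map_coeff_zero_inverse {S T : Matrix J J A⟦X⟧} (h : S.map (PowerSeries.coeff 0) = 1)
    (hST : S * T = 1) : T.map (PowerSeries.coeff 0) = 1 := by
  have h1 : (S * T).map (PowerSeries.constantCoeff (R := A)) =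
      S.map (PowerSeries.constantCoeff (R := A)) * T.map (PowerSeries.constantCoeff (R := A)) :=
    Matrix.map_mul
  rw [hST, Matrix.map_one _ (map_zero _) (map_one _)] at h1
  have h2 : S.map (PowerSeries.constantCoeff (R := A)) = 1 := by
    rw [← h]
    ext i j
    simp
  rw [h2, one_mul] at h1
  rw [h1]
  ext i j
  simp

theorem commute_inverse_apply {W : Type*} [Ring W] {S T : Matrix J J W} (h1 : S * T = 1)
    (h2 : T * S = 1) {w : W} (h : ∀ i j, Commute w (S i j)) (i j : J) : Commute w (T i j) := by
  have e1 : Matrix.scalar J w * S = S * Matrix.scalar J w := by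
    ext i j
    simpa using (h i j).eq
  have e2 : Matrix.scalar J w * T = T * Matrix.scalar J w := by
    calc Matrix.scalar J w * T = T * S * (Matrix.scalar J w * T) := by rw [h2, one_mul]
      _ = T * (Matrix.scalar J w * S) * T := by rw [e1]; simp only [mul_assoc]
      _ = T * Matrix.scalar J w * (S * T) := by simp only [mul_assoc]
      _ = _ := by rw [h1, mul_one]
  have := congrFun (congrFun e2 i) j
  have e3 : w * T i j = T i j * w := by simpa using this
  exact e3

end Inverse

/-! ### Matrices of series satisfying the twisted relations -/

section Twisted

open PowerSeries

variable {A J J' : Type*} [Ring A] [Algebra ℂ A] [Fintype J] [DecidableEq J] [InvolutiveNeg J]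
  [Fintype J'] [DecidableEq J'] [InvolutiveNeg J'] {θ : J → J → ℤ}

/-- The matrix of series satisfies the twisted quaternary relation for all pairs of shifts of the
parameter, and its constant term is the identity matrix. -/
structure Twisted (θ : J → J → ℤ) (S : Matrix J J A⟦X⟧) : Prop where
  one : S.map (coeff 0) = 1
  quat : ∀ z : ℂ, z ≠ 0 → Quat θ S (S.map (lin A 1 z)) (C (-z⁻¹) : ℂ⟦X⟧) (invLin 2 z)

theorem map_lin_lin (S : Matrix J J A⟦X⟧) {ε ε' : ℂ} (hε : ε ≠ 0) (hε' : ε' ≠ 0) (c c' : ℂ) :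
    (S.map (lin A ε' c')).map (lin A ε c) = S.map (lin A (ε' * ε) (ε' * c + c')) := by
  ext1 i j
  exact lin_lin hε hε' c c' _

theorem map_lin_mul (S T : Matrix J J A⟦X⟧) (ε c : ℂ) :
    (S * T).map (lin A ε c) = S.map (lin A ε c) * T.map (lin A ε c) :=
  Matrix.map_mul

theorem map_lin_one (ε c : ℂ) :
    (1 : Matrix J J A⟦X⟧).map (lin A ε c) = 1 :=
  Matrix.map_one _ (map_zero _) (map_one _)

theorem map_lin_mul_eq_one {S T : Matrix J J A⟦X⟧} (h : S * T = 1) (ε c : ℂ) :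
    S.map (lin A ε c) * T.map (lin A ε c) = 1 := by
  rw [← map_lin_mul, h, map_lin_one]

theorem map_lin_one_zero (S : Matrix J J A⟦X⟧) : S.map (lin A 1 0) = S := by
  ext1 i j
  exact lin_one_zero _

theorem lin_algebraMap_invLin {ε ε' : ℂ} (hε : ε ≠ 0) (hε' : ε' ≠ 0) (c c' : ℂ) :
    lin A ε c (algebraMap ℂ⟦X⟧ A⟦X⟧ (invLin ε' c')) =
      algebraMap ℂ⟦X⟧ A⟦X⟧ (invLin (ε' * ε) (ε' * c + c')) := by
  rw [algebraMap_eq_emb, lin_emb, lin_invLin hε hε']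

theorem lin_algebraMap_C (ε c a : ℂ) :
    lin A ε c (algebraMap ℂ⟦X⟧ A⟦X⟧ (C a)) = algebraMap ℂ⟦X⟧ A⟦X⟧ (C a) := by
  rw [algebraMap_eq_emb, emb_C, lin_C]

theorem Twisted.quat_lin {S : Matrix J J A⟦X⟧} (h : Twisted θ S) {c c' : ℂ} (hc : c ≠ c') :
    Quat θ (S.map (lin A 1 c)) (S.map (lin A 1 c')) (C (c - c')⁻¹ : ℂ⟦X⟧) (invLin 2 (c + c')) := by
  have := (h.quat (c' - c) (sub_ne_zero.mpr hc.symm)).map (lin A 1 c)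
    (α' := (C (c - c')⁻¹ : ℂ⟦X⟧)) (β' := invLin 2 (c + c')) ?_ ?_
  · rwa [map_lin_lin _ one_ne_zero one_ne_zero, one_mul, one_mul, add_sub_cancel] at this
  · rw [lin_algebraMap_C, ← inv_neg, neg_sub]
  · rw [lin_algebraMap_invLin one_ne_zero two_ne_zero, mul_one]
    congr 2
    ring

theorem invLin_two_yangBaxter {a b : ℂ} (hab : a ≠ b) (j : ℂ) :
    invLin 2 (j + a) * invLin 2 (j + b) =
      C (a - b)⁻¹ * (invLin 2 (j + b) - invLin 2 (j + a)) := by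
  rw [invLin_sub _ _ _ two_ne_zero, ← mul_assoc, ← map_mul, add_sub_add_left_eq_sub,
    inv_mul_cancel₀ (sub_ne_zero.mpr hab), map_one, one_mul, mul_comm]

theorem Twisted.isQuatFamily {ι : Type*} {S : Matrix J J A⟦X⟧} (h : Twisted θ S) {c : ι → ℂ}
    (hc : c.Injective) : IsQuatFamily θ (fun a => S.map (lin A 1 (c a)))
      (fun a b => (C (c a - c b)⁻¹ : ℂ⟦X⟧)) fun a b => invLin 2 (c a + c b) where
  symm a b := by rw [add_comm]
  quat a b hab := h.quat_lin (hc.ne hab)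
  yangBaxter a b j hab _ _ := invLin_two_yangBaxter (hc.ne hab) _

theorem Twisted.submatrix {S : Matrix J J A⟦X⟧} (h : Twisted θ S) {f : J' → J}
    (hf : f.Injective) (hneg : ∀ i, f (-i) = -f i) :
    Twisted (fun i j => θ (f i) (f j)) (S.submatrix f f) where
  one := by
    rw [← Matrix.submatrix_map, h.one, Matrix.submatrix_one f hf]
  quat z hz := (h.quat z hz).submatrix hneg

/-- For `x = εu + c` these are the coefficients `1/x` and `-1/(x + n)` of `Q` in a factor and in its
inverse when `Q² = nQ`. -/
theorem invLin_inverse_relation {ε c n : ℂ} (hε : ε ≠ 0) :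
    invLin ε c + invLin (-ε) (-(c + n)) + C n * (invLin ε c * invLin (-ε) (-(c + n))) = 0 := by
  have h1 := invLin_mul hε c
  have h2 := invLin_mul (neg_ne_zero.mpr hε) (-(c + n))
  refine mul_right_cancel₀ (lin_ne_zero hε c)
    (mul_right_cancel₀ (lin_ne_zero (neg_ne_zero.mpr hε) (-(c + n))) ?_)
  simp only [map_neg, map_add] at h2 ⊢
  linear_combination (-C ε - (C c + C n) * X) * h1 + (C ε + C c * X) * h2 + C n *
    ((invLin (-ε) (-(c + n))) * (-C ε - (C c + C n) * X) * h1 + X * h2)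

/-- Inversion exchanges the two parameters and replaces `1/(2u + z)` by `-1/(2u + z + |J|)`. The
substitution `u ↦ -u - z - |J|/2` undoes both changes. -/
theorem Twisted.inverse (hθ : IsSignForm θ) {S T : Matrix J J A⟦X⟧} (h : Twisted θ S)
    (h1 : S * T = 1) (h2 : T * S = 1) :
    Twisted θ (T.map (lin A (-1) (-((Fintype.card J : ℂ) / 2)))) where
  one := by
    rw [← map_coeff_zero_inverse h.one h1]
    ext1 i j
    exact coeff_zero_lin _ _ _
  quat z hz := by
    set n : ℂ := (Fintype.card J : ℂ) with hn
    have hn' : ((Fintype.card J : ℕ) : ℂ⟦X⟧) = C n := by rw [hn, map_natCast]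
    have h3 := (h.quat z hz).inverse hθ h1 h2 (map_lin_mul_eq_one h1 1 z)
      (map_lin_mul_eq_one h2 1 z) (β' := invLin (-2) (-(z + n)))
      (by rw [hn']; exact invLin_inverse_relation two_ne_zero)
    have h4 := h3.map (lin A (-1) (-z - n / 2)) (α' := (C (-z⁻¹) : ℂ⟦X⟧)) (β' := invLin 2 z)
      (lin_algebraMap_C _ _ _) ?_
    · rw [map_lin_lin _ (neg_ne_zero.mpr one_ne_zero) one_ne_zero] at h4
      rw [map_lin_lin _ one_ne_zero (neg_ne_zero.mpr one_ne_zero)]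
      convert h4 using 3 <;> ring_nf
    · rw [lin_algebraMap_invLin (neg_ne_zero.mpr one_ne_zero) (neg_ne_zero.mpr two_ne_zero)]
      congr 2 <;> ring

theorem Twisted.smul {S : Matrix J J A⟦X⟧} (h : Twisted θ S) {c : A⟦X⟧} (hc0 : coeff 0 c = 1)
    (hc : CoeffCommute c c) (hcS : ∀ i j, CoeffCommute c (S i j)) : Twisted θ (c • S) where
  one := by
    rw [← h.one]
    ext i j
    simp only [coeff_zero_eq_constantCoeff] at hc0 ⊢
    simp [hc0]
  quat z hz := by
    have := (h.quat z hz).smul (c := c) (c' := lin A 1 z c) (hc.lin_right 1 z).commute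
      (fun i j => ((hcS i j).lin_right 1 z).commute) fun i j => ((hcS i j).lin_left 1 z).commute
    convert this using 1
    ext1 i j
    simp

end Twisted

/-! ### Sklyanin minors of a matrix of series -/

section SeriesMinors

open PowerSeries

instance invertibleTwoSeries : Invertible (2 : ℂ⟦X⟧) where
  invOf := C (2⁻¹ : ℂ)
  invOf_mul_self := by
    rw [← map_ofNat (C : ℂ →+* ℂ⟦X⟧) 2, ← map_mul, inv_mul_cancel₀ two_ne_zero, map_one]
  mul_invOf_self := by
    rw [← map_ofNat (C : ℂ →+* ℂ⟦X⟧) 2, ← map_mul, mul_inv_cancel₀ two_ne_zero, map_one]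

variable {A J J' : Type*} [Ring A] [Algebra ℂ A] [Fintype J] [DecidableEq J] [InvolutiveNeg J]
  [Fintype J'] [DecidableEq J'] [InvolutiveNeg J'] {θ : J → J → ℤ}

/-- The Sklyanin minors of a matrix of series. -/
def sminor (θ : J → J → ℤ) (S : Matrix J J A⟦X⟧) {k : ℕ} (p q : Fin k → J) : A⟦X⟧ :=
  qminor θ (fun a : Fin k => S.map (lin A 1 (-(a : ℂ))))
    (fun a b => invLin 2 (-(a : ℂ) + -(b : ℂ))) (List.finRange k) p q

theorem neg_natCast_injective (k : ℕ) : Function.Injective fun a : Fin k => -((a : ℕ) : ℂ) :=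
  fun a b h => Fin.ext (by simpa using h)

theorem inv_neg_sub_neg_eq_one {k : ℕ} {i j : Fin k} (h : (j : ℕ) = i + 1) :
    (C (-(i : ℂ) - -(j : ℂ))⁻¹ : ℂ⟦X⟧) = 1 := by
  rw [h]
  simp

theorem lin_sminor (S : Matrix J J A⟦X⟧) {ε : ℂ} (hε : ε ≠ 0) (c : ℂ) {k : ℕ} (p q : Fin k → J) :
    lin A ε c (sminor θ S p q) = qminor θ (fun a : Fin k => S.map (lin A ε (c + -(a : ℂ))))
      (fun a b => invLin (2 * ε) (2 * c + (-(a : ℂ) + -(b : ℂ)))) (List.finRange k) p q := by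
  rw [sminor, map_qminor (lin A ε c) _ (β' := fun a b : Fin k =>
    invLin (2 * ε) (2 * c + (-(a : ℂ) + -(b : ℂ))))
    (fun a b => lin_algebraMap_invLin hε two_ne_zero _ _)]
  congr 1
  funext a
  rw [map_lin_lin _ hε one_ne_zero, one_mul, one_mul]

theorem sminor_comp {f : J' → J} (hf : f.Injective) (hneg : ∀ i, f (-i) = -f i)
    (S : Matrix J J A⟦X⟧) {k : ℕ} (p q : Fin k → J') :
    sminor θ S (f ∘ p) (f ∘ q) =
      sminor (fun i j => θ (f i) (f j)) (S.submatrix f f) p q :=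
  qminor_comp hf hneg _ _ (List.nodup_finRange _) _ _

theorem Twisted.sminor_of_bijective (hθ : IsSignForm θ) {S : Matrix J J A⟦X⟧} (h : Twisted θ S)
    {k k' : ℕ} {p : Fin k → J} {p' : Fin k' → J} (hp : p.Bijective) (hp' : p'.Bijective) :
    sminor θ S p' p' = sminor θ S p p := by
  obtain rfl : k = k' := by
    rw [← Fintype.card_fin k, Fintype.card_of_bijective hp, ← Fintype.card_of_bijective hp',
      Fintype.card_fin]
  exact qminor_of_bijective hθ (h.isQuatFamily (neg_natCast_injective k))
    (fun _ _ => inv_neg_sub_neg_eq_one) hp hp'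

theorem sminor_zero (S : Matrix J J A⟦X⟧) (p q : Fin 0 → J) : sminor θ S p q = 1 := by
  rw [sminor, qminor_eq_sum, Fintype.sum_unique]
  simp [bracket, Subsingleton.elim p q]

/-- Modulo `u⁻¹` the matrix is the identity and all coefficients of `Q` vanish, so only the diagonal
entry of the antisymmetrizer is left. -/
theorem coeff_zero_sminor {S : Matrix J J A⟦X⟧} (h : S.map (coeff 0) = 1) {k : ℕ} {p : Fin k → J}
    (hp : p.Injective) : coeff 0 (sminor θ S p p) = 1 := by
  rw [coeff_zero_eq_constantCoeff_apply, sminor, map_qminor (constantCoeff (R := A)) _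
    (β' := fun _ _ : Fin k => (0 : ℂ)) (fun a b => ?_), qminor]
  · have h1 : (fun a : Fin k => (S.map (lin A 1 (-(a : ℂ)))).map (constantCoeff (R := A))) =
        fun _ => 1 := by
      funext a
      rw [← h]
      ext i j
      rw [Matrix.map_apply, Matrix.map_apply, Matrix.map_apply,
        ← coeff_zero_eq_constantCoeff_apply, coeff_zero_lin]
    have h2 : ∀ l : List (Fin k), bracket θ (fun _ : Fin k => (1 : Matrix J J A))
        (fun _ _ : Fin k => (0 : ℂ)) l = 1 := by
      intro l
      induction l with
      | nil => rfl
      | cons a l ih =>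
        rw [bracket, ih, siteOp_one, one_mul, mul_one, rtProd]
        refine List.prod_eq_one fun x hx => ?_
        obtain ⟨b, -, rfl⟩ := List.mem_map.mp hx
        simp [rtOp]
    rw [h1, h2, mul_one, altOp_apply_self hp]
  · rw [algebraMap_eq_emb, ← coeff_zero_eq_constantCoeff_apply, coeff_zero_emb_invLin, map_zero]

theorem commute_sminor {S : Matrix J J A⟦X⟧} {a : A} (h : ∀ i j, Commute (C a) (S i j)) {k : ℕ}
    (p q : Fin k → J) : Commute (C a) (sminor θ S p q) :=
  commute_qminor _ (fun _ _ _ _ => commute_lin_of_commute (h _ _) _ _) _ _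

theorem coeffCommute_sminor {S : Matrix J J A⟦X⟧} {f : A⟦X⟧} (h : ∀ i j, CoeffCommute f (S i j))
    {k : ℕ} (p q : Fin k → J) : CoeffCommute f (sminor θ S p q) := fun n =>
  commute_C_iff.mp (commute_sminor (fun i j => commute_C_iff.mpr (h i j n)) p q)

/-- The Sklyanin determinant of a multiple of a matrix. -/
theorem sminor_smul {S : Matrix J J A⟦X⟧} {c : A⟦X⟧} (h : ∀ i j, CoeffCommute c (S i j)) {k : ℕ}
    (p q : Fin k → J) : sminor θ (c • S) p q =
      ((List.finRange k).map fun a : Fin k => lin A 1 (-(a : ℂ)) c).prod * sminor θ S p q := by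
  rw [sminor, sminor, ← qminor_smul]
  · congr 1
    funext a
    ext1 i j
    simp
  · exact fun a _ b _ i j => (((h i j).lin_left _ _).lin_right _ _).commute

/-- For non-real `z` no difference of `u` and `u + z - i` is an integer, which keeps the parameters
distinct and the factors `1 - α`, `1 - α²` invertible. -/
theorem infinite_setOf_im_ne_zero : {z : ℂ | z.im ≠ 0}.Infinite :=
  Set.infinite_of_injective_forall_mem (f := fun n : ℕ => ((n : ℂ) + 1) * Complex.I)
    (fun a b h => by simpa using h)
    fun n => by
      simp only [Set.mem_ofPred_eq, Complex.mul_im, Complex.add_re, Complex.natCast_re,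
        Complex.one_re, Complex.I_im, Complex.I_re, mul_one, mul_zero, add_zero]
      positivity

/-- The parameters `u, u + z, u + z - 1, …`. -/
def genericParam (z : ℂ) (m : ℕ) : Fin (m + 1) → ℂ :=
  Fin.cons (α := fun _ => ℂ) 0 fun i : Fin m => z + -((i : ℕ) : ℂ)

theorem genericParam_injective {z : ℂ} (hz : z.im ≠ 0) (m : ℕ) :
    (genericParam z m).Injective := by
  rw [genericParam, Fin.cons_injective_iff]
  constructor
  · rintro ⟨i, hi⟩
    exact hz (by simpa using congrArg Complex.im hi)
  · intro a b h
    exact Fin.ext (by simpa using h)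

theorem ofReal_sub_ne_zero {z : ℂ} (hz : z.im ≠ 0) (x : ℝ) : (x : ℂ) - z ≠ 0 := fun h =>
  hz (by simpa using congrArg Complex.im h)

theorem inv_zero_sub_genericParam (z : ℂ) (i : ℕ) :
    (0 - (z + -(i : ℂ)))⁻¹ = (((i : ℝ) : ℂ) - z)⁻¹ := by
  congr 1
  push_cast
  ring

theorem lin_sminor_genericParam (S : Matrix J J A⟦X⟧) (z : ℂ) {m : ℕ} (p q : Fin m → J) :
    qminor θ ((fun a => S.map (lin A 1 (genericParam z m a))) ∘ Fin.succ)
      (fun a b : Fin m => invLin 2 (genericParam z m a.succ + genericParam z m b.succ))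
      (List.finRange m) p q = lin A 1 z (sminor θ S p q) := by
  rw [lin_sminor _ one_ne_zero]
  congr 1
  funext a b
  rw [genericParam, Fin.cons_succ, Fin.cons_succ, mul_one]
  congr 1
  ring

theorem isUnit_C {c : ℂ} (hc : c ≠ 0) : IsUnit (C c : ℂ⟦X⟧) := hc.isUnit.map C

/-- The coefficients of the minors with indices in `B` commute with the entries of the inverse
matrix with indices outside of `B`. -/
theorem Twisted.coeffCommute_inverse (hθ : IsSignForm θ) {S T : Matrix J J A⟦X⟧}
    (h : Twisted θ S) (h1 : S * T = 1) (h2 : T * S = 1) {m : ℕ} {B : Fin m → J} {a b : J}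
    (ha : a ∉ Set.range B) (hb : b ∉ Set.range B) (ha' : ∀ i, a ≠ -B i) (hb' : ∀ i, b ≠ -B i) :
    CoeffCommute (T a b) (sminor θ S B B) := by
  refine coeffCommute_of_lin infinite_setOf_im_ne_zero fun z hz => ?_
  have h0 : S.map (lin A 1 (genericParam z m 0)) = S := map_lin_one_zero S
  have := commute_inverse_qminor hθ (h.isQuatFamily (genericParam_injective hz m)) (fun i => ?_)
    (S' := T) (by rw [h0]; exact h1) (by rw [h0]; exact h2) ha hb ha' hb'
  · rwa [lin_sminor_genericParam] at this
  · simp only [genericParam, Fin.cons_zero, Fin.cons_succ]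
    rw [inv_zero_sub_genericParam, ← map_pow, ← map_one C, ← map_sub]
    -- `α = 1/(i - z)` squares to `1` only if `i - z = ±1`, impossible for non-real `z`.
    refine isUnit_C fun e => ?_
    have e1 : (((i : ℕ) : ℝ) : ℂ) - z ≠ 0 := ofReal_sub_ne_zero hz _
    have e2 := ofReal_sub_ne_zero hz ((i : ℕ) - 1 : ℝ)
    have e3 := ofReal_sub_ne_zero hz ((i : ℕ) + 1 : ℝ)
    push_cast at e1 e2 e3 e
    rw [inv_pow, sub_eq_zero, eq_comm, inv_eq_one] at e
    exact mul_ne_zero e2 e3 (by linear_combination e)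

theorem invLin_two_step (z : ℂ) (n : ℂ) :
    invLin 2 (0 + (z + -n)) * (1 - C n * invLin 2 z) = invLin 2 z := by
  have h1 := invLin_mul two_ne_zero (0 + (z + -n))
  have h2 := invLin_mul two_ne_zero z
  refine mul_right_cancel₀ (lin_ne_zero two_ne_zero (0 + (z + -n)))
    (mul_right_cancel₀ (lin_ne_zero two_ne_zero z) ?_)
  simp only [map_add, map_neg, map_zero] at h1 ⊢
  linear_combination (C 2 + C z * X - C n * (invLin 2 z) * (C 2 + C z * X)) * h1 -
    (C n * X + C 2 + (C z - C n) * X) * h2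

/-- The coefficients of the Sklyanin determinant are central. -/
theorem Twisted.coeffCommute_of_bijective (hθ : IsSignForm θ) {S : Matrix J J A⟦X⟧}
    (h : Twisted θ S) {m : ℕ} {B : Fin m → J} (hB : B.Bijective) (a b : J) :
    CoeffCommute (S a b) (sminor θ S B B) := by
  refine coeffCommute_of_lin infinite_setOf_im_ne_zero fun z hz => ?_
  have h0 : S.map (lin A 1 (genericParam z m 0)) = S := map_lin_one_zero S
  have hne : ∀ i : ℕ, (i : ℂ) - z ≠ 0 := fun i => by simpa using ofReal_sub_ne_zero hz (i : ℝ)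
  have := commute_qminor_of_bijective hθ (h.isQuatFamily (genericParam_injective hz m))
    (fun i j hij => ?_) (fun i j hij => ?_) (fun i => ?_) (β₀ := invLin 2 z) ?_ (fun i => ?_) hB a b
  · rw [lin_sminor_genericParam, h0] at this
    exact this
  · simp only [genericParam, Fin.cons_succ]
    rw [hij, ← map_one C]
    congr 1
    push_cast
    ring_nf
  · simp only [genericParam, Fin.cons_succ, Fin.cons_zero]
    rw [inv_zero_sub_genericParam, inv_zero_sub_genericParam, ← map_one C, ← map_add, ← map_mul, hij]
    congr 1
    have e1 := hne i
    have e2 := hne (i + 1)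
    push_cast at e2 ⊢
    field_simp
    ring
  · simp only [genericParam, Fin.cons_succ, Fin.cons_zero]
    rw [inv_zero_sub_genericParam, ← map_one C, ← map_sub]
    refine isUnit_C fun e => ?_
    have e1 := hne i
    have e2 := ofReal_sub_ne_zero hz ((i : ℕ) - 1 : ℝ)
    push_cast at e2 e
    rw [sub_eq_zero, eq_comm, inv_eq_one] at e
    exact e2 (by linear_combination e)
  · rw [isUnit_iff_constantCoeff]
    have := coeff_zero_invLin 2 z
    rw [coeff_zero_eq_constantCoeff_apply] at this
    simp [this]
  · simp only [genericParam, Fin.cons_succ, Fin.cons_zero]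
    have := invLin_two_step z (i : ℕ)
    rwa [map_natCast] at this

end SeriesMinors

/-! ### Schur complements of twisted matrices -/

section Sylvester

open PowerSeries

variable {A J J₁ J₂ : Type*} [Ring A] [Algebra ℂ A] [Fintype J] [DecidableEq J] [InvolutiveNeg J]
  [Fintype J₁] [DecidableEq J₁] [InvolutiveNeg J₁] [Fintype J₂] [DecidableEq J₂]
  [InvolutiveNeg J₂] {θ : J → J → ℤ}

/-- A partition of the set of indices into two subsets closed under negation. -/
structure IsSplitting (f₁ : J₁ → J) (f₂ : J₂ → J) : Prop where
  inj_left : f₁.Injective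
  inj_right : f₂.Injective
  neg_left : ∀ i, f₁ (-i) = -f₁ i
  neg_right : ∀ i, f₂ (-i) = -f₂ i
  ne : ∀ i j, f₁ i ≠ f₂ j
  mem : ∀ j, j ∈ Set.range f₁ ∨ j ∈ Set.range f₂

theorem IsSignForm.comp (hθ : IsSignForm θ) {f : J₁ → J} (hf : ∀ i, f (-i) = -f i) :
    IsSignForm fun i j => θ (f i) (f j) where
  self _ := hθ.self _
  mul _ _ _ := hθ.mul _ _ _
  symm _ _ := hθ.symm _ _
  neg _ _ := by rw [hf, hf, hθ.neg]

/-- The Sklyanin determinant of the inverse matrix gives complementary minors. -/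
theorem Twisted.sminor_complement (hθ : IsSignForm θ) {S T : Matrix J J A⟦X⟧} (h : Twisted θ S)
    (h1 : S * T = 1) {m r : ℕ} {p : Fin (m + r) → J} (hp : p.Bijective)
    (hneg : ∀ i j, p (Fin.castAdd r i) ≠ -p (Fin.natAdd m j)) :
    sminor θ S (p ∘ Fin.castAdd r) (p ∘ Fin.castAdd r) =
      sminor θ S p p * lin A (-1) ((Fintype.card J : ℂ) / 2 - 1)
        (sminor θ (T.map (lin A (-1) (-((Fintype.card J : ℂ) / 2))))
          (p ∘ Fin.natAdd m ∘ Fin.rev) (p ∘ Fin.natAdd m ∘ Fin.rev)) := by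
  have hcard : (Fintype.card J : ℂ) = m + r := by
    rw [← Fintype.card_of_bijective hp, Fintype.card_fin]
    push_cast
    rfl
  have hcard' : ((Fintype.card J : ℕ) : ℂ⟦X⟧) = C ((m : ℂ) + r) := by
    rw [← hcard, map_natCast]
  have key := qminor_complement hθ (h.isQuatFamily (neg_natCast_injective (m + r)))
    (fun _ _ => inv_neg_sub_neg_eq_one) hp hneg
    -- The inverse of `S` at the `j`-th of the last `r` sites, where the parameter is `u - m - j`;
    -- correspondingly `β'` is the coefficient of `Q` in the inverse factor.
    (S' := fun j => T.map (lin A 1 (-((m : ℂ) + (j : ℕ)))))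
    (β' := fun i j => invLin (-2) ((m : ℂ) + (i : ℕ) + (j : ℕ) - r)) (fun j => ?_)
    (fun a b => by rw [add_right_comm]) (fun i j _ => ?_)
  · refine (Eq.trans ?_ key).trans ?_
    · rfl
    · rw [lin_sminor _ (neg_ne_zero.mpr one_ne_zero), List.finRange_reverse,
        -- Relabelling the sites by `a ↦ r - 1 - a` makes the reversed product a genuine minor: with
        -- `F(w) = T(-w - |J|/2)` and `w = -u + |J|/2 - 1` the matrix at site `a` is `F(w - a)`.
        show (List.finRange r).map Fin.rev = (List.finRange r).map Fin.revPerm from rfl,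
        qminor_map_equiv, sminor]
      congr 1
      have hrev : ∀ a : Fin r, (((Fin.rev a : Fin r) : ℕ) : ℂ) = r - 1 - (a : ℕ) := by
        intro a
        rw [Fin.val_rev, Nat.cast_sub a.2]
        push_cast
        ring
      congr 1
      · funext a
        rw [map_lin_lin _ (neg_ne_zero.mpr one_ne_zero) (neg_ne_zero.mpr one_ne_zero),
          Function.comp_apply, Fin.revPerm_apply, hrev, hcard]
        congr 2 <;> ring_nf
      · funext a b
        rw [Fin.revPerm_apply, Fin.revPerm_apply, hrev, hrev, hcard]
        congr 1 <;> ring_nf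
  · rw [Fin.val_natAdd]
    push_cast
    exact map_lin_mul_eq_one h1 _ _
  · rw [hcard', Fin.val_natAdd, Fin.val_natAdd]
    convert invLin_inverse_relation (n := (m : ℂ) + r) two_ne_zero using 4
    · push_cast
      ring
    · push_cast
      ring


/-- The matrix of Sklyanin minors with rows `B, a` and columns `B, b`. -/
def sharpOf (θ : J → J → ℤ) (S : Matrix J J A⟦X⟧) {m : ℕ} (B : Fin m → J) (f₂ : J₂ → J) :
    Matrix J₂ J₂ A⟦X⟧ :=
  Matrix.of fun a b => sminor θ S (Fin.snoc (α := fun _ => J) B (f₂ a))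
    (Fin.snoc (α := fun _ => J) B (f₂ b))

variable {f₁ : J₁ → J} {f₂ : J₂ → J}

/-- The sum over all columns is known from `sum_qminor_snoc_mul`; columns from the first block
repeat an index and contribute zero minors, leaving a matrix product over the second block. -/
theorem Twisted.sharpOf_mul (hθ : IsSignForm θ) {S T : Matrix J J A⟦X⟧} (h : Twisted θ S)
    (h1 : S * T = 1) (hf : IsSplitting f₁ f₂) {m : ℕ} {p₁ : Fin m → J₁} (hp₁ : p₁.Bijective) :
    sharpOf θ S (f₁ ∘ p₁) f₂ * (T.submatrix f₂ f₂).map (lin A 1 (-(m : ℂ))) =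
      sminor θ S (f₁ ∘ p₁) (f₁ ∘ p₁) • (1 : Matrix J₂ J₂ A⟦X⟧) := by
  have hnot : ∀ a, f₂ a ∉ Set.range (f₁ ∘ p₁) := by
    rintro a ⟨i, hi⟩
    exact hf.ne _ _ hi
  ext1 a b
  have key := sum_qminor_snoc_mul (θ := θ) (S := fun a : Fin (m + 1) => S.map (lin A 1 (-(a : ℂ))))
    (fun a b => invLin 2 (-(a : ℂ) + -(b : ℂ))) (S' := T.map (lin A 1 (-(m : ℂ))))
    (B := f₁ ∘ p₁) (a := f₂ a) (b := f₂ b) (by rw [Fin.val_last]; exact map_lin_mul_eq_one h1 _ _)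
    (hf.inj_left.comp hp₁.1) (hnot a) (hnot b) fun i => by
      rw [← hf.neg_right]
      exact hf.ne _ _
  rw [Matrix.mul_apply, Matrix.smul_apply, Matrix.one_apply, smul_ite, smul_eq_mul, mul_one,
    smul_zero]
  have hab : (f₂ a = f₂ b) = (a = b) := propext hf.inj_right.eq_iff
  simp only [hab] at key
  refine Eq.trans ?_ key
  refine sum_of_injOn f₂ hf.inj_right.injOn (by simp) (fun j _ hj => ?_) fun j _ => rfl
  obtain ⟨i, rfl⟩ := (hf.mem j).resolve_right fun hj' => hj (by simpa using hj')
  obtain ⟨i, rfl⟩ := hp₁.2 i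
  rw [qminor_eq_zero hθ (h.isQuatFamily (neg_natCast_injective (m + 1)))
    (fun _ _ => inv_neg_sub_neg_eq_one), zero_mul]
  intro hinj
  have := @hinj i.castSucc (Fin.last m) (by simp)
  exact (Fin.castSucc_lt_last i).ne this

theorem IsSplitting.card_eq (hf : IsSplitting f₁ f₂) :
    Fintype.card J = Fintype.card J₁ + Fintype.card J₂ := by
  rw [← Fintype.card_sum]
  refine (Fintype.card_of_bijective (f := Sum.elim f₁ f₂) ⟨?_, fun j => ?_⟩).symm
  · rintro (i | i) (j | j) hij
    · exact congrArg _ (hf.inj_left hij)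
    · exact absurd hij (hf.ne _ _)
    · exact absurd hij.symm (hf.ne _ _)
    · exact congrArg _ (hf.inj_right hij)
  · rcases hf.mem j with ⟨i, rfl⟩ | ⟨i, rfl⟩
    · exact ⟨Sum.inl i, rfl⟩
    · exact ⟨Sum.inr i, rfl⟩

theorem IsSplitting.append_bijective (hf : IsSplitting f₁ f₂) {m r : ℕ} {p₁ : Fin m → J₁}
    (hp₁ : p₁.Bijective) {p₂ : Fin r → J₂} (hp₂ : p₂.Bijective) :
    (Fin.append (f₁ ∘ p₁) (f₂ ∘ p₂)).Bijective := by
  rw [Fintype.bijective_iff_surjective_and_card, hf.card_eq, Fintype.card_fin,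
    ← Fintype.card_of_bijective hp₁, ← Fintype.card_of_bijective hp₂, Fintype.card_fin,
    Fintype.card_fin]
  refine ⟨fun j => ?_, rfl⟩
  rcases hf.mem j with ⟨i, rfl⟩ | ⟨i, rfl⟩
  · obtain ⟨i, rfl⟩ := hp₁.2 i
    exact ⟨Fin.castAdd r i, by simp⟩
  · obtain ⟨i, rfl⟩ := hp₂.2 i
    exact ⟨Fin.natAdd m i, by simp⟩

/-- The matrix of minors is, up to a commuting factor, a twisted matrix whose Sklyanin determinant
is a quotient of Sklyanin determinants. -/
theorem Twisted.exists_schur (hθ : IsSignForm θ) {S : Matrix J J A⟦X⟧} (h : Twisted θ S)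
    (hf : IsSplitting f₁ f₂) {m r : ℕ} {p₁ : Fin m → J₁} (hp₁ : p₁.Bijective) {p₂ : Fin r → J₂}
    (hp₂ : p₂.Bijective) {N : ℕ} {p : Fin N → J}
    (hp : p.Bijective) :
    ∃ D : Matrix J₂ J₂ A⟦X⟧, Twisted (fun i j => θ (f₂ i) (f₂ j)) D ∧
      (∀ a b, CoeffCommute (sminor θ S (f₁ ∘ p₁) (f₁ ∘ p₁)) (D a b)) ∧
      (sharpOf θ S (f₁ ∘ p₁) f₂).map (lin A 1 ((m : ℂ) / 2)) =
        lin A 1 ((m : ℂ) / 2) (sminor θ S (f₁ ∘ p₁) (f₁ ∘ p₁)) • D ∧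
      lin A 1 ((m : ℂ) / 2) (sminor θ S p p) =
        lin A 1 ((m : ℂ) / 2) (sminor θ S (f₁ ∘ p₁) (f₁ ∘ p₁)) *
          sminor (fun i j => θ (f₂ i) (f₂ j)) D p₂ p₂ := by
  obtain ⟨T, h1, h2⟩ := exists_inverse h.one
  have hT0 := map_coeff_zero_inverse h.one h1
  have hT20 : (T.submatrix f₂ f₂).map (coeff 0) = 1 := by
    rw [← Matrix.submatrix_map, hT0, Matrix.submatrix_one f₂ hf.inj_right]
  obtain ⟨E, hE1, hE2⟩ := exists_inverse hT20
  set g := sminor θ S (f₁ ∘ p₁) (f₁ ∘ p₁) with hg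
  have hm : Fintype.card J₁ = m := by rw [← Fintype.card_of_bijective hp₁, Fintype.card_fin]
  have hr : Fintype.card J₂ = r := by rw [← Fintype.card_of_bijective hp₂, Fintype.card_fin]
  have hN : (Fintype.card J : ℂ) = m + r := by
    rw [hf.card_eq, hm, hr]
    push_cast
    rfl
  have hne1 : (-1 : ℂ) ≠ 0 := neg_ne_zero.mpr one_ne_zero
  have hnot : ∀ a, f₂ a ∉ Set.range (f₁ ∘ p₁) := by
    rintro a ⟨i, hi⟩
    exact hf.ne _ _ hi
  have hnotneg : ∀ a i, f₂ a ≠ -(f₁ ∘ p₁) i := by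
    intro a i e
    rw [Function.comp_apply, ← hf.neg_left] at e
    exact hf.ne _ _ e.symm
  have hθ2 := hθ.comp hf.neg_right
  have hF := (h.inverse hθ h1 h2).submatrix hf.inj_right hf.neg_right
  set κ : ℂ := -((Fintype.card J : ℂ) / 2) with hκ
  have hFE1 : (T.map (lin A (-1) κ)).submatrix f₂ f₂ * E.map (lin A (-1) κ) = 1 :=
    map_lin_mul_eq_one hE1 _ _
  have hFE2 : E.map (lin A (-1) κ) * (T.map (lin A (-1) κ)).submatrix f₂ f₂ = 1 :=
    map_lin_mul_eq_one hE2 _ _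
  have hD := hF.inverse hθ2 hFE1 hFE2
  -- The two reflections from inverting at sizes `m + r` and `r` compose to the shift `u ↦ u - m/2`.
  have hDE : (E.map (lin A (-1) κ)).map (lin A (-1) (-((Fintype.card J₂ : ℂ) / 2))) =
      E.map (lin A 1 (-((m : ℂ) / 2))) := by
    rw [map_lin_lin _ hne1 hne1, hκ, hN, hr]
    congr 2 <;> ring_nf
  -- `g` commutes with the entries of the block of `T`, hence with those of its inverse.
  have hgE : ∀ a b, CoeffCommute g (E a b) := by
    intro a b n
    refine commute_C_iff.mp (commute_inverse_apply hE1 hE2 (fun i j => ?_) a b)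
    exact commute_C_iff.mpr fun q => ((h.coeffCommute_inverse hθ h1 h2 (hnot i) (hnot j)
      (hnotneg i) (hnotneg j)).symm n q)
  refine ⟨E.map (lin A 1 (-((m : ℂ) / 2))), hDE ▸ hD, fun a b => (hgE a b).lin_right _ _, ?_, ?_⟩
  · have e1 : sharpOf θ S (f₁ ∘ p₁) f₂ = g • E.map (lin A 1 (-(m : ℂ))) := by
      calc sharpOf θ S (f₁ ∘ p₁) f₂ = sharpOf θ S (f₁ ∘ p₁) f₂ *
            ((T.submatrix f₂ f₂).map (lin A 1 (-(m : ℂ))) * E.map (lin A 1 (-(m : ℂ)))) := by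
            rw [map_lin_mul_eq_one hE1, mul_one]
        _ = _ := by
            rw [← mul_assoc, h.sharpOf_mul hθ h1 hf hp₁, smul_mul_assoc, one_mul]
    rw [e1]
    ext1 a b
    simp only [Matrix.map_apply, Matrix.smul_apply, smul_eq_mul, map_mul]
    rw [lin_lin one_ne_zero one_ne_zero, one_mul, one_mul,
      show (m : ℂ) / 2 + -m = -((m : ℂ) / 2) by ring]
  · set d := sminor (fun i j => θ (f₂ i) (f₂ j)) ((T.map (lin A (-1) κ)).submatrix f₂ f₂)
      p₂ p₂ with hd
    have e1 : g = sminor θ S p p * lin A (-1) ((Fintype.card J : ℂ) / 2 - 1) d := by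
      have hb := hf.append_bijective hp₁ hp₂
      have := h.sminor_complement hθ h1 hb fun i j => by
        rw [Fin.append_left, Fin.append_right, Function.comp_apply, Function.comp_apply,
          ← hf.neg_right]
        exact hf.ne _ _
      have c1 : Fin.append (f₁ ∘ p₁) (f₂ ∘ p₂) ∘ Fin.castAdd r = f₁ ∘ p₁ := by
        funext i
        simp
      have c2 : Fin.append (f₁ ∘ p₁) (f₂ ∘ p₂) ∘ Fin.natAdd m ∘ Fin.rev = f₂ ∘ p₂ ∘ Fin.rev := by
        funext i
        simp
      rw [c1, c2, sminor_comp hf.inj_right hf.neg_right, ← hκ,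
        hF.sminor_of_bijective hθ2 hp₂ (hp₂.comp Fin.rev_bijective)] at this
      rw [hg, this, hd]
      rw [h.sminor_of_bijective hθ hp hb]
    -- The complementary minor identity for the block of the inverse, with an empty first group of
    -- sites, whose minor is `1`.
    have e2 : d * lin A (-1) ((Fintype.card J₂ : ℂ) / 2 - 1)
        (sminor (fun i j => θ (f₂ i) (f₂ j)) (E.map (lin A 1 (-((m : ℂ) / 2)))) p₂ p₂) = 1 := by
      have hcast : (Fin.cast (Nat.zero_add r)).Bijective := (finCongr (Nat.zero_add r)).bijective
      have hq : (p₂ ∘ Fin.cast (Nat.zero_add r)).Bijective := hp₂.comp hcast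
      have := hF.sminor_complement hθ2 hFE1 hq fun i => i.elim0
      have hq' : (p₂ ∘ Fin.cast (Nat.zero_add r) ∘ Fin.natAdd 0 ∘ Fin.rev).Bijective := by
        refine hp₂.comp ?_
        convert Fin.rev_bijective (n := r) using 1
        funext i
        ext
        simp
      rw [sminor_zero, hDE, hF.sminor_of_bijective hθ2 hp₂ hq, Function.comp_assoc,
        (hDE ▸ hD : Twisted _ _).sminor_of_bijective hθ2 hp₂ hq'] at this
      exact this.symm
    -- The substitutions bring `d` to the argument it has in `e1` after the shift by `m/2`, and
    -- return the determinant of the Schur complement to the argument `u`.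
    have e3 := congrArg (lin A 1 ((m : ℂ) / 2))
      (congrArg (lin A (-1) ((Fintype.card J : ℂ) / 2 - 1)) e2)
    rw [map_mul, map_one, map_mul, map_one, lin_lin hne1 hne1, neg_one_mul, neg_neg,
      lin_lin one_ne_zero one_ne_zero, one_mul, one_mul, hN, hr,
      show (m : ℂ) / 2 + (-1 * (((m : ℂ) + r) / 2 - 1) + ((r : ℂ) / 2 - 1)) = 0 by ring,
      lin_one_zero] at e3
    rw [e1, map_mul, mul_assoc, hN, e3, mul_one]

end Sylvester

/-! ### Comparison with the stated definitions and the defining relations -/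

section DefiningRelations

open PowerSeries

variable {A B : Type*} [Ring A] [Algebra ℂ A] [Ring B] [Algebra ℂ B] {I : IndexSet}
  {t : CaseType}

instance involutiveNegIdx (I : IndexSet) : InvolutiveNeg I.Idx where
  neg := Neg.neg
  neg_neg i := Subtype.ext (neg_neg i.1)

/-- The signs `θ_ij` on a set of indices. -/
def thetaIdx (t : CaseType) (I : IndexSet) (i j : I.Idx) : ℤ := theta t i j

theorem coe_neg_idx (i : I.Idx) : ((-i : I.Idx) : ℤ) = -(i : ℤ) := rfl

/-- The index `0` has to be excluded in the symplectic case, since its sign `0` would break `θ_ii =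
1`. -/
theorem isSignForm_thetaIdx (h : t = CaseType.symplectic → (0 : ℤ) ∉ I.carrier) :
    IsSignForm (thetaIdx t I) := by
  cases t with
  | orthogonal => constructor <;> intros <;> simp [thetaIdx, theta]
  | symplectic =>
    have h1 : ∀ i : I.Idx, (i : ℤ).sign * (i : ℤ).sign = 1 := by
      intro i
      have hi : (i : ℤ) ≠ 0 := fun e => h rfl (e ▸ i.2)
      rcases lt_or_gt_of_ne hi with hi | hi
      · simp [Int.sign_eq_neg_one_of_neg hi]
      · simp [Int.sign_eq_one_of_pos hi]
    constructor
    · exact h1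
    · intro i j k
      simp only [thetaIdx, theta]
      linear_combination ((i : ℤ).sign * (k : ℤ).sign) * h1 j
    · intro i j
      exact mul_comm _ _
    · intro i j
      simp [thetaIdx, theta, coe_neg_idx]

theorem ite_eq_ite_of_decidable {R : Type*} {P : Prop} (d d' : Decidable P) (x y : R) :
    @ite R P d x y = @ite R P d' x y := by
  congr

theorem onSite_eq {k : ℕ} (S : Matrix I.Idx I.Idx A⟦X⟧) (a : Fin k) : onSite S a = siteOp S a := by
  ext1 p q
  exact ite_eq_ite_of_decidable _ _ _ _

theorem opQ_eq {k : ℕ} (a b : Fin k) :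
    opQ A t a b = pairOp A⟦X⟧ (thetaIdx t I) a b := by
  ext1 p q
  exact ite_eq_ite_of_decidable _ _ _ _

theorem antisymmetrizer_eq (k : ℕ) : antisymmetrizer A I k = altOp (Fin k) I.Idx A⟦X⟧ := by
  refine sum_congr rfl fun σ _ => congrArg _ ?_
  ext1 p q
  exact ite_eq_ite_of_decidable _ _ _ _

theorem opRt_eq {k : ℕ} (a b : Fin k) : opRt A t a b =
    rtOp A⟦X⟧ (thetaIdx t I) (fun a b : Fin k => invLin 2 (-(a : ℂ) + -(b : ℂ))) a b := by
  rw [opRt, rtOp, invTwoSub_eq_emb, neg_add, opQ_eq]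
  rfl

theorem filter_finRange_eq {k : ℕ} {l l' : List (Fin k)} {a : Fin k}
    (h : List.finRange k = l ++ a :: l') :
    (List.finRange k).filter (fun b => a < b) = l' := by
  have hs : (List.finRange k).Pairwise (· < ·) := List.pairwise_lt_finRange k
  rw [h, List.pairwise_append, List.pairwise_cons] at hs
  rw [h, List.filter_append, List.filter_cons_of_neg (by simp), List.filter_eq_nil_iff.mpr,
    List.nil_append, List.filter_eq_self.mpr]
  · intro b hb
    simpa using hs.2.1.1 b hb
  · intro b hb
    simpa using (hs.2.2 b hb a (by simp)).le

theorem bracketProd_eq (S : Matrix I.Idx I.Idx A⟦X⟧) (k : ℕ) : bracketProd t S k =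
    bracket (thetaIdx t I) (fun a : Fin k => S.map (lin A 1 (-(a : ℂ))))
      (fun a b => invLin 2 (-(a : ℂ) + -(b : ℂ))) (List.finRange k) := by
  -- Induction over final segments of the list of sites: behind `a` the filter `a < b` selects
  -- exactly the rest of the segment.
  have key : ∀ l' l : List (Fin k), List.finRange k = l ++ l' →
      (l'.map fun a : Fin k => onSite (fun i j => shift (-((a : ℕ) : ℂ)) (S i j)) a *
        (((List.finRange k).filter fun b : Fin k => a < b).map
          fun b : Fin k => opRt A t a b).prod).prod =
      bracket (thetaIdx t I) (fun a : Fin k => S.map (lin A 1 (-(a : ℂ))))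
        (fun a b => invLin 2 (-(a : ℂ) + -(b : ℂ))) l' := by
    intro l'
    induction l' with
    | nil => intro l _; rfl
    | cons a l' ih =>
      intro l hl
      rw [List.map_cons, List.prod_cons, ih (l ++ [a]) (by simpa using hl), bracket,
        filter_finRange_eq hl, rtProd]
      congr 2
      · refine (onSite_eq _ a).trans (congrArg (siteOp · a) ?_)
        ext1 i j
        exact shift_eq_lin _ _
      · congr 1
        exact List.map_congr_left fun b _ => opRt_eq a b
  exact key _ [] rfl

theorem sklyaninMinor_eq (S : Matrix I.Idx I.Idx A⟦X⟧) {k : ℕ} (p q : Fin k → I.Idx) :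
    sklyaninMinor t S p q = sminor (thetaIdx t I) S p q := by
  rw [sklyaninMinor, bracketProd_eq, antisymmetrizer_eq, sminor, qminor]

theorem enum_bijective (I : IndexSet) : I.enum.Bijective :=
  (I.carrier.orderIsoOfFin rfl).bijective

theorem sdet_eq (S : Matrix I.Idx I.Idx A⟦X⟧) :
    sdet t S = sminor (thetaIdx t I) S I.enum I.enum :=
  sklyaninMinor_eq S _ _

/-! ### The defining relations -/

/-- At `v = u + z` the relation may be divided by `u² - v²`: the coefficients `u + v`, `u - v` and
`1` become `α = 1/(u - v)`, `β = 1/(u + v)` and `αβ`, which is the expanded quaternary relation. -/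
theorem evLin_relLHS_sub_relRHS (hθ : IsSignForm (thetaIdx t I)) (S : Matrix I.Idx I.Idx A⟦X⟧)
    {z : ℂ} (hz : z ≠ 0) (i j k l : I.Idx) :
    let θ := thetaIdx t I
    let T := S
    let T' := S.map (lin A 1 z)
    let α : ℂ⟦X⟧ := C (-z⁻¹)
    let β := invLin 2 z
    evLin A 1 z (relLHS S i j k l - relRHS t S i j k l) =
      emb A (invLin 1 z ^ 2 - X ^ 2) *
      (T i j * T' k l + β • (((θ (-j) k : ℤ) : A⟦X⟧) * (T i (-k) * T' (-j) l))
      - α • (T k j * T' i l + β • (((θ (-j) i : ℤ) : A⟦X⟧) * (T k (-i) * T' (-j) l))) -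
      (T' k l * T i j + β • (((θ l (-i) : ℤ) : A⟦X⟧) * (T' k (-i) * T (-l) j))
      - α • (T' k j * T i l + β • (((θ j (-i) : ℤ) : A⟦X⟧) * (T' k (-i) * T (-j) l))))) := by
  intro θ T T' α β
  set η := invLin 1 z with hη
  have hη1 : η - X = -C z * (X * η) := by
    have := invLin_mul one_ne_zero z
    rw [map_one] at this
    linear_combination this
  have hβ1 : β * (X + η) = X * η := by
    have h1 := invLin_mul one_ne_zero z
    have h2 := invLin_mul two_ne_zero z
    have h3 : (C 2 : ℂ⟦X⟧) = 1 + C 1 := by rw [← map_one C, ← map_add]; norm_num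
    rw [h3] at h2
    refine mul_right_cancel₀ (lin_ne_zero one_ne_zero z) ?_
    simp only [map_one] at h1 h2 ⊢
    linear_combination X * h2 + (β - X) * h1
  have hz' : C z * (C (-z⁻¹) : ℂ⟦X⟧) = -1 := by
    rw [← map_mul, mul_neg, mul_inv_cancel₀ hz, map_neg, map_one]
  -- These three identities perform the division by `u² - v²`, with `X = u⁻¹` and `η = v⁻¹`.
  have r1 : X * η * (X + η) = (η ^ 2 - X ^ 2) * α := by
    linear_combination -(X + η) * α * hη1 + X * η * (X + η) * hz'
  have r2 : X * η * (η - X) = (η ^ 2 - X ^ 2) * β := by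
    linear_combination -(η - X) * hβ1
  have r3 : X ^ 2 * η ^ 2 = (η ^ 2 - X ^ 2) * α * β := by
    linear_combination β * r1 - X * η * hβ1
  have s1 := congrArg (emb A) r1
  have s2 := congrArg (emb A) r2
  have s3 := congrArg (emb A) r3
  simp only [map_mul, map_add, map_sub, map_pow, emb_X] at s1 s2 s3
  have t1 : (theta t k (-j : I.Idx) : ℤ) = θ (-j) k := hθ.symm k (-j)
  have t2 : (theta t i (-l : I.Idx) : ℤ) = θ l (-i) := by
    exact (hθ.symm i (-l)).trans ((hθ.neg (-l) i).symm.trans (by rw [neg_neg]))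
  have t3 : (theta t i (-j : I.Idx) : ℤ) = θ (-j) i := hθ.symm i (-j)
  have t4 : θ j (-i) = θ (-j) i :=
    (hθ.neg j (-i)).symm.trans (by rw [neg_neg])
  rw [relLHS, relRHS]
  simp only [coe_neg_idx] at t1 t2 t3
  simp only [t1, t2, t3, t4, map_sub, map_add, map_mul, map_pow, map_intCast, evLin_X, evLin_C,
    evLin_map, emb_X, ← hη, s1, s2, s3, smul_eq_emb_mul]
  have hT' : ∀ a b, T' a b = lin A 1 z (S a b) := fun _ _ => rfl
  simp only [hT', T]
  simp only [mul_sub, mul_add, sub_mul, mul_assoc]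
  abel

theorem relLHS_eq_relRHS_iff (hθ : IsSignForm (thetaIdx t I)) (S : Matrix I.Idx I.Idx A⟦X⟧) :
    (∀ i j k l, relLHS S i j k l = relRHS t S i j k l) ↔
      ∀ z : ℂ, z ≠ 0 → Quat (thetaIdx t I) S (S.map (lin A 1 z)) (C (-z⁻¹) : ℂ⟦X⟧)
        (invLin 2 z) := by
  constructor
  · intro h z hz i j k l
    have h1 := evLin_relLHS_sub_relRHS hθ S hz i j k l
    rw [h, sub_self, map_zero] at h1
    refine sub_eq_zero.mp (eq_zero_of_emb_mul_eq_zero ?_ h1.symm)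
    have h2 := invLin_mul one_ne_zero z
    have h3 := invLin_ne_zero one_ne_zero z
    rw [map_one] at h2
    rw [sq_sub_sq]
    refine mul_ne_zero (fun e => ?_) (fun e => ?_)
    · refine mul_ne_zero X_ne_zero (lin_ne_zero two_ne_zero z) ?_
      have h4 : (C 2 : ℂ⟦X⟧) = 1 + C 1 := by rw [← map_one C, ← map_add]; norm_num
      rw [h4, map_one]
      linear_combination (1 + C z * X) * e - h2
    · rw [sub_eq_zero] at e
      rw [e, mul_add, mul_one, add_eq_left] at h2
      exact mul_ne_zero X_ne_zero (mul_ne_zero (by simpa using hz) X_ne_zero) h2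
  · intro h i j k l
    refine sub_eq_zero.mp (eq_zero_of_evLin_eq_zero (Z := {0}ᶜ) (Set.finite_singleton _).infinite_compl
      fun z hz => ?_)
    rw [evLin_relLHS_sub_relRHS hθ S hz, sub_eq_zero.mpr (h z hz i j k l), mul_zero]

theorem twisted_of_rel (hθ : IsSignForm (thetaIdx t I)) {S : Matrix I.Idx I.Idx A⟦X⟧}
    (h1 : S.map (coeff 0) = 1) (h : ∀ i j k l, relLHS S i j k l = relRHS t S i j k l) :
    Twisted (thetaIdx t I) S :=
  ⟨h1, (relLHS_eq_relRHS_iff hθ S).mp h⟩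

theorem Twisted.rel (hθ : IsSignForm (thetaIdx t I)) {S : Matrix I.Idx I.Idx A⟦X⟧}
    (h : Twisted (thetaIdx t I) S) (i j k l : I.Idx) : relLHS S i j k l = relRHS t S i j k l :=
  (relLHS_eq_relRHS_iff hθ S).mpr h.quat i j k l

end DefiningRelations

/-! ### The universal property of the extended twisted Yangian -/

section Homomorphisms

open PowerSeries

variable {A B : Type*} [Ring A] [Ring B] {I : IndexSet} {t : CaseType}

theorem map_map_C (g : A →+* B) (f : A⟦X⟧) :
    PowerSeries.map (PowerSeries.map g) (PowerSeries.map (C (R := A)) f) =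
      PowerSeries.map (C (R := B)) (PowerSeries.map g f) := by
  refine PowerSeries.ext fun q => ?_
  simp

theorem map_relLHS (g : A →+* B) (S : Matrix I.Idx I.Idx A⟦X⟧) (i j k l : I.Idx) :
    PowerSeries.map (PowerSeries.map g) (relLHS S i j k l) =
      relLHS (S.map (PowerSeries.map g)) i j k l := by
  simp only [relLHS, map_mul, map_sub, map_pow, map_X, map_C, map_map_C, Matrix.map_apply]

theorem map_relRHS (g : A →+* B) (S : Matrix I.Idx I.Idx A⟦X⟧) (i j k l : I.Idx) :
    PowerSeries.map (PowerSeries.map g) (relRHS t S i j k l) =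
      relRHS t (S.map (PowerSeries.map g)) i j k l := by
  simp only [relRHS, map_mul, map_sub, map_add, map_pow, map_X, map_C, map_map_C,
    Matrix.map_apply, map_intCast]

theorem coeff_zero_freeSeries (I : IndexSet) : (freeSeries I).map (coeff 0) = 1 := by
  ext1 i j
  simp [freeSeries, Matrix.one_apply]

theorem coeff_zero_genMatrix (t : CaseType) (I : IndexSet) :
    (genMatrix t I).map (coeff 0) = 1 := by
  ext1 i j
  have := congrFun (congrFun (coeff_zero_freeSeries I) i) j
  rw [Matrix.map_apply] at this ⊢
  rw [genMatrix, coeff_map, this, Matrix.one_apply, Matrix.one_apply]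
  split_ifs <;> simp

theorem genMatrix_rel (t : CaseType) (I : IndexSet) (i j k l : I.Idx) :
    relLHS (genMatrix t I) i j k l = relRHS t (genMatrix t I) i j k l := by
  have h : genMatrix t I =
      (freeSeries I).map (PowerSeries.map (proj t I : FreeGen I →+* ExtYangian t I)) := rfl
  rw [h, ← map_relLHS, ← map_relRHS]
  refine PowerSeries.ext fun q => PowerSeries.ext fun p => ?_
  simp only [coeff_map]
  exact RingQuot.mkAlgHom_rel ℂ ⟨i, j, k, l, p, q, rfl, rfl⟩

variable [Algebra ℂ A]

theorem existsUnique_hom {S : Matrix I.Idx I.Idx A⟦X⟧} (h1 : S.map (coeff 0) = 1)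
    (h : ∀ i j k l, relLHS S i j k l = relRHS t S i j k l) :
    ∃! φ : ExtYangian t I →ₐ[ℂ] A, ∀ a b,
      PowerSeries.map (φ : ExtYangian t I →+* A) (genMatrix t I a b) = S a b := by
  set f : FreeGen I →ₐ[ℂ] A :=
    -- The label `r` of a free generator stands for the coefficient of `u⁻¹` to the power `r + 1`;
    -- the constant terms are not generators and are supplied by `h1`.
    FreeAlgebra.lift ℂ fun x : I.Idx × I.Idx × ℕ => coeff (x.2.2 + 1) (S x.1 x.2.1) with hf
  have hfS : (freeSeries I).map (PowerSeries.map (f : FreeGen I →+* A)) = S := by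
    ext i j n
    rw [Matrix.map_apply, coeff_map]
    cases n with
    | zero =>
      have e1 := congrFun (congrFun (coeff_zero_freeSeries I) i) j
      have e2 := congrFun (congrFun h1 i) j
      rw [Matrix.map_apply] at e1 e2
      rw [e1, e2, Matrix.one_apply, Matrix.one_apply]
      split_ifs <;> simp
    | succ n => simp [freeSeries, hf]
  have hrel : ∀ ⦃x y : FreeGen I⦄, Rel t I x y → f x = f y := by
    rintro x y ⟨i, j, k, l, p, q, rfl, rfl⟩
    have e := h i j k l
    rw [← hfS, ← map_relLHS, ← map_relRHS] at e
    have := congrArg (fun F => coeff p (coeff q F)) e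
    simp only [coeff_map] at this
    exact this
  refine ⟨(RingQuot.liftAlgHom ℂ ⟨f, hrel⟩ : RingQuot (Rel t I) →ₐ[ℂ] A), fun a b => ?_,
    fun ψ hψ => ?_⟩
  · rw [← hfS]
    refine PowerSeries.ext fun n => ?_
    rw [genMatrix, Matrix.map_apply, coeff_map, coeff_map, coeff_map]
    exact RingQuot.liftAlgHom_mkAlgHom_apply ℂ f hrel _
  · refine RingQuot.ringQuot_ext' ℂ (ψ : RingQuot (Rel t I) →ₐ[ℂ] A) _ ?_
    refine FreeAlgebra.hom_ext (funext fun x => ?_)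
    obtain ⟨i, j, r⟩ := x
    have e1 := congrArg (coeff (r + 1)) (hψ i j)
    rw [genMatrix, coeff_map, coeff_map] at e1
    simp only [Function.comp_apply, AlgHom.comp_apply, RingQuot.liftAlgHom_mkAlgHom_apply]
    refine Eq.trans ?_ (e1.trans ?_)
    · simp [freeSeries]
      rfl
    · simp [hf]

end Homomorphisms

/-! ### Cardinalities and complements of the index sets -/

section IndexSets

theorem card_indexSet (N : ℕ) : (indexSet N).carrier.card = N := by
  have hIcc : (Finset.Icc (-((N / 2 : ℕ) : ℤ)) ((N / 2 : ℕ) : ℤ)).card = 2 * (N / 2) + 1 := by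
    rw [Int.card_Icc]
    omega
  rcases Nat.even_or_odd N with h | h
  · have : (indexSet N).carrier = (Finset.Icc (-((N / 2 : ℕ) : ℤ)) ((N / 2 : ℕ) : ℤ)).erase 0 := by
      ext i
      simp only [indexSet, mem_filter, mem_erase, ← Nat.not_even_iff_odd, h, not_true, or_false]
      exact and_comm
    rw [this, card_erase_of_mem (by rw [mem_Icc]; omega), hIcc]
    have := Nat.two_mul_div_two_of_even h
    omega
  · have : (indexSet N).carrier = Finset.Icc (-((N / 2 : ℕ) : ℤ)) ((N / 2 : ℕ) : ℤ) := by
      ext i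
      simp [indexSet, h]
    rw [this, hIcc]
    exact Nat.two_mul_div_two_add_one_of_odd h

theorem card_compl {I J : IndexSet} (h : J.carrier ⊆ I.carrier) :
    (I.compl J).carrier.card = I.carrier.card - J.carrier.card :=
  card_sdiff_of_subset h

theorem zero_notMem_indexSet {N : ℕ} (h : Even N) : (0 : ℤ) ∉ (indexSet N).carrier := by
  simp [indexSet, h]

theorem isSplitting_indexSet {I J : IndexSet} (h : J.carrier ⊆ I.carrier) :
    IsSplitting (IndexSet.incl h) (IndexSet.complIncl I J) where
  inj_left a b hab := Subtype.ext (by simpa [IndexSet.incl] using hab)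
  inj_right a b hab := Subtype.ext (by simpa [IndexSet.complIncl] using hab)
  neg_left _ := rfl
  neg_right _ := rfl
  ne i j hij := by
    have := congrArg Subtype.val hij
    exact (Finset.mem_sdiff.mp j.2).2 (this ▸ i.2)
  mem j := by
    by_cases hj : (j : ℤ) ∈ J.carrier
    · exact Or.inl ⟨⟨j, hj⟩, rfl⟩
    · exact Or.inr ⟨⟨j, Finset.mem_sdiff.mpr ⟨j.2, hj⟩⟩, rfl⟩

end IndexSets

/-! ### The Sylvester theorem -/

section Sharp

open PowerSeries

variable {A : Type*} [Ring A] [Algebra ℂ A] {t : CaseType}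

theorem sharpMatrix_eq {N M : ℕ} (h : (indexSet M).carrier ⊆ (indexSet N).carrier)
    (S : Matrix (indexSet N).Idx (indexSet N).Idx A⟦X⟧) :
    sharpMatrix t h S = (sharpOf (thetaIdx t (indexSet N)) S
      (IndexSet.incl h ∘ (indexSet M).enum) (IndexSet.complIncl (indexSet N) (indexSet M))).map
        (lin A 1 ((M : ℂ) / 2)) := by
  ext1 a b
  rw [sharpMatrix, Matrix.map_apply, ← shift_eq_lin, sklyaninMinor_eq]
  rfl

theorem prod_map_finRange_succ {R : Type*} [Monoid R] (f : ℕ → R) {k n : ℕ} (hk : k = n + 1) :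
    ((List.finRange k).map fun a : Fin k => f a).prod =
      f 0 * ((List.range n).map fun i => f (i + 1)).prod := by
  have : ((List.finRange k).map fun a : Fin k => f a) = (List.range k).map f := by
    rw [← List.map_coe_finRange_eq_range, List.map_map]
    rfl
  rw [this, hk, List.range_succ_eq_map, List.map_cons, List.prod_cons, List.map_map]
  rfl

/-- The quantum Sylvester theorem for an arbitrary matrix satisfying the twisted relations. -/
theorem Twisted.sylvester {N M : ℕ} (hMN : M < N) (hpar : Even M ↔ Even N)
    (hsymp : t = CaseType.symplectic → Even N)
    {S : Matrix (indexSet N).Idx (indexSet N).Idx A⟦X⟧}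
    (hS : Twisted (thetaIdx t (indexSet N)) S) :
    Twisted (thetaIdx t ((indexSet N).compl (indexSet M)))
        (sharpMatrix t (indexSet_subset hMN.le hpar) S) ∧
      sdet t (sharpMatrix t (indexSet_subset hMN.le hpar) S) =
        shift ((M : ℂ) / 2) (sdet t S) *
          ((List.range (N - M - 1)).map fun i : ℕ =>
            shift ((M : ℂ) / 2 - ((i : ℂ) + 1))
              (sdet t (subMatrix (indexSet_subset hMN.le hpar) S))).prod := by
  set h := indexSet_subset hMN.le hpar with hh
  have hθ : IsSignForm (thetaIdx t (indexSet N)) :=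
    isSignForm_thetaIdx fun ht => zero_notMem_indexSet (hsymp ht)
  have hf := isSplitting_indexSet h
  have hcard : ((indexSet M).carrier.card : ℂ) = M := by rw [card_indexSet]
  obtain ⟨D, hD, hcD, hsharp, hdet⟩ := hS.exists_schur hθ hf (enum_bijective (indexSet M))
    (enum_bijective ((indexSet N).compl (indexSet M))) (enum_bijective (indexSet N))
  have hg : sdet t (subMatrix h S) = sminor (thetaIdx t (indexSet N)) S
      (IndexSet.incl h ∘ (indexSet M).enum) (IndexSet.incl h ∘ (indexSet M).enum) := by
    rw [sdet_eq, sminor_comp hf.inj_left hf.neg_left]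
    rfl
  rw [← hg, hcard] at hsharp hdet
  rw [← hg] at hcD
  rw [← sharpMatrix_eq] at hsharp
  rw [← sdet_eq] at hdet
  set g := sdet t (subMatrix h S) with hgdef
  have hg0 : coeff 0 g = 1 := by
    rw [hg]
    exact coeff_zero_sminor hS.one (hf.inj_left.comp (enum_bijective _).1)
  -- `g` is the Sklyanin determinant of the block on ℬ, so it commutes with the entries of that
  -- block, and `g` is itself built from these entries.
  have hgg : CoeffCommute g g := by
    have h1 := hS.submatrix hf.inj_left hf.neg_left
    have h2 := h1.coeffCommute_of_bijective (hθ.comp hf.neg_left) (enum_bijective (indexSet M))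
    have h3 : sminor (fun i j => thetaIdx t (indexSet N) (IndexSet.incl h i) (IndexSet.incl h j))
        (S.submatrix (IndexSet.incl h) (IndexSet.incl h)) (indexSet M).enum (indexSet M).enum = g :=
      (sdet_eq _).symm
    rw [h3] at h2
    have h4 := coeffCommute_sminor
      (θ := fun i j => thetaIdx t (indexSet N) (IndexSet.incl h i) (IndexSet.incl h j))
      (fun i j => (h2 i j).symm) (indexSet M).enum (indexSet M).enum
    rwa [h3] at h4
  set s : ℂ := (M : ℂ) / 2 with hs
  have hcD' : ∀ a b, CoeffCommute (lin A 1 s g) (D a b) := fun a b => (hcD a b).lin_left _ _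
  refine ⟨?_, ?_⟩
  · rw [hsharp]
    exact hD.smul ((coeff_zero_lin _ _ _).trans hg0) ((hgg.lin_left _ _).lin_right _ _) hcD'
  · have hr : ((indexSet N).compl (indexSet M)).carrier.card = N - M - 1 + 1 := by
      rw [card_compl h, card_indexSet, card_indexSet]
      omega
    have e1 : sdet t (sharpMatrix t h S) =
        ((List.finRange ((indexSet N).compl (indexSet M)).carrier.card).map
          fun a : Fin _ => lin A 1 (-((a : ℕ) : ℂ)) (lin A 1 s g)).prod *
        sminor (thetaIdx t ((indexSet N).compl (indexSet M))) D
          ((indexSet N).compl (indexSet M)).enum ((indexSet N).compl (indexSet M)).enum := by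
      rw [sdet_eq, hsharp, sminor_smul hcD']
    have e2 := prod_map_finRange_succ (fun n : ℕ => lin A 1 (-(n : ℂ)) (lin A 1 s g)) hr
    -- The factor of `g` without further shift pairs with the determinant of `D` to form the shifted
    -- `sdet t S`; the remaining factors only have to be moved past the determinant of `D`.
    rw [e1, e2, shift_eq_lin, hdet, mul_assoc, mul_assoc]
    congr 1
    · rw [Nat.cast_zero, neg_zero, lin_one_zero]
    · have e3 : ∀ i : ℕ, lin A 1 (-((i + 1 : ℕ) : ℂ)) (lin A 1 s g) = shift (s - ((i : ℂ) + 1)) g := by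
        intro i
        rw [lin_lin one_ne_zero one_ne_zero, shift_eq_lin, one_mul, one_mul]
        congr 2
        push_cast
        ring
      simp only [e3]
      refine Commute.list_prod_left _ _ fun x hx => ?_
      obtain ⟨i, -, rfl⟩ := List.mem_map.mp hx
      rw [shift_eq_lin]
      exact (coeffCommute_sminor (fun a b => (hcD a b).lin_left 1 _) _ _).commute

end Sharp

end TwistedYangian

end

theorem theorem2p6 (t : CaseType) (N M : ℕ) (hMN : M < N) (hpar : Even M ↔ Even N)
    (hsymp : t = CaseType.symplectic → Even N) :
    (∃! φ : ExtYangian t ((indexSet N).compl (indexSet M)) →ₐ[ℂ] ExtYangian t (indexSet N),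
      ∀ a b : ((indexSet N).compl (indexSet M)).Idx,
        PowerSeries.map
            (φ : ExtYangian t ((indexSet N).compl (indexSet M)) →+* ExtYangian t (indexSet N))
            (genMatrix t ((indexSet N).compl (indexSet M)) a b)
          = sharpMatrix t (indexSet_subset hMN.le hpar) (genMatrix t (indexSet N)) a b) ∧
    sdet t (sharpMatrix t (indexSet_subset hMN.le hpar) (genMatrix t (indexSet N)))
      = shift ((M : ℂ) / 2) (sdet t (genMatrix t (indexSet N))) *
        ((List.range (N - M - 1)).map fun i : ℕ =>
          shift ((M : ℂ) / 2 - ((i : ℂ) + 1))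
            (sdet t (subMatrix (indexSet_subset hMN.le hpar) (genMatrix t (indexSet N))))).prod := by
  have hθ : IsSignForm (thetaIdx t (indexSet N)) :=
    isSignForm_thetaIdx fun ht => zero_notMem_indexSet (hsymp ht)
  have hθ' : IsSignForm (thetaIdx t ((indexSet N).compl (indexSet M))) :=
    isSignForm_thetaIdx fun ht h0 =>
      zero_notMem_indexSet (hsymp ht) (Finset.mem_sdiff.mp h0).1
  have hS := twisted_of_rel hθ (coeff_zero_genMatrix t (indexSet N)) (genMatrix_rel t (indexSet N))
  obtain ⟨h1, h2⟩ := hS.sylvester hMN hpar hsymp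
  exact ⟨existsUnique_hom h1.one (h1.rel hθ'), h2⟩
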